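/- Let $A$ be a (unital associative) ring, $P(A)$ the category of finitely generated projective left $A$-modules, and $B : P(A)^{op}\times P(A)\to \mathbf{Ab}$ a functor. For a functor $F$ from $P(A)$ or from $P(A)^{op}$ to abelian groups, let $\Delta F$ be the functor defined by the canonical splitting $F(V\oplus A)\simeq F(V)\oplus(\Delta F)(V)$; $F$ is polynomial of degree $\le d$ if $\Delta^{d+1}F=0$. Write $HH_*(P(A);B)$ and $HH^*(P(A);B)$ for the Hochschild homology and cohomology of the category $P(A)$ with coefficients in $B$, computed by the standard complexes with $i$-chains $\bigoplus_{x_0\to\cdots\to x_i}B(x_i,x_0)$ and $i$-cochains $\prod_{x_0\to\cdots\to x_i}B(x_0,x_i)$. For $n\in\mathbb N$, let $\mathbb Z[M_n(A)]$ be the ring of the multiplicative monoid $M_n(A)=\mathrm{End}_A(A^n)$, and let $HH_*(\mathbb Z[M_n(A)];B(A^n,A^n))$ and $HH^*(\mathbb Z[M_n(A)];B(A^n,A^n))$ be the Hochschild homology and cohomology of this ring with coefficients in the bimodule $B(A^n,A^n)$. Let $d\in\mathbb N$. Suppose that $B$ is polynomial of degree $\le d$ in one of its variables: either $B(-,V)$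 is polynomial of degree $\le d$ for all $V$ in $P(A)$, or $B(U,-)$ is polynomial of degree $\le d$ for all $U$ in $P(A)$. Then for all $i,n\in\mathbb N$: 1. the canonical morphism $HH_i(\mathbb Z[M_n(A)];B(A^n,A^n))\to HH_i(P(A);B)$ is surjective for $n\ge d(i+1)$ and bijective for $n\ge d(i+2)$; 2. the canonical morphism $HH^i(P(A);B)\to HH^i(\mathbb Z[M_n(A)];B(A^n,A^n))$ is injective for $n\ge d(i+1)$ and bijective for $n\ge d(i+2)$; 3. the stabilization morphism $HH_i(\mathbb Z[M_n(A)];B(A^n,A^n))\to HH_i(\mathbb Z[M_{n+1}(A)];B(A^{n+1},A^{n+1}))$, induced by $M_n(A)\to M_{n+1}(A)$, $g\mapsto\mathrm{diag}(g,1)$, and by the map $B(A^n,A^n)\to B(A^{n+1},A^{n+1})$ given by the projection $A^{n+1}\to A^n$ in the first variable and the inclusion $A^n\to A^{n+1}$ in the second, is surjective for $n\ge d(i+2)-1$ and bijective for $n\ge d(i+2)$. The canonical morphisms in 1 and 2 are those induced by the functor to $P(A)$, with value $A^n$, from the one-object category with endomorphism monoid $M_n(A)$. -/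

import Mathlib

open CategoryTheory Opposite
open scoped Simplicial TensorProduct DirectSum

universe u v w

namespace MatrixMonoidHH

noncomputable section

/-- The property of being a finitely generated projective left `A`-module. -/
def finiteProjective (A : Type u) [Ring A] : ObjectProperty (ModuleCat.{u} A) :=
  fun V => Module.Finite A V ∧ Module.Projective A V

/-- The category `P(A)` of finitely generated projective left `A`-modules and `A`-linear maps. -/
abbrev Proj (A : Type u) [Ring A] : Type (u + 1) := (finiteProjective A).FullSubcategory

section Polynomial

variable (A : Type u) [Ring A]

/-- The object `A^n` of `P(A)`. -/
def free (n : ℕ) : Proj A :=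
  ⟨ModuleCat.of A (Fin n → A), inferInstanceAs (Module.Finite A (Fin n → A)),
    inferInstanceAs (Module.Projective A (Fin n → A))⟩

/-- The endofunctor `V ↦ V ⊕ A` of `P(A)`. -/
def shift : Proj A ⥤ Proj A where
  obj V := ⟨ModuleCat.of A (V.obj × A), by
    have := V.property.1
    have := V.property.2
    exact ⟨inferInstanceAs (Module.Finite A (V.obj × A)),
      inferInstanceAs (Module.Projective A (V.obj × A))⟩⟩
  map f := ObjectProperty.homMk (ModuleCat.ofHom (f.hom.hom.prodMap LinearMap.id))

/-- The projection `V ⊕ A → V`. -/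
def shiftProj : shift A ⟶ 𝟭 (Proj A) where
  app V := ObjectProperty.homMk (ModuleCat.ofHom (LinearMap.fst A V.obj A))

/-- The inclusion `V → V ⊕ A`. -/
def shiftIncl : 𝟭 (Proj A) ⟶ shift A where
  app V := ObjectProperty.homMk (ModuleCat.ofHom (LinearMap.inl A V.obj A))
  naturality := by
    intro X Y f
    ext x
    · rfl

variable {C : Type*} [Category C]

/-- The difference functor: the kernel of `F (T X) → F X` induced by `p : T X ⟶ X`. In the two
cases used below, `p` is a split epimorphism at each object, so that the kernel is the canonical
complement `Δ F` of `F` in `F ∘ T`. -/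
def difference (T : C ⥤ C) (p : T ⟶ 𝟭 C) (F : C ⥤ AddCommGrpCat.{w}) : C ⥤ AddCommGrpCat.{w} :=
  Limits.kernel (Functor.whiskerRight p F)

/-- A functor `F` on `P(A)` is polynomial of degree at most `d` if `Δ^{d+1} F = 0`, where `Δ` is
defined by the splitting `F (V ⊕ A) = F V ⊕ (Δ F) V`. -/
def IsPolynomialOfDegreeLE (F : Proj A ⥤ AddCommGrpCat.{w}) (d : ℕ) : Prop :=
  Limits.IsZero ((difference (shift A) (shiftProj A))^[d + 1] F)

/-- A contravariant functor `F` on `P(A)` is polynomial of degree at most `d` if `Δ^{d+1} F = 0`,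
where `Δ` is defined by the splitting `F (V ⊕ A) = F V ⊕ (Δ F) V`; here `F (V ⊕ A) → F V` is
induced by the inclusion `V → V ⊕ A`. -/
def IsPolynomialOfDegreeLEOp (F : (Proj A)ᵒᵖ ⥤ AddCommGrpCat.{w}) (d : ℕ) : Prop :=
  Limits.IsZero ((difference (shift A).op (NatTrans.op (shiftIncl A)))^[d + 1] F)

end Polynomial

section CategoryHH
variable {C : Type u} [Category.{v} C] (B : Cᵒᵖ × C ⥤ AddCommGrpCat.{w})

/-- The map on coefficients `B(x_m, x_0) → B(y_{m'}, y_0)` of the simplicial operator `θ`, where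
`y` is the image of the string `x` under `θ`: it is induced by the morphisms `y_{m'} → x_m` and
`x_0 → y_0` which are composites of the arrows of `x`. -/
def chainCoeff {m m' : SimplexCategoryᵒᵖ} (θ : m ⟶ m') (x : (nerve C).obj m) :
    B.obj (op (x.obj (Fin.last _)), x.obj 0) →+
      B.obj (op (((nerve C).map θ x).obj (Fin.last _)), ((nerve C).map θ x).obj 0) :=
  (B.map (Y := (op (((nerve C).map θ x).obj (Fin.last _)), ((nerve C).map θ x).obj 0))
        ((x.map (homOfLE (Fin.le_last _))).op, x.map (homOfLE (Fin.zero_le _)))).hom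

/-- The map on coefficients `B(y_0, y_m) → B(x_0, x_{m'})` of the cosimplicial operator `θ`, where
`y` is the image of the string `x` under `θ`. -/
def cochainCoeff {m m' : SimplexCategory} (θ : m ⟶ m') (x : (nerve C).obj (op m')) :
    B.obj (op (((nerve C).map θ.op x).obj 0), ((nerve C).map θ.op x).obj (Fin.last _)) →+ 
    B.obj (op (x.obj 0), x.obj (Fin.last _)) :=
  (B.map (X := (op (((nerve C).map θ.op x).obj 0), ((nerve C).map θ.op x).obj (Fin.last _)))
        (Y := (op (x.obj 0), x.obj (Fin.last _)))
        ((x.map (homOfLE (Fin.zero_le _))).op, x.map (homOfLE (Fin.le_last _)))).hom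

lemma chainCoeff_id (m : SimplexCategoryᵒᵖ) (x : (nerve C).obj m) (b) :
    chainCoeff B (𝟙 m) x b = b := by
  have h : ((x.map (homOfLE (Fin.le_last (Fin.last _)))).op, x.map (homOfLE (Fin.zero_le 0))) =
      𝟙 ((op (x.obj (Fin.last _)), x.obj 0) : Cᵒᵖ × C) :=
    Prod.ext (Quiver.Hom.unop_inj (x.map_id _)) (x.map_id _)
  exact (congrArg (fun f => (B.map f).hom b) h).trans
    (congrArg (fun f => f.hom b) (B.map_id _))

lemma chainCoeff_comp {m m' m'' : SimplexCategoryᵒᵖ} (θ : m ⟶ m') (θ' : m' ⟶ m'')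
    (x : (nerve C).obj m) (b) :
    chainCoeff B (θ ≫ θ') x b = chainCoeff B θ' ((nerve C).map θ x) (chainCoeff B θ x b) := by
  unfold chainCoeff
  erw [← AddMonoidHom.comp_apply, ← AddCommGrpCat.hom_comp, ← B.map_comp]
  refine congrArg (fun f => (B.map f).hom b) (Prod.ext ?_ ?_)
  · exact Quiver.Hom.unop_inj (x.map_comp _ _)
  · exact x.map_comp _ _

lemma cochainCoeff_id (m : SimplexCategory) (x : (nerve C).obj (op m)) (b) :
    cochainCoeff B (𝟙 m) x b = b := by
  have h : ((x.map (homOfLE (Fin.zero_le 0))).op, x.map (homOfLE (Fin.le_last (Fin.last _)))) =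
      𝟙 ((op (x.obj 0), x.obj (Fin.last _)) : Cᵒᵖ × C) :=
    Prod.ext (Quiver.Hom.unop_inj (x.map_id _)) (x.map_id _)
  exact (congrArg (fun f => (B.map f).hom b) h).trans
    (congrArg (fun f => f.hom b) (B.map_id _))

lemma cochainCoeff_comp {m m' m'' : SimplexCategory} (θ : m ⟶ m') (θ' : m' ⟶ m'')
    (x : (nerve C).obj (op m'')) (b) :
    cochainCoeff B (θ ≫ θ') x b =
      cochainCoeff B θ' x (cochainCoeff B θ ((nerve C).map θ'.op x) b) := by
  unfold cochainCoeff
  erw [← AddMonoidHom.comp_apply, ← AddCommGrpCat.hom_comp, ← B.map_comp]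
  refine congrArg (fun g => (B.map g).hom b) (Prod.ext ?_ ?_)
  · exact Quiver.Hom.unop_inj (x.map_comp _ _)
  · exact x.map_comp _ _

open Classical in
/-- The simplicial abelian group whose `m`-simplices are the direct sum of the groups
`B(x_m, x_0)` over all strings `x_0 → x_1 → ⋯ → x_m` of composable arrows of `C`. -/
def simplicialChains : SimplicialObject AddCommGrpCat.{max u v w} where
  obj m := AddCommGrpCat.of (⨁ x : (nerve C).obj m,
    B.obj (op (x.obj (Fin.last _)), x.obj 0))
  map {m m'} θ := AddCommGrpCat.ofHom (DirectSum.toAddMonoid fun x =>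
    (DirectSum.of (fun y : (nerve C).obj m' => B.obj (op (y.obj (Fin.last _)), y.obj 0))
      ((nerve C).map θ x)).comp (chainCoeff B θ x))
  map_id m := by
    refine AddCommGrpCat.hom_ext (DirectSum.addHom_ext fun x b => ?_)
    refine (DirectSum.toAddMonoid_of _ _ _).trans ?_
    exact congrArg (DirectSum.of (fun y : (nerve C).obj m =>
      B.obj (op (y.obj (Fin.last _)), y.obj 0)) x) (chainCoeff_id B m x b)
  map_comp {m m' m''} θ θ' := by
    refine AddCommGrpCat.hom_ext (DirectSum.addHom_ext fun x b => ?_)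
    refine (DirectSum.toAddMonoid_of _ _ _).trans ?_
    simp only [AddCommGrpCat.hom_ofHom, DirectSum.toAddMonoid_of, AddMonoidHom.comp_apply,
      AddCommGrpCat.hom_comp]
    exact congrArg _ (chainCoeff_comp B θ θ' x b)

/-- The cosimplicial abelian group whose `m`-cosimplices are the product of the groups
`B(x_0, x_m)` over all strings `x_0 → x_1 → ⋯ → x_m` of composable arrows of `C`. -/
def cosimplicialCochains : CosimplicialObject AddCommGrpCat.{max u v w} where
  obj m := AddCommGrpCat.of (∀ x : (nerve C).obj (op m),
    B.obj (op (x.obj 0), x.obj (Fin.last _)))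
  map {m m'} θ := AddCommGrpCat.ofHom (AddMonoidHom.pi fun x =>
      (cochainCoeff B θ x).comp (Pi.evalAddMonoidHom _ ((nerve C).map θ.op x)))
  map_id m := by
    refine AddCommGrpCat.hom_ext (AddMonoidHom.ext fun f => funext fun x => ?_)
    exact cochainCoeff_id B m x (f x)
  map_comp {m m' m''} θ θ' := by
    refine AddCommGrpCat.hom_ext (AddMonoidHom.ext fun f => funext fun x => ?_)
    exact cochainCoeff_comp B θ θ' x _

/-- The standard chain complex that computes the Hochschild homology `HH_*(C; B)`, the left derived
functors of the coend of `B`: the group of `i`-chains is the direct sum of the `B(x_i, x_0)` over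
all strings `x_0 → ⋯ → x_i` of `C`, and the differential is the alternating sum of the faces. -/
def chainComplex : ChainComplex AddCommGrpCat.{max u v w} ℕ :=
  (AlgebraicTopology.alternatingFaceMapComplex _).obj (simplicialChains B)

/-- The standard cochain complex that computes the Hochschild cohomology `HH^*(C; B)`, the right
derived functors of the end of `B`: the group of `i`-cochains is the product of the `B(x_0, x_i)`
over all strings `x_0 → ⋯ → x_i` of `C`, with the alternating sum of the cofaces. -/
def cochainComplex : CochainComplex AddCommGrpCat.{max u v w} ℕ :=
  (AlgebraicTopology.alternatingCofaceMapComplex _).obj (cosimplicialCochains B)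

end CategoryHH

section Ring
variable {R : Type u} [Ring R]

/-- A map that is additive in each variable is `ℤ`-multilinear. -/
def multilinearOfAdditive {i : ℕ} {P : Type w} [AddCommGroup P] (f : (Fin i → R) → P)
    (h : ∀ (r : Fin i → R) (k : Fin i) (a b : R), f (Function.update r k (a + b)) =
      f (Function.update r k a) + f (Function.update r k b)) :
    MultilinearMap ℤ (fun _ : Fin i => R) P where
  toFun := f
  map_update_add' {inst} r k a b := by
    obtain rfl : inst = instDecidableEqFin i := Subsingleton.elim _ _
    exact h r k a b
  map_update_smul' {inst} r k c a := by
    obtain rfl : inst = instDecidableEqFin i := Subsingleton.elim _ _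
    exact map_zsmul (AddMonoidHom.mk' (fun a => f (Function.update r k a)) (h r k)) c a

lemma contractNth_update {i : ℕ} (j : Fin i) (r : Fin (i + 1) → R) (k : Fin (i + 1)) :
    ∃ (l : Fin i) (L : R →+ R), ∀ a, Fin.contractNth j.castSucc (· * ·) (Function.update r k a) =
      Function.update (Fin.contractNth j.castSucc (· * ·) r) l (L a) := by
  obtain ⟨k, hk⟩ := k
  obtain ⟨j, hj⟩ := j
  rcases lt_trichotomy k j with h | rfl | h
  · refine ⟨⟨k, by omega⟩, AddMonoidHom.id R, fun a => funext fun ⟨m, hm⟩ => ?_⟩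
    simp only [Fin.contractNth, Function.update_apply, Fin.ext_iff, Fin.castSucc_mk, Fin.succ_mk,
      AddMonoidHom.id_apply]
    split_ifs <;> first | rfl | omega
  · refine ⟨⟨k, hj⟩, AddMonoidHom.mulRight (r ⟨k + 1, by omega⟩), fun a => funext fun ⟨m, hm⟩ => ?_⟩
    simp only [Fin.contractNth, Function.update_apply, Fin.ext_iff, Fin.castSucc_mk, Fin.succ_mk]
    split_ifs <;> first | rfl | omega | skip
    subst_vars; rfl
  · rcases Nat.lt_or_ge (j + 1) k with h' | h'
    · refine ⟨⟨k - 1, by omega⟩, AddMonoidHom.id R, fun a => funext fun ⟨m, hm⟩ => ?_⟩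
      simp only [Fin.contractNth, Function.update_apply, Fin.ext_iff, Fin.castSucc_mk, Fin.succ_mk,
        AddMonoidHom.id_apply]
      split_ifs <;> first | rfl | omega
    · obtain rfl : k = j + 1 := by omega
      refine ⟨⟨j, hj⟩, AddMonoidHom.mulLeft (r ⟨j, by omega⟩), fun a => funext fun ⟨m, hm⟩ => ?_⟩
      simp only [Fin.contractNth, Function.update_apply, Fin.ext_iff, Fin.castSucc_mk, Fin.succ_mk]
      split_ifs <;> first | rfl | omega | skip
      subst_vars; rfl

variable {P : Type w} [AddCommGroup P] {Q : Type v} [AddCommGroup Q]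

/-- `(r₀, …, rᵢ) ↦ f (r₀, …, rⱼ rⱼ₊₁, …, rᵢ)`. -/
def contractMap {i : ℕ} (j : Fin i) (f : MultilinearMap ℤ (fun _ : Fin i => R) P) :
    MultilinearMap ℤ (fun _ : Fin (i + 1) => R) P :=
  multilinearOfAdditive (fun r => f (Fin.contractNth j.castSucc (· * ·) r)) fun r k a b => by
    obtain ⟨l, L, h⟩ := contractNth_update j r k
    simp only [h, map_add, MultilinearMap.map_update_add]

/-- `(r₀, …, rᵢ) ↦ β r₀ (f (r₁, …, rᵢ))`. -/
def headMap {i : ℕ} (β : R →+ P →+ Q) (f : MultilinearMap ℤ (fun _ : Fin i => R) P) :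
    MultilinearMap ℤ (fun _ : Fin (i + 1) => R) Q :=
  multilinearOfAdditive (fun r => β (r 0) (f (Fin.tail r))) fun r k a b => by
    induction k using Fin.cases with
    | zero => simp [Fin.tail_update_zero]
    | succ k => simp [Fin.tail_update_succ, (Fin.succ_ne_zero k).symm]

/-- `(r₀, …, rᵢ) ↦ β rᵢ (f (r₀, …, rᵢ₋₁))`. -/
def lastMap {i : ℕ} (β : R →+ P →+ Q) (f : MultilinearMap ℤ (fun _ : Fin i => R) P) :
    MultilinearMap ℤ (fun _ : Fin (i + 1) => R) Q :=
  multilinearOfAdditive (fun r => β (r (Fin.last i)) (f (Fin.init r))) fun r k a b => by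
    induction k using Fin.lastCases with
    | last => simp [Fin.init_update_last]
    | cast k => simp [Fin.init_update_castSucc, (Fin.castSucc_lt_last k).ne']


variable (R : Type u) [Ring R] (N : Type w) [AddCommGroup N] [Module R N] [Module Rᵐᵒᵖ N]

/-- The group of Hochschild `i`-chains `N ⊗ R ⊗ ⋯ ⊗ R` (tensor products over `ℤ`). -/
abbrev RingChains (i : ℕ) : Type (max u w) := N ⊗[ℤ] (⨂[ℤ] _ : Fin i, R)

/-- `n ⊗ r₀ ⊗ ⋯ ⊗ rᵢ ↦ n r₀ ⊗ r₁ ⊗ ⋯ ⊗ rᵢ + ∑ ± n ⊗ ⋯ ⊗ rⱼ rⱼ₊₁ ⊗ ⋯ ± rᵢ n ⊗ r₀ ⊗ ⋯ ⊗ rᵢ₋₁`. -/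
def ringChainsDAux (i : ℕ) (n : N) :
    MultilinearMap ℤ (fun _ : Fin (i + 1) => R) (RingChains R N i) :=
  headMap (AddMonoidHom.mk' (fun r => (TensorProduct.mk ℤ N _ (MulOpposite.op r • n)).toAddMonoidHom)
      fun a b => by ext; simp [add_smul]) (PiTensorProduct.tprod ℤ)
  + ∑ j : Fin i, (-1 : ℤ) ^ ((j : ℕ) + 1) •
      contractMap j ((TensorProduct.mk ℤ N _ n).compMultilinearMap (PiTensorProduct.tprod ℤ))
  + (-1 : ℤ) ^ (i + 1) •
    lastMap (AddMonoidHom.mk' (fun r => (TensorProduct.mk ℤ N _ (r • n)).toAddMonoidHom)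
      fun a b => by ext; simp [add_smul]) (PiTensorProduct.tprod ℤ)

variable {R N} in
lemma ringChainsDAux_apply (i : ℕ) (n : N) (r : Fin (i + 1) → R) :
    ringChainsDAux R N i n r =
      (MulOpposite.op (r 0) • n) ⊗ₜ PiTensorProduct.tprod ℤ (Fin.tail r)
      + ∑ j : Fin i, (-1 : ℤ) ^ ((j : ℕ) + 1) •
        (n ⊗ₜ PiTensorProduct.tprod ℤ (Fin.contractNth j.castSucc (· * ·) r))
      + (-1 : ℤ) ^ (i + 1) • ((r (Fin.last i) • n) ⊗ₜ PiTensorProduct.tprod ℤ (Fin.init r)) := by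
  simp only [ringChainsDAux, add_apply, sum_apply]
  rfl

/-- The Hochschild boundary on chains, see `ringChainsD_tmul` for the formula. -/
def ringChainsD (i : ℕ) : RingChains R N (i + 1) →ₗ[ℤ] RingChains R N i :=
  TensorProduct.lift (PiTensorProduct.lift.toLinearMap ∘ₗ
    (AddMonoidHom.mk' (ringChainsDAux R N i) fun a b => by
      ext r
      simp only [ringChainsDAux_apply, add_apply, smul_add, TensorProduct.add_tmul,
        Finset.sum_add_distrib]
      abel).toIntLinearMap)

variable {R N} in
lemma ringChainsD_tmul (i : ℕ) (n : N) (r : Fin (i + 1) → R) :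
    ringChainsD R N i (n ⊗ₜ PiTensorProduct.tprod ℤ r) =
      (MulOpposite.op (r 0) • n) ⊗ₜ PiTensorProduct.tprod ℤ (Fin.tail r)
      + ∑ j : Fin i, (-1 : ℤ) ^ ((j : ℕ) + 1) •
        (n ⊗ₜ PiTensorProduct.tprod ℤ (Fin.contractNth j.castSucc (· * ·) r))
      + (-1 : ℤ) ^ (i + 1) • ((r (Fin.last i) • n) ⊗ₜ PiTensorProduct.tprod ℤ (Fin.init r)) := by
  rw [← ringChainsDAux_apply]
  exact (TensorProduct.lift.tmul _ _).trans (PiTensorProduct.lift.tprod _)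

/-- The group of Hochschild `i`-cochains: the multilinear maps from `R^i` to `N`. -/
abbrev RingCochains (i : ℕ) : Type (max u w) := MultilinearMap ℤ (fun _ : Fin i => R) N

/-- The Hochschild coboundary, `(r₀, …, rᵢ) ↦ r₀ f(r₁, …, rᵢ) + ∑ ± f(…, rⱼ rⱼ₊₁, …)
± f(r₀, …, rᵢ₋₁) rᵢ`. -/
def ringCochainsDAux (i : ℕ) (f : RingCochains R N i) : RingCochains R N (i + 1) :=
  headMap (AddMonoidHom.mk' (fun r => DistribSMul.toAddMonoidHom N r)
      fun a b => by ext; simp [add_smul]) f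
  + ∑ j : Fin i, (-1 : ℤ) ^ ((j : ℕ) + 1) • contractMap j f
  + (-1 : ℤ) ^ (i + 1) •
    lastMap (AddMonoidHom.mk' (fun r => DistribSMul.toAddMonoidHom N (MulOpposite.op r))
      fun a b => by ext; simp [add_smul]) f

variable {R N} in
lemma ringCochainsDAux_apply (i : ℕ) (f : RingCochains R N i) (r : Fin (i + 1) → R) :
    ringCochainsDAux R N i f r =
      r 0 • f (Fin.tail r)
      + ∑ j : Fin i, (-1 : ℤ) ^ ((j : ℕ) + 1) • f (Fin.contractNth j.castSucc (· * ·) r)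
      + (-1 : ℤ) ^ (i + 1) • (MulOpposite.op (r (Fin.last i)) • f (Fin.init r)) := by
  simp only [ringCochainsDAux, add_apply, sum_apply]
  rfl

/-- The Hochschild coboundary as a morphism of groups. -/
def ringCochainsD (i : ℕ) : RingCochains R N i →+ RingCochains R N (i + 1) :=
  AddMonoidHom.mk' (ringCochainsDAux R N i) fun f g => by
    ext r
    simp only [ringCochainsDAux_apply, add_apply, smul_add,
      Finset.sum_add_distrib]
    abel

end Ring

section OneObject

/-- The category with one object whose endomorphism monoid is `M`, where `f ≫ g = f * g`. -/
def OneObj (_M : Type u) : Type := Unit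

namespace OneObj

variable {M : Type u} [Monoid M]

instance : Category.{u} (OneObj M) where
  Hom _ _ := M
  id _ := (1 : M)
  comp f g := (f * g : M)
  id_comp f := one_mul (M := M) f
  comp_id f := mul_one (M := M) f
  assoc f g h := mul_assoc (G := M) f g h

variable (M) in
/-- The object. -/
def star : OneObj M := ()

/-- The endomorphism given by an element of `M`. -/
def hom (g : M) : star M ⟶ star M := g

/-- The arrow from the vertex `a` to the vertex `b` of a simplex of the nerve. -/
def edge {i : ℕ} (x : ComposableArrows (OneObj M) i) {a b : Fin (i + 1)} (h : a ≤ b) : M :=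
  x.map (homOfLE h)

lemma edge_self {i : ℕ} (x : ComposableArrows (OneObj M) i) {a b : Fin (i + 1)} (h : a ≤ b)
    (hab : a = b) : edge x h = 1 := by
  subst hab; exact x.map_id a

lemma edge_mul {i : ℕ} (x : ComposableArrows (OneObj M) i) {a b c : Fin (i + 1)} (h : a ≤ b)
    (h' : b ≤ c) : edge x h * edge x h' = edge x (h.trans h') :=
  (x.map_comp (homOfLE h) (homOfLE h')).symm

lemma edge_congr {i : ℕ} (x : ComposableArrows (OneObj M) i) {a b a' b' : Fin (i + 1)} (h : a ≤ b)
    (h' : a' ≤ b') (ha : a = a') (hb : b = b') : edge x h = edge x h' := by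
  subst ha hb; rfl

/-- The successive arrows of a simplex of the nerve. -/
def arrows {i : ℕ} (x : ComposableArrows (OneObj M) i) (k : Fin i) : M :=
  edge x (Fin.castSucc_lt_succ (i := k)).le

lemma arrows_δ_zero {i : ℕ} (x : ComposableArrows (OneObj M) (i + 1)) :
    arrows ((nerve (OneObj M)).δ 0 x) = Fin.tail (arrows x) := rfl

lemma arrows_δ_last {i : ℕ} (x : ComposableArrows (OneObj M) (i + 1)) :
    arrows ((nerve (OneObj M)).δ (Fin.last (i + 1)) x) = Fin.init (arrows x) := by
  funext k
  refine edge_congr x _ _ ?_ ?_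
  · exact Fin.succAbove_last_apply _
  · exact Fin.succAbove_last_apply _

lemma val_succAbove {n : ℕ} (p : Fin (n + 1)) (i : Fin n) :
    (p.succAbove i : ℕ) = if (i : ℕ) < p then (i : ℕ) else i + 1 := by
  unfold Fin.succAbove
  simp only [Fin.lt_def, Fin.val_castSucc]
  split_ifs <;> simp

lemma arrows_δ_succ {i : ℕ} (x : ComposableArrows (OneObj M) (i + 1)) (j : Fin i) :
    arrows ((nerve (OneObj M)).δ j.castSucc.succ x) =
      Fin.contractNth j.castSucc (· * ·) (arrows x) := by
  funext k
  have key : arrows ((nerve (OneObj M)).δ j.castSucc.succ x) k =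
    edge x (a := j.castSucc.succ.succAbove k.castSucc) (b := j.castSucc.succ.succAbove k.succ)
      (Fin.succAbove_le_succAbove_iff.2 (Fin.castSucc_lt_succ (i := k)).le) := rfl
  rw [key]
  rcases lt_trichotomy (k : ℕ) (j : ℕ) with h | h | h
  · rw [Fin.contractNth_apply_of_lt _ _ _ _ h]
    refine edge_congr x _ _ ?_ ?_
    · simp [Fin.ext_iff, val_succAbove]; try omega
    · simp [Fin.ext_iff, val_succAbove]; try omega
  · rw [Fin.contractNth_apply_of_eq _ _ _ _ h]
    unfold arrows
    refine (edge_congr x _ ?_ ?_ ?_).trans (edge_mul x _ _).symm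
    · exact Fin.castSucc_lt_succ.le.trans (Fin.succ_castSucc k ▸ Fin.castSucc_lt_succ.le)
    · simp [Fin.ext_iff, val_succAbove]; try omega
    · simp [Fin.ext_iff, val_succAbove]; try omega
  · rw [Fin.contractNth_apply_of_gt _ _ _ _ h]
    refine edge_congr x _ _ ?_ ?_
    · simp [Fin.ext_iff, val_succAbove]; try omega
    · simp [Fin.ext_iff, val_succAbove]; try omega

lemma arrows_injective {i : ℕ} : Function.Injective (arrows (M := M) (i := i)) := by
  intro x y h
  refine ComposableArrows.ext (fun _ => rfl) fun k hk => ?_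
  refine (congrFun h ⟨k, hk⟩).trans ?_
  exact ((congrArg (fun z : M => (1 : M) * z) (mul_one _)).trans (one_mul _)).symm

/-- The simplex with given successive arrows. -/
def simplex {i : ℕ} (g : Fin i → M) : ComposableArrows (OneObj M) i :=
  ComposableArrows.mkOfObjOfMapSucc (fun _ => star M) (fun k => g k)

lemma arrows_simplex {i : ℕ} (g : Fin i → M) : arrows (simplex g) = g := by
  funext k
  exact ComposableArrows.mkOfObjOfMapSucc_map_succ (fun _ => star M) (fun k => g k) k.1 k.2

lemma simplex_arrows {i : ℕ} (x : ComposableArrows (OneObj M) i) : simplex (arrows x) = x :=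
  arrows_injective (arrows_simplex _)

end OneObj

end OneObject

section RingComplex

lemma hom_sum_zsmul_apply {X Y : AddCommGrpCat.{w}} {n : ℕ} (a : Fin n → ℤ) (f : Fin n → (X ⟶ Y))
    (x : X) : (∑ k, a k • f k).hom x = ∑ k, a k • (f k).hom x := by
  have h : (∑ k, a k • f k).hom = ∑ k, a k • (f k).hom := by
    exact map_sum (AddCommGrpCat.homAddEquiv (M := X) (N := Y)) _ _
  rw [h]; simp

section

variable {C : Type u} [Category.{v} C] (B : Cᵒᵖ × C ⥤ AddCommGrpCat.{w})

open Classical in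
lemma simplicialChains_δ_of (i : ℕ) (k : Fin (i + 2)) (x : (nerve C).obj (op ⦋i + 1⦌))
    (b : B.obj (op (x.obj (Fin.last _)), x.obj 0)) :
    ((simplicialChains B).δ k).hom (DirectSum.of (fun x : (nerve C).obj (op ⦋i + 1⦌) =>
      B.obj (op (x.obj (Fin.last _)), x.obj 0)) x b) =
    DirectSum.of (fun x : (nerve C).obj (op ⦋i⦌) => B.obj (op (x.obj (Fin.last _)), x.obj 0))
      ((nerve C).δ k x) (chainCoeff B (SimplexCategory.δ k).op x b) :=
  DirectSum.toAddMonoid_of _ _ _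

lemma chainComplex_d_apply (i : ℕ) (y : (chainComplex B).X (i + 1)) :
    ((chainComplex B).d (i + 1) i).hom y =
      ∑ k : Fin (i + 2), (-1 : ℤ) ^ (k : ℕ) • ((simplicialChains B).δ k).hom y := by
  have h : (chainComplex B).d (i + 1) i =
      ∑ k : Fin (i + 2), (-1 : ℤ) ^ (k : ℕ) • (simplicialChains B).δ k :=
    AlgebraicTopology.AlternatingFaceMapComplex.obj_d_eq _ _
  rw [h]
  exact hom_sum_zsmul_apply _ _ _

lemma cochainComplex_d_apply (i : ℕ) (y : (cochainComplex B).X i) :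
    ((cochainComplex B).d i (i + 1)).hom y =
      ∑ k : Fin (i + 2), (-1 : ℤ) ^ (k : ℕ) • ((cosimplicialCochains B).δ k).hom y := by
  have h : (cochainComplex B).d i (i + 1) =
      ∑ k : Fin (i + 2), (-1 : ℤ) ^ (k : ℕ) • (cosimplicialCochains B).δ k := by
    change (AlgebraicTopology.AlternatingCofaceMapComplex.obj (cosimplicialCochains B)).d _ _ = _
    simp [AlgebraicTopology.AlternatingCofaceMapComplex.obj]
  rw [h]
  exact hom_sum_zsmul_apply _ _ _

end

lemma map_signed_sum {X : Type u} {Y : Type v} [AddCommGroup X] [AddCommGroup Y] (g : X →+ Y)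
    {n : ℕ} (a : Fin n → ℤ) (f : Fin n → X) : g (∑ k, a k • f k) = ∑ k, a k • g (f k) := by
  simp

variable {M : Type v} [Monoid M] {R : Type u} [Ring R] (φ : M →* R)
  (B : (OneObj M)ᵒᵖ × OneObj M ⥤ AddCommGrpCat.{w})
  {N : Type w} [AddCommGroup N] [Module R N] [Module Rᵐᵒᵖ N]
  (c : B.obj (op (OneObj.star M), OneObj.star M) ≃+ N)

open OneObj in
/-- `B` is the restriction along `φ` of the bimodule `N`. -/
def Compatible : Prop := ∀ (f g : M) (b : B.obj (op (star M), star M)),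
  c ((B.map (X := (op (star M), star M)) (Y := (op (star M), star M))
    ((hom f).op, hom g)).hom b) = φ f • MulOpposite.op (φ g) • c b

open Classical in
/-- On the summand of the simplex with arrows `g₁, …, gᵢ`: `b ↦ c b ⊗ φ g₁ ⊗ ⋯ ⊗ φ gᵢ`. -/
def chainsToRing (φ : M →* R) (B : (OneObj M)ᵒᵖ × OneObj M ⥤ AddCommGrpCat.{w})
    {N : Type w} [AddCommGroup N] (c : B.obj (op (OneObj.star M), OneObj.star M) ≃+ N) (i : ℕ) :
    (chainComplex B).X i →+ RingChains R N i :=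
  DirectSum.toAddMonoid fun x : (nerve (OneObj M)).obj (op ⦋i⦌) =>
    (((TensorProduct.mk ℤ N (⨂[ℤ] _ : Fin i, R)).flip
      (PiTensorProduct.tprod ℤ (φ ∘ OneObj.arrows x))).toAddMonoidHom).comp c.toAddMonoidHom

open Classical in
lemma chainsToRing_of (φ : M →* R) (B : (OneObj M)ᵒᵖ × OneObj M ⥤ AddCommGrpCat.{w})
    {N : Type w} [AddCommGroup N] (c : B.obj (op (OneObj.star M), OneObj.star M) ≃+ N) (i : ℕ) (x : (nerve (OneObj M)).obj (op ⦋i⦌))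
    (b : B.obj (op (OneObj.star M), OneObj.star M)) :
    chainsToRing φ B c i (DirectSum.of (fun x : (nerve (OneObj M)).obj (op ⦋i⦌) =>
      B.obj (op (x.obj (Fin.last _)), x.obj 0)) x b) =
      c b ⊗ₜ PiTensorProduct.tprod ℤ (φ ∘ OneObj.arrows x) :=
  DirectSum.toAddMonoid_of _ _ _

lemma tmul_tprod_congr (φ : M →* R) {N : Type w} [AddCommGroup N] {i : ℕ} {n n' : N} {g g' : Fin i → M} (hn : n = n') (hg : g = g') :
    (n ⊗ₜ[ℤ] PiTensorProduct.tprod ℤ (φ ∘ g) : RingChains R N i) =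
      n' ⊗ₜ PiTensorProduct.tprod ℤ (φ ∘ g') := by
  rw [hn, hg]

lemma smul_smul_congr {a a' b b' : M} (n : N) (ha : a = a') (hb : b = b') :
    φ a • MulOpposite.op (φ b) • n = φ a' • MulOpposite.op (φ b') • n := by
  rw [ha, hb]

variable {φ B c}

open Classical in
lemma chainsToRing_d (h : Compatible φ B c) (i : ℕ) (y : (chainComplex B).X (i + 1)) :
    chainsToRing φ B c i (((chainComplex B).d (i + 1) i).hom y) =
      ringChainsD R N i (chainsToRing φ B c (i + 1) y) := by
  revert y
  refine DFunLike.congr_fun (f := (chainsToRing φ B c i).comp ((chainComplex B).d (i + 1) i).hom)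
    (g := (ringChainsD R N i).toAddMonoidHom.comp (chainsToRing φ B c (i + 1))) ?_
  refine DirectSum.addHom_ext fun (x : (nerve (OneObj M)).obj (op ⦋i + 1⦌)) b => ?_
  have h2 := ringChainsD_tmul i (c b) (φ ∘ OneObj.arrows x)
  refine Eq.trans ?_ ((congrArg (ringChainsD R N i)
    (chainsToRing_of φ B c (i + 1) x b)).trans h2).symm
  refine (congrArg (chainsToRing φ B c i) (chainComplex_d_apply B i _)).trans ?_
  have face : ∀ k : Fin (i + 2), chainsToRing φ B c i (((simplicialChains B).δ k).hom
      (DirectSum.of (fun x : (nerve (OneObj M)).obj (op ⦋i + 1⦌) =>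
      B.obj (op (x.obj (Fin.last _)), x.obj 0)) x b)) =
      (φ (OneObj.edge x (Fin.le_last (k.succAbove (Fin.last i)))) •
        MulOpposite.op (φ (OneObj.edge x (Fin.zero_le (k.succAbove 0)))) • c b) ⊗ₜ
        PiTensorProduct.tprod ℤ (φ ∘ OneObj.arrows ((nerve (OneObj M)).δ k x)) := by
    intro k
    refine (congrArg (chainsToRing φ B c i) (DirectSum.toAddMonoid_of _ _ _)).trans ?_
    refine (chainsToRing_of φ B c i _ _).trans ?_
    exact congrArg (· ⊗ₜ _) (h _ _ b)
  refine (map_signed_sum (chainsToRing φ B c i) _ _).trans ?_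
  refine (Finset.sum_congr rfl fun k _ => congrArg _ (face k)).trans ?_
  clear face
  rw [Fin.sum_univ_succ, Fin.sum_univ_castSucc, ← add_assoc]
  have comp_contract : ∀ j : Fin i, φ ∘ Fin.contractNth j.castSucc (· * ·) (OneObj.arrows x) =
      Fin.contractNth j.castSucc (· * ·) (φ ∘ OneObj.arrows x) := fun j =>
    Fin.comp_contractNth _ _ (map_mul φ) _ _
  refine congrArg₂ _ (congrArg₂ _ ?_ (Finset.sum_congr rfl fun j _ => ?_)) ?_
  · refine (congrArg _ (tmul_tprod_congr φ ((smul_smul_congr φ (c b) (OneObj.edge_self x _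
      (by simp [Fin.ext_iff])) rfl).trans ?_) (OneObj.arrows_δ_zero x))).trans
      ((congrArg (· • _) (pow_zero (-1 : ℤ))).trans (one_smul ℤ _))
    rw [map_one, one_smul]
    rfl
  · refine congrArg _ ((tmul_tprod_congr φ ((smul_smul_congr φ (c b) (OneObj.edge_self x _
      (by simp [Fin.ext_iff, OneObj.val_succAbove])) (OneObj.edge_self x _
      (by simp [Fin.ext_iff]))).trans ?_) (OneObj.arrows_δ_succ x j)).trans
      (congrArg _ (congrArg _ (comp_contract j))))
    rw [map_one, MulOpposite.op_one, one_smul, one_smul]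
  · refine congrArg _ (tmul_tprod_congr φ ((smul_smul_congr φ (c b) (OneObj.edge_congr x
      (a' := (Fin.last i).castSucc) (b' := Fin.last (i + 1)) _ (Fin.le_last _)
      (by simp [Fin.ext_iff, OneObj.val_succAbove]) rfl) (OneObj.edge_self x _
      (by simp [Fin.ext_iff]))).trans ?_) (OneObj.arrows_δ_last x))
    rw [map_one, MulOpposite.op_one, one_smul]
    rfl

variable (φ B c) in
/-- A multilinear cochain, restricted to the elements of the monoid. -/
def cochainsOfRing (i : ℕ) : RingCochains R N i →+ (cochainComplex B).X i :=
  AddMonoidHom.pi fun x : (nerve (OneObj M)).obj (op ⦋i⦌) =>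
    c.symm.toAddMonoidHom.comp (AddMonoidHom.mk' (fun f : RingCochains R N i =>
      f (φ ∘ OneObj.arrows x)) fun _ _ => rfl)

lemma cochainsOfRing_d (h : Compatible φ B c) (i : ℕ) (f : RingCochains R N i) :
    cochainsOfRing φ B c (i + 1) (ringCochainsD R N i f) =
      ((cochainComplex B).d i (i + 1)).hom (cochainsOfRing φ B c i f) := by
  funext (x : (nerve (OneObj M)).obj (op ⦋i + 1⦌))
  apply c.injective
  refine (c.apply_symm_apply _).trans ?_
  refine (ringCochainsDAux_apply i f (φ ∘ OneObj.arrows x)).trans ?_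
  have face : ∀ k : Fin (i + 2), c ((((cosimplicialCochains B).δ k).hom
      (cochainsOfRing φ B c i f) : (cochainComplex B).X (i + 1)) x) =
      φ (OneObj.edge x (Fin.zero_le (k.succAbove 0))) •
        MulOpposite.op (φ (OneObj.edge x (Fin.le_last (k.succAbove (Fin.last i))))) •
          f (φ ∘ OneObj.arrows ((nerve (OneObj M)).δ k x)) := by
    intro k
    refine (h _ _ _).trans ?_
    exact congrArg (fun n : N => φ (OneObj.edge x (Fin.zero_le (k.succAbove 0))) •
      MulOpposite.op (φ (OneObj.edge x (Fin.le_last (k.succAbove (Fin.last i))))) • n)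
      (c.apply_symm_apply _)
  refine Eq.trans ?_ (congrArg (fun y : (cochainComplex B).X (i + 1) => c (y x))
    (cochainComplex_d_apply B i _)).symm
  refine Eq.trans ?_ (map_signed_sum (c.toAddMonoidHom.comp (Pi.evalAddMonoidHom
    (fun x : (nerve (OneObj M)).obj (op ⦋i + 1⦌) => B.obj (op (x.obj 0), x.obj (Fin.last _))) x))
    (fun k : Fin (i + 2) => (-1 : ℤ) ^ (k : ℕ)) (fun k => ((cosimplicialCochains B).δ k).hom
      (cochainsOfRing φ B c i f))).symm
  refine Eq.trans ?_ (Finset.sum_congr rfl fun k _ => congrArg _ (face k)).symm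
  clear face
  rw [Fin.sum_univ_succ, Fin.sum_univ_castSucc, ← add_assoc]
  have comp_contract : ∀ j : Fin i, φ ∘ Fin.contractNth j.castSucc (· * ·) (OneObj.arrows x) =
      Fin.contractNth j.castSucc (· * ·) (φ ∘ OneObj.arrows x) := fun j =>
    Fin.comp_contractNth _ _ (map_mul φ) _ _
  refine (congrArg₂ _ (congrArg₂ _ ?_ (Finset.sum_congr rfl fun j _ => ?_)) ?_).symm
  · refine ((congrArg (· • _) (pow_zero (-1 : ℤ))).trans (one_smul ℤ _)).trans
      ((smul_smul_congr φ _ rfl (OneObj.edge_self x _ (by simp [Fin.ext_iff]))).trans ?_)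
    rw [map_one, MulOpposite.op_one, one_smul]
    rfl
  · refine congrArg _ ((smul_smul_congr φ _ (OneObj.edge_self x _ (by simp [Fin.ext_iff]))
      (OneObj.edge_self x _ (by simp [Fin.ext_iff, OneObj.val_succAbove]))).trans ?_)
    rw [map_one, MulOpposite.op_one, one_smul, one_smul]
    exact congrArg f ((congrArg (φ ∘ ·) (OneObj.arrows_δ_succ x j)).trans (comp_contract j))
  · refine congrArg _ ((smul_smul_congr φ _ (OneObj.edge_self x _ (by simp [Fin.ext_iff]))
      (OneObj.edge_congr x (a' := (Fin.last i).castSucc) (b' := Fin.last (i + 1)) _ (Fin.le_last _)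
      (by simp [Fin.ext_iff, OneObj.val_succAbove]) rfl)).trans ?_)
    rw [map_one, one_smul]
    exact congrArg (fun g => MulOpposite.op (φ (OneObj.arrows x (Fin.last i))) • f g)
      (congrArg (φ ∘ ·) (OneObj.arrows_δ_last x))

end RingComplex

section RingHH

variable (R : Type u) [Ring R] (N : Type w) [AddCommGroup N] [Module R N] [Module Rᵐᵒᵖ N]
  [SMulCommClass R Rᵐᵒᵖ N]

/-- A bimodule as a bifunctor on the one-object category of the multiplicative monoid. -/
def ofBimodule : (OneObj R)ᵒᵖ × OneObj R ⥤ AddCommGrpCat.{w} where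
  obj _ := AddCommGrpCat.of N
  map f := AddCommGrpCat.ofHom ((DistribSMul.toAddMonoidHom N (f.1.unop : R)).comp
    (DistribSMul.toAddMonoidHom N (MulOpposite.op (f.2 : R))))
  map_id X := by
    refine AddCommGrpCat.hom_ext (AddMonoidHom.ext fun n => ?_)
    change (1 : R) • (MulOpposite.op (1 : R)) • n = n
    simp
  map_comp f g := by
    refine AddCommGrpCat.hom_ext (AddMonoidHom.ext fun n => ?_)
    change ((g.1.unop : R) * (f.1.unop : R)) • (MulOpposite.op ((f.2 : R) * (g.2 : R))) • n =
      (g.1.unop : R) • (MulOpposite.op (g.2 : R)) • (f.1.unop : R) • (MulOpposite.op (f.2 : R)) • n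
    rw [MulOpposite.op_mul, mul_smul, mul_smul, smul_comm (f.1.unop : R)]

/-- The value of `ofBimodule` at the object. -/
def ofBimoduleEquiv : (ofBimodule R N).obj (op (OneObj.star R), OneObj.star R) ≃+ N :=
  AddEquiv.refl N

lemma compatible_ofBimodule :
    Compatible (MonoidHom.id R) (ofBimodule R N) (ofBimoduleEquiv R N) := fun _ _ _ => rfl

lemma ringChainsD_comp (i : ℕ) : (ringChainsD R N i) ∘ₗ (ringChainsD R N (i + 1)) = 0 := by
  classical
  refine TensorProduct.ext (LinearMap.ext fun n => PiTensorProduct.ext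
    (MultilinearMap.ext fun r => ?_))
  have h := chainsToRing_of (MonoidHom.id R) (ofBimodule R N) (ofBimoduleEquiv R N) (i + 2)
    (OneObj.simplex r) n
  rw [OneObj.arrows_simplex] at h
  change ringChainsD R N i (ringChainsD R N (i + 1) (n ⊗ₜ PiTensorProduct.tprod ℤ r)) = 0
  refine (congrArg (fun z => ringChainsD R N i (ringChainsD R N (i + 1) z)) h.symm).trans ?_
  refine (congrArg (ringChainsD R N i)
    (chainsToRing_d (compatible_ofBimodule R N) (i + 1) _).symm).trans ?_
  refine (chainsToRing_d (compatible_ofBimodule R N) i _).symm.trans ?_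
  refine (congrArg _ (DFunLike.congr_fun (congrArg AddCommGrpCat.Hom.hom
    ((chainComplex (ofBimodule R N)).d_comp_d (i + 2) (i + 1) i)) _)).trans ?_
  exact map_zero _

lemma ringCochainsD_comp (i : ℕ) (f : RingCochains R N i) :
    ringCochainsD R N (i + 1) (ringCochainsD R N i f) = 0 := by
  have key : cochainsOfRing (MonoidHom.id R) (ofBimodule R N) (ofBimoduleEquiv R N) (i + 2)
      (ringCochainsD R N (i + 1) (ringCochainsD R N i f)) = 0 := by
    refine (cochainsOfRing_d (compatible_ofBimodule R N) (i + 1) _).trans ?_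
    refine (congrArg _ (cochainsOfRing_d (compatible_ofBimodule R N) i f)).trans ?_
    exact DFunLike.congr_fun (congrArg AddCommGrpCat.Hom.hom
      ((cochainComplex (ofBimodule R N)).d_comp_d i (i + 1) (i + 2))) _
  refine MultilinearMap.ext fun r => ?_
  have h := congrFun key (OneObj.simplex r)
  change ringCochainsD R N (i + 1) (ringCochainsD R N i f)
    (MonoidHom.id R ∘ OneObj.arrows (OneObj.simplex r)) = 0 at h
  rw [OneObj.arrows_simplex] at h
  exact h

/-- The Hochschild chain complex `⋯ → N ⊗ R ⊗ R → N ⊗ R → N` of the ring `R` with coefficients in the bimodule `N`. -/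
def ringChainComplex : ChainComplex AddCommGrpCat.{max u w} ℕ :=
  ChainComplex.of (fun i => AddCommGrpCat.of (RingChains R N i))
    (fun i => AddCommGrpCat.ofHom (ringChainsD R N i).toAddMonoidHom) fun i =>
    AddCommGrpCat.hom_ext (AddMonoidHom.ext fun z => LinearMap.congr_fun (ringChainsD_comp R N i) z)

/-- The Hochschild cochain complex of the ring `R` with coefficients in the bimodule `N`. -/
def ringCochainComplex : CochainComplex AddCommGrpCat.{max u w} ℕ :=
  CochainComplex.of (fun i => AddCommGrpCat.of (RingCochains R N i))
    (fun i => AddCommGrpCat.ofHom (ringCochainsD R N i)) fun i =>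
    AddCommGrpCat.hom_ext (AddMonoidHom.ext fun f => ringCochainsD_comp R N i f)

lemma ringChainComplex_d (i : ℕ) : (ringChainComplex R N).d (i + 1) i =
    AddCommGrpCat.ofHom (ringChainsD R N i).toAddMonoidHom :=
  by simp [ringChainComplex]

lemma ringCochainComplex_d (i : ℕ) : (ringCochainComplex R N).d i (i + 1) =
    AddCommGrpCat.ofHom (ringCochainsD R N i) :=
  by simp [ringCochainComplex]

variable {R N} {S : Type u} [Ring S] {N' : Type w} [AddCommGroup N'] [Module S N']
  [Module Sᵐᵒᵖ N'] (ψ : R →+* S) (η : N →+ N')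

/-- `n ⊗ r₁ ⊗ ⋯ ⊗ rᵢ ↦ η n ⊗ ψ r₁ ⊗ ⋯ ⊗ ψ rᵢ`. -/
def ringChainsMap (i : ℕ) : RingChains R N i →ₗ[ℤ] RingChains S N' i :=
  TensorProduct.map η.toIntLinearMap
    (PiTensorProduct.map fun _ => ψ.toAddMonoidHom.toIntLinearMap)

lemma ringChainsMap_tmul (i : ℕ) (n : N) (r : Fin i → R) :
    ringChainsMap ψ η i (n ⊗ₜ PiTensorProduct.tprod ℤ r) =
      η n ⊗ₜ PiTensorProduct.tprod ℤ (ψ ∘ r) :=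
  (TensorProduct.map_tmul _ _ _ _).trans
    (congrArg (η n ⊗ₜ ·) (PiTensorProduct.map_tprod _ _))

variable {ψ η}

lemma ringChainsMap_d (hl : ∀ (r : R) (n : N), η (r • n) = ψ r • η n)
    (hr : ∀ (r : R) (n : N), η (MulOpposite.op r • n) = MulOpposite.op (ψ r) • η n) (i : ℕ) :
    ringChainsMap ψ η i ∘ₗ ringChainsD R N i = ringChainsD S N' i ∘ₗ ringChainsMap ψ η (i + 1) := by
  refine TensorProduct.ext (LinearMap.ext fun n => PiTensorProduct.ext
    (MultilinearMap.ext fun r => ?_))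
  change ringChainsMap ψ η i (ringChainsD R N i (n ⊗ₜ PiTensorProduct.tprod ℤ r)) =
    ringChainsD S N' i (ringChainsMap ψ η (i + 1) (n ⊗ₜ PiTensorProduct.tprod ℤ r))
  rw [ringChainsMap_tmul, ringChainsD_tmul, ringChainsD_tmul]
  simp only [map_add, map_sum, map_zsmul, ringChainsMap_tmul, hl, hr,
    Fin.comp_contractNth _ _ (map_mul ψ)]
  rfl

variable [SMulCommClass S Sᵐᵒᵖ N']

/-- The chain map induced by a ring morphism and an equivariant map of bimodules. -/
def ringChainComplexMap (hl : ∀ (r : R) (n : N), η (r • n) = ψ r • η n)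
    (hr : ∀ (r : R) (n : N), η (MulOpposite.op r • n) = MulOpposite.op (ψ r) • η n) :
    ringChainComplex R N ⟶ ringChainComplex S N' where
  f i := AddCommGrpCat.ofHom (ringChainsMap ψ η i).toAddMonoidHom
  comm' i j h := by
    obtain rfl : j + 1 = i := h
    rw [ringChainComplex_d, ringChainComplex_d]
    exact AddCommGrpCat.hom_ext (AddMonoidHom.ext fun z =>
      (LinearMap.congr_fun (ringChainsMap_d hl hr j) z).symm)

end RingHH

section MonoidAlgebraBimodule

variable {M : Type v} [Monoid M] (B : (OneObj M)ᵒᵖ × OneObj M ⥤ AddCommGrpCat.{w})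

/-- The value of a bifunctor on a one-object category. It is a `ℤ[M]`-bimodule: the left action of
`M` is through the first (contravariant) variable, since `f ≫ g = f * g` in `OneObj M`, and the
right action is through the second variable. -/
def Coeff : Type w := B.obj (op (OneObj.star M), OneObj.star M)

instance : AddCommGroup (Coeff B) :=
  inferInstanceAs (AddCommGroup (B.obj (op (OneObj.star M), OneObj.star M)))

/-- The action `(f, g)` of a pair on the coefficients. -/
def act (f g : M) : AddMonoid.End (Coeff B) :=
  (B.map (X := (op (OneObj.star M), OneObj.star M)) (Y := (op (OneObj.star M), OneObj.star M))
    ((OneObj.hom f).op, OneObj.hom g)).hom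

lemma act_one : act B 1 1 = 1 := congrArg AddCommGrpCat.Hom.hom (B.map_id _)

lemma act_mul (f f' g g' : M) : act B (f' * f) (g * g') = act B f' g' * act B f g :=
  congrArg AddCommGrpCat.Hom.hom (B.map_comp
    (X := (op (OneObj.star M), OneObj.star M)) (Y := (op (OneObj.star M), OneObj.star M))
    (Z := (op (OneObj.star M), OneObj.star M))
    ((OneObj.hom f).op, OneObj.hom g) ((OneObj.hom f').op, OneObj.hom g'))

/-- The left action of `M`, through the first variable. -/
def leftAction : M →* AddMonoid.End (Coeff B) where
  toFun f := act B f 1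
  map_one' := act_one B
  map_mul' f' f := by simpa using act_mul B f f' 1 1

/-- The right action of `M`, through the second variable. -/
def rightAction : M →* (AddMonoid.End (Coeff B))ᵐᵒᵖ where
  toFun g := MulOpposite.op (act B 1 g)
  map_one' := by rw [act_one]; rfl
  map_mul' g g' := by rw [← MulOpposite.op_mul, ← act_mul, mul_one]

instance : Module (MonoidAlgebra ℤ M) (Coeff B) :=
  Module.compHom _ (MonoidAlgebra.lift ℤ (AddMonoid.End (Coeff B)) M (leftAction B)).toRingHom

instance : Module (MonoidAlgebra ℤ M)ᵐᵒᵖ (Coeff B) :=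
  Module.compHom _ ((RingEquiv.opOp (AddMonoid.End (Coeff B))).symm.toRingHom.comp
    (MonoidAlgebra.lift ℤ (AddMonoid.End (Coeff B))ᵐᵒᵖ M (rightAction B)).toRingHom.op)

lemma single_smul (m : M) (a : ℤ) (b : Coeff B) :
    (MonoidAlgebra.single m a : MonoidAlgebra ℤ M) • b = a • act B m 1 b := by
  change (MonoidAlgebra.lift ℤ (AddMonoid.End (Coeff B)) M (leftAction B)
    (MonoidAlgebra.single m a)) b = _
  rw [MonoidAlgebra.lift_single]
  rfl

lemma op_single_smul (m : M) (a : ℤ) (b : Coeff B) :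
    MulOpposite.op (MonoidAlgebra.single m a : MonoidAlgebra ℤ M) • b = a • act B 1 m b := by
  change (MulOpposite.unop (MonoidAlgebra.lift ℤ (AddMonoid.End (Coeff B))ᵐᵒᵖ M (rightAction B)
    (MonoidAlgebra.single m a))) b = _
  rw [MonoidAlgebra.lift_single]
  rfl

instance : SMulCommClass (MonoidAlgebra ℤ M) (MonoidAlgebra ℤ M)ᵐᵒᵖ (Coeff B) where
  smul_comm r s b := by
    induction s using MulOpposite.rec' with | _ s
    induction r using MonoidAlgebra.induction_linear with
    | zero => simp
    | add r r' h h' => rw [add_smul, add_smul, smul_add, h, h']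
    | single m a =>
      induction s using MonoidAlgebra.induction_linear with
      | zero => simp
      | add s s' h h' => rw [MulOpposite.op_add, add_smul, add_smul, smul_add, h, h']
      | single m' a' =>
        rw [single_smul, op_single_smul, op_single_smul, single_smul, map_zsmul, map_zsmul,
          smul_comm]
        refine congrArg (a' • a • ·) ?_
        have h1 := DFunLike.congr_fun (act_mul B 1 m m' 1) b
        have h2 := DFunLike.congr_fun (act_mul B m 1 1 m') b
        rw [mul_one, mul_one] at h1
        rw [one_mul, one_mul] at h2
        exact h1.symm.trans h2

/-- The identification of `Coeff B` with a value of `B`. -/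
def coeffEquiv : B.obj (op (OneObj.star M), OneObj.star M) ≃+ Coeff B := AddEquiv.refl _

lemma compatible_coeff : Compatible (MonoidAlgebra.of ℤ M) B (coeffEquiv B) := by
  intro f g b
  rw [MonoidAlgebra.of_apply, MonoidAlgebra.of_apply, single_smul, op_single_smul, one_smul,
    one_smul]
  have h := DFunLike.congr_fun (act_mul B 1 f g 1) (coeffEquiv B b)
  rw [mul_one, mul_one] at h
  exact h

/-- `ℤ[M]^{⊗ i}` is free on `M^i`. -/
def tensorEquiv (M : Type v) [Monoid M] (i : ℕ) :
    (⨂[ℤ] _ : Fin i, MonoidAlgebra ℤ M) ≃ₗ[ℤ] ((Fin i → M) →₀ ℤ) :=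
  open Classical in
  (PiTensorProduct.congr fun _ => MonoidAlgebra.coeffAddEquiv.toIntLinearEquiv).trans
    PiTensorProduct.ofFinsuppEquiv'

lemma tensorEquiv_tprod {i : ℕ} (g : Fin i → M) :
    tensorEquiv M i (PiTensorProduct.tprod ℤ (MonoidAlgebra.of ℤ M ∘ g)) = Finsupp.single g 1 := by
  classical
  rw [tensorEquiv, LinearEquiv.trans_apply, PiTensorProduct.congr_tprod]
  refine (PiTensorProduct.ofFinsuppEquiv'_tprod_single g (fun _ => (1 : ℤ))).trans ?_
  simp

/-- `N ⊗ ℤ[M]^{⊗ i}` is a direct sum of copies of `N` indexed by `M^i`. -/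
def chainsFinsupp (i : ℕ) :
    RingChains (MonoidAlgebra ℤ M) (Coeff B) i ≃ₗ[ℤ] ((Fin i → M) →₀ Coeff B) :=
  open Classical in
  (TensorProduct.congr (LinearEquiv.refl ℤ (Coeff B)) (tensorEquiv M i)).trans
    (TensorProduct.finsuppScalarRight ℤ ℤ (Coeff B) (Fin i → M))

lemma chainsFinsupp_tprod {i : ℕ} (g : Fin i → M) (b : Coeff B) :
    chainsFinsupp B i (b ⊗ₜ PiTensorProduct.tprod ℤ (MonoidAlgebra.of ℤ M ∘ g)) =
      Finsupp.single g b := by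
  classical
  refine (congrArg (fun z => TensorProduct.finsuppScalarRight ℤ ℤ (Coeff B) (Fin i → M) (b ⊗ₜ z))
    (tensorEquiv_tprod g)).trans ?_
  simp [TensorProduct.finsuppScalarRight_apply_tmul]

open Classical in
/-- `b ⊗ g₁ ⊗ ⋯ ⊗ gᵢ` is sent to `b` in the summand of the simplex with arrows `g₁, …, gᵢ`. -/
def chainsOfRing (i : ℕ) :
    RingChains (MonoidAlgebra ℤ M) (Coeff B) i →+ (chainComplex B).X i :=
  (Finsupp.liftAddHom fun g : Fin i → M =>
    (DirectSum.of (fun x : (nerve (OneObj M)).obj (op ⦋i⦌) =>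
      B.obj (op (x.obj (Fin.last _)), x.obj 0)) (OneObj.simplex g) : Coeff B →+ _)).comp
    (chainsFinsupp B i).toAddEquiv.toAddMonoidHom

open Classical in
lemma chainsOfRing_tprod {i : ℕ} (g : Fin i → M) (b : Coeff B) :
    chainsOfRing B i (b ⊗ₜ PiTensorProduct.tprod ℤ (MonoidAlgebra.of ℤ M ∘ g)) =
      DirectSum.of (fun x : (nerve (OneObj M)).obj (op ⦋i⦌) =>
      B.obj (op (x.obj (Fin.last _)), x.obj 0)) (OneObj.simplex g) b := by
  change Finsupp.liftAddHom _ (chainsFinsupp B i _) = _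
  rw [chainsFinsupp_tprod]
  exact Finsupp.liftAddHom_apply_single _ _ _

open Classical in
lemma of_congr {i : ℕ} {x y : (nerve (OneObj M)).obj (op ⦋i⦌)} (h : x = y) (b : Coeff B) :
    DirectSum.of (fun x : (nerve (OneObj M)).obj (op ⦋i⦌) =>
      B.obj (op (x.obj (Fin.last _)), x.obj 0)) x b =
    DirectSum.of (fun x : (nerve (OneObj M)).obj (op ⦋i⦌) =>
      B.obj (op (x.obj (Fin.last _)), x.obj 0)) y b := by
  subst h; rfl

/-- The Hochschild chains of the ring `ℤ[M]` are those of the one-object category of `M`. -/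
def chainsEquiv (i : ℕ) :
    RingChains (MonoidAlgebra ℤ M) (Coeff B) i ≃+ (chainComplex B).X i where
  toFun := chainsOfRing B i
  invFun := chainsToRing (MonoidAlgebra.of ℤ M) B (coeffEquiv B) i
  map_add' := map_add _
  left_inv z := by
    classical
    obtain ⟨z, rfl⟩ := (chainsFinsupp B i).symm.surjective z
    refine DFunLike.congr_fun (f := ((chainsToRing (MonoidAlgebra.of ℤ M) B (coeffEquiv B) i).comp
      (chainsOfRing B i)).comp (chainsFinsupp B i).symm.toAddEquiv.toAddMonoidHom)
      (g := (chainsFinsupp B i).symm.toAddEquiv.toAddMonoidHom)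
      (Finsupp.addHom_ext fun g b => ?_) z
    have h : (chainsFinsupp B i).symm (Finsupp.single g b) =
        b ⊗ₜ PiTensorProduct.tprod ℤ (MonoidAlgebra.of ℤ M ∘ g) := by
      rw [LinearEquiv.symm_apply_eq, chainsFinsupp_tprod]
    change chainsToRing _ B _ i (chainsOfRing B i ((chainsFinsupp B i).symm _)) =
      (chainsFinsupp B i).symm _
    rw [h, chainsOfRing_tprod]
    refine (chainsToRing_of _ _ _ _ _ _).trans ?_
    rw [OneObj.arrows_simplex]
    rfl
  right_inv z := by
    classical
    refine DFunLike.congr_fun (f := (chainsOfRing B i).comp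
      (chainsToRing (MonoidAlgebra.of ℤ M) B (coeffEquiv B) i))
      (g := AddMonoidHom.id _) (DirectSum.addHom_ext fun
        (x : (nerve (OneObj M)).obj (op ⦋i⦌)) b => ?_) z
    refine (congrArg (chainsOfRing B i) (chainsToRing_of _ B (coeffEquiv B) i x b)).trans ?_
    refine (chainsOfRing_tprod B _ _).trans ?_
    exact of_congr B (OneObj.simplex_arrows x) _

lemma chainsEquiv_d (i : ℕ) (z : RingChains (MonoidAlgebra ℤ M) (Coeff B) (i + 1)) :
    chainsEquiv B i (ringChainsD _ _ i z) =
      ((chainComplex B).d (i + 1) i).hom (chainsEquiv B (i + 1) z) := by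
  obtain ⟨y, rfl⟩ := (chainsEquiv B (i + 1)).symm.surjective z
  rw [AddEquiv.apply_symm_apply]
  apply (chainsEquiv B i).symm.injective
  rw [AddEquiv.symm_apply_apply]
  exact (chainsToRing_d (compatible_coeff B) i y).symm

lemma tensor_hom_ext {P : Type w} [AddCommGroup P] {i : ℕ}
    {f f' : (⨂[ℤ] _ : Fin i, MonoidAlgebra ℤ M) →ₗ[ℤ] P}
    (h : ∀ g : Fin i → M, f (PiTensorProduct.tprod ℤ (MonoidAlgebra.of ℤ M ∘ g)) =
      f' (PiTensorProduct.tprod ℤ (MonoidAlgebra.of ℤ M ∘ g))) : f = f' := by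
  have key : f ∘ₗ (tensorEquiv M i).symm.toLinearMap =
      f' ∘ₗ (tensorEquiv M i).symm.toLinearMap := by
    refine Finsupp.lhom_ext' fun g => LinearMap.ext_ring ?_
    change f ((tensorEquiv M i).symm (Finsupp.single g 1)) =
      f' ((tensorEquiv M i).symm (Finsupp.single g 1))
    rw [← tensorEquiv_tprod, LinearEquiv.symm_apply_apply, h]
  refine LinearMap.ext fun t => ?_
  have := LinearMap.congr_fun key (tensorEquiv M i t)
  simpa using this

lemma eval_congr {i : ℕ} (F : (cochainComplex B).X i) {x y : (nerve (OneObj M)).obj (op ⦋i⦌)}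
    (h : x = y) : (show Coeff B from F x) = F y := by
  subst h; rfl

/-- The Hochschild cochains of the ring `ℤ[M]` are those of the one-object category of `M`: a
multilinear map on `ℤ[M]^i` is the same as a function on `M^i`. -/
def cochainsEquiv (i : ℕ) :
    RingCochains (MonoidAlgebra ℤ M) (Coeff B) i ≃+ (cochainComplex B).X i where
  toFun := cochainsOfRing (MonoidAlgebra.of ℤ M) B (coeffEquiv B) i
  invFun F := PiTensorProduct.lift.symm ((Finsupp.linearCombination ℤ fun g : Fin i → M =>
    (coeffEquiv B (F (OneObj.simplex g)) : Coeff B)).comp (tensorEquiv M i).toLinearMap)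
  map_add' := map_add _
  left_inv f := by
    rw [LinearEquiv.symm_apply_eq]
    refine tensor_hom_ext fun g => ?_
    rw [PiTensorProduct.lift.tprod]
    change Finsupp.linearCombination ℤ _ (tensorEquiv M i _) = _
    rw [tensorEquiv_tprod, Finsupp.linearCombination_single, one_smul]
    change f (MonoidAlgebra.of ℤ M ∘ OneObj.arrows (OneObj.simplex g)) = _
    rw [OneObj.arrows_simplex]
  right_inv F := by
    funext (x : (nerve (OneObj M)).obj (op ⦋i⦌))
    change Finsupp.linearCombination ℤ (fun g : Fin i → M =>
      (coeffEquiv B (F (OneObj.simplex g)) : Coeff B)) (tensorEquiv M i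
        (PiTensorProduct.tprod ℤ (MonoidAlgebra.of ℤ M ∘ OneObj.arrows x))) = F x
    rw [tensorEquiv_tprod, Finsupp.linearCombination_single, one_smul]
    exact eval_congr B F (OneObj.simplex_arrows x)

lemma cochainsEquiv_d (i : ℕ) (f : RingCochains (MonoidAlgebra ℤ M) (Coeff B) i) :
    cochainsEquiv B (i + 1) (ringCochainsD _ _ i f) =
      ((cochainComplex B).d i (i + 1)).hom (cochainsEquiv B i f) :=
  cochainsOfRing_d (compatible_coeff B) i f

end MonoidAlgebraBimodule

section Functoriality

variable {D : Type*} [Category* D] {C : Type*} [Category* C] (Φ : D ⥤ C)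
  (B : Cᵒᵖ × C ⥤ AddCommGrpCat.{w})

/-- The restriction of a bifunctor along a functor. -/
abbrev restrict : Dᵒᵖ × D ⥤ AddCommGrpCat.{w} := Φ.op.prod Φ ⋙ B

open Classical in
/-- The map `HH_*(D; Φ^* B) → HH_*(C; B)` on chains: the summand `B(Φ x_i, Φ x_0)` of the string
`x` goes identically to the summand of the string `Φ x`. -/
def chainsMap (i : ℕ) : (chainComplex (restrict Φ B)).X i →+ (chainComplex B).X i :=
  DirectSum.toAddMonoid fun x : (nerve D).obj (op ⦋i⦌) =>
    DirectSum.of (fun x : (nerve C).obj (op ⦋i⦌) => B.obj (op (x.obj (Fin.last _)), x.obj 0))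
      ((Φ.mapComposableArrows i).obj x)

open Classical in
lemma chainsMap_of (i : ℕ) (x : (nerve D).obj (op ⦋i⦌))
    (b : (restrict Φ B).obj (op (x.obj (Fin.last _)), x.obj 0)) :
    chainsMap Φ B i (DirectSum.of (fun x : (nerve D).obj (op ⦋i⦌) =>
      (restrict Φ B).obj (op (x.obj (Fin.last _)), x.obj 0)) x b) =
    DirectSum.of (fun x : (nerve C).obj (op ⦋i⦌) => B.obj (op (x.obj (Fin.last _)), x.obj 0))
      ((Φ.mapComposableArrows i).obj x) b :=
  DirectSum.toAddMonoid_of _ _ _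

lemma chainsMap_d (i : ℕ) (y : (chainComplex (restrict Φ B)).X (i + 1)) :
    chainsMap Φ B i (((chainComplex (restrict Φ B)).d (i + 1) i).hom y) =
      ((chainComplex B).d (i + 1) i).hom (chainsMap Φ B (i + 1) y) := by
  classical
  rw [chainComplex_d_apply, chainComplex_d_apply]
  refine (map_signed_sum (chainsMap Φ B i) _ _).trans ?_
  refine Finset.sum_congr rfl fun k _ => congrArg _ ?_
  refine DFunLike.congr_fun (f := (chainsMap Φ B i).comp
    ((simplicialChains (restrict Φ B)).δ k).hom)
    (g := ((simplicialChains B).δ k).hom.comp (chainsMap Φ B (i + 1)))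
    (DirectSum.addHom_ext fun (x : (nerve D).obj (op ⦋i + 1⦌)) b => ?_) y
  refine (congrArg (chainsMap Φ B i) (simplicialChains_δ_of (restrict Φ B) i k x b)).trans ?_
  refine (chainsMap_of Φ B i _ _).trans ?_
  refine Eq.trans ?_ (congrArg ((simplicialChains B).δ k).hom (chainsMap_of Φ B (i + 1) x b)).symm
  exact (simplicialChains_δ_of B i k ((Φ.mapComposableArrows (i + 1)).obj x) b).symm

/-- The map `HH^*(C; B) → HH^*(D; Φ^* B)` on cochains. -/
def cochainsMap (i : ℕ) : (cochainComplex B).X i →+ (cochainComplex (restrict Φ B)).X i :=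
  AddMonoidHom.pi fun x : (nerve D).obj (op ⦋i⦌) => Pi.evalAddMonoidHom
    (fun x : (nerve C).obj (op ⦋i⦌) => B.obj (op (x.obj 0), x.obj (Fin.last _)))
    ((Φ.mapComposableArrows i).obj x)

lemma cochainsMap_d (i : ℕ) (y : (cochainComplex B).X i) :
    cochainsMap Φ B (i + 1) (((cochainComplex B).d i (i + 1)).hom y) =
      ((cochainComplex (restrict Φ B)).d i (i + 1)).hom (cochainsMap Φ B i y) := by
  rw [cochainComplex_d_apply, cochainComplex_d_apply]
  exact map_signed_sum (cochainsMap Φ B (i + 1)) _ _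

end Functoriality

section Matrix

variable (A : Type u) [Ring A] (B : (Proj A)ᵒᵖ × Proj A ⥤ AddCommGrpCat.{w}) (n : ℕ)

/-- The multiplicative monoid `M_n(A)` of square matrices of size `n`. -/
abbrev MatrixMonoid (n : ℕ) : Type u := Matrix (Fin n) (Fin n) A

/-- The functor from the one-object category of `M_n(A)` to `P(A)` with value `A^n`, where a matrix
`g` acts on row vectors by `v ↦ v g`; it identifies `M_n(A)` with the endomorphisms of `A^n`. -/
def matrixFunctor : OneObj (MatrixMonoid A n) ⥤ Proj A where
  obj _ := free A n
  map g := ObjectProperty.homMk (ModuleCat.ofHom (Matrix.toLinearMapRight' g))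
  map_id _ := ObjectProperty.hom_ext _ (ModuleCat.hom_ext (LinearMap.ext fun v =>
    Matrix.vecMul_one v))
  map_comp f g := ObjectProperty.hom_ext _ (ModuleCat.hom_ext (LinearMap.ext fun v =>
    (Matrix.vecMul_vecMul v (f : MatrixMonoid A n) (g : MatrixMonoid A n)).symm))

/-- The `ℤ[M_n(A)]`-bimodule `B(A^n, A^n)`. -/
abbrev CoeffMatrix : Type w := Coeff (restrict (matrixFunctor A n) B)

variable {A}

/-- The Hochschild chain complex of the ring `ℤ[M_n(A)]` with coefficients in `B(A^n, A^n)`. -/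
abbrev matrixChainComplex : ChainComplex AddCommGrpCat.{max u w} ℕ :=
  ringChainComplex (MonoidAlgebra ℤ (MatrixMonoid A n)) (CoeffMatrix A B n)

/-- The Hochschild cochain complex of the ring `ℤ[M_n(A)]` with coefficients in `B(A^n, A^n)`. -/
abbrev matrixCochainComplex : CochainComplex AddCommGrpCat.{max u w} ℕ :=
  ringCochainComplex (MonoidAlgebra ℤ (MatrixMonoid A n)) (CoeffMatrix A B n)

/-- The canonical chain map, induced by the functor `matrixFunctor`. As `P(A)` has a large set of
objects, the complex of `ℤ[M_n(A)]` is lifted to the universe of the complex of `P(A)`. -/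
def comparisonChains :
    (AddCommGrpCat.uliftFunctor.{u + 1}.mapHomologicalComplex _).obj (matrixChainComplex B n) ⟶
      chainComplex B where
  f i := AddCommGrpCat.ofHom (((chainsMap (matrixFunctor A n) B i).comp
    (chainsEquiv (restrict (matrixFunctor A n) B) i).toAddMonoidHom).comp
      AddEquiv.ulift.toAddMonoidHom)
  comm' i j h := by
    obtain rfl : j + 1 = i := h
    refine AddCommGrpCat.hom_ext (AddMonoidHom.ext fun z => ?_)
    obtain ⟨z⟩ := z
    refine (chainsMap_d (matrixFunctor A n) B j
      (chainsEquiv (restrict (matrixFunctor A n) B) (j + 1) z)).symm.trans ?_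
    refine congrArg (chainsMap (matrixFunctor A n) B j) ?_
    refine (chainsEquiv_d (restrict (matrixFunctor A n) B) j z).symm.trans ?_
    refine congrArg (chainsEquiv (restrict (matrixFunctor A n) B) j) ?_
    exact (DFunLike.congr_fun (congrArg AddCommGrpCat.Hom.hom (ringChainComplex_d _ _ j)) z).symm

/-- The canonical cochain map, induced by the functor `matrixFunctor`. -/
def comparisonCochains :
    cochainComplex B ⟶
      (AddCommGrpCat.uliftFunctor.{u + 1}.mapHomologicalComplex _).obj
        (matrixCochainComplex B n) where
  f i := AddCommGrpCat.ofHom (AddEquiv.ulift.symm.toAddMonoidHom.comp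
    ((cochainsEquiv (restrict (matrixFunctor A n) B) i).symm.toAddMonoidHom.comp
      (cochainsMap (matrixFunctor A n) B i)))
  comm' i j h := by
    obtain rfl : i + 1 = j := h
    refine AddCommGrpCat.hom_ext (AddMonoidHom.ext fun z => ?_)
    refine congrArg ULift.up ?_
    refine (DFunLike.congr_fun (congrArg AddCommGrpCat.Hom.hom (ringCochainComplex_d _ _ i))
      ((cochainsEquiv (restrict (matrixFunctor A n) B) i).symm
        (cochainsMap (matrixFunctor A n) B i z))).trans ?_
    apply (cochainsEquiv (restrict (matrixFunctor A n) B) (i + 1)).injective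
    refine (cochainsEquiv_d (restrict (matrixFunctor A n) B) i _).trans ?_
    refine Eq.trans ?_ (AddEquiv.apply_symm_apply _ _).symm
    refine Eq.trans ?_ (cochainsMap_d (matrixFunctor A n) B i z).symm
    exact congrArg ((cochainComplex (restrict (matrixFunctor A n) B)).d i (i + 1)).hom
      (AddEquiv.apply_symm_apply _ _)

/-- `HH_i(ℤ[M_n(A)]; B(A^n, A^n))`. -/
abbrev matrixHH (i : ℕ) : AddCommGrpCat.{max u w} := (matrixChainComplex B n).homology i

/-- `HH^i(ℤ[M_n(A)]; B(A^n, A^n))`. -/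
abbrev matrixCoHH (i : ℕ) : AddCommGrpCat.{max u w} := (matrixCochainComplex B n).homology i

/-- `HH_i(P(A); B)`. -/
abbrev projHH (i : ℕ) : AddCommGrpCat.{max (u + 1) w} := (chainComplex B).homology i

/-- `HH^i(P(A); B)`. -/
abbrev projCoHH (i : ℕ) : AddCommGrpCat.{max (u + 1) w} := (cochainComplex B).homology i

/-- The canonical morphism `HH_i(ℤ[M_n(A)]; B(A^n, A^n)) → HH_i(P(A); B)`. -/
def homologyComparison (i : ℕ) : matrixHH B n i →+ projHH B i :=
  (HomologicalComplex.homologyMap (comparisonChains B n) i).hom.comp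
    ((((matrixChainComplex B n).sc i).mapHomologyIso
      AddCommGrpCat.uliftFunctor.{u + 1}).inv.hom.comp AddEquiv.ulift.symm.toAddMonoidHom)

/-- The canonical morphism `HH^i(P(A); B) → HH^i(ℤ[M_n(A)]; B(A^n, A^n))`. -/
def cohomologyComparison (i : ℕ) : projCoHH B i →+ matrixCoHH B n i :=
  AddEquiv.ulift.toAddMonoidHom.comp
  ((((matrixCochainComplex B n).sc i).mapHomologyIso
      AddCommGrpCat.uliftFunctor.{u + 1}).hom.hom.comp
    (HomologicalComplex.homologyMap (comparisonCochains B n) i).hom)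

variable (A) in
/-- The inclusion `M_n(A) → M_{n+1}(A)` of monoids, `g ↦ diag(g, 1)`. -/
def blockHom : MatrixMonoid A n →* MatrixMonoid A (n + 1) where
  toFun g := Matrix.of fun a b => Fin.lastCases (motive := fun _ => A)
    (Fin.lastCases (motive := fun _ => A) 1 (fun _ => 0) b)
    (fun a => Fin.lastCases (motive := fun _ => A) 0 (fun b => g a b) b) a
  map_one' := by
    ext a b
    induction a using Fin.lastCases with
    | last =>
      induction b using Fin.lastCases with
      | last => simp
      | cast b => simp [Matrix.one_apply, (Fin.castSucc_lt_last b).ne']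
    | cast a =>
      induction b using Fin.lastCases with
      | last => simp [Matrix.one_apply, (Fin.castSucc_lt_last a).ne]
      | cast b => simp [Matrix.one_apply]
  map_mul' g h := by
    ext a b
    induction a using Fin.lastCases <;> induction b using Fin.lastCases <;>
      simp [Matrix.mul_apply, Fin.sum_univ_castSucc]

variable (A) in
/-- The projection of `A^{n+1}` onto the first `n` coordinates. -/
def projFirst : free A (n + 1) ⟶ free A n :=
  ObjectProperty.homMk (ModuleCat.ofHom (LinearMap.funLeft A A Fin.castSucc))

variable (A) in
/-- The inclusion of `A^n` in `A^{n+1}` as the first `n` coordinates. -/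
def inclFirst : free A n ⟶ free A (n + 1) :=
  ObjectProperty.homMk (ModuleCat.ofHom (LinearMap.pi fun a =>
    Fin.lastCases (motive := fun _ => (Fin n → A) →ₗ[A] A) 0 (fun a => LinearMap.proj a) a))

variable (A) in
lemma inclFirst_comp (g : MatrixMonoid A n) :
    inclFirst A n ≫ (matrixFunctor A (n + 1)).map (OneObj.hom (blockHom A n g)) =
      (matrixFunctor A n).map (OneObj.hom g) ≫ inclFirst A n := by
  refine ObjectProperty.hom_ext _ (ModuleCat.hom_ext (LinearMap.ext fun v => funext fun a => ?_))
  change Matrix.vecMul (fun a : Fin (n + 1) => Fin.lastCases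
      (motive := fun _ => (Fin n → A) →ₗ[A] A) 0 (fun a => LinearMap.proj a) a v)
      (blockHom A n g) a =
    Fin.lastCases (motive := fun _ => (Fin n → A) →ₗ[A] A) 0 (fun a => LinearMap.proj a) a
      (Matrix.vecMul v g)
  induction a using Fin.lastCases with
  | last =>
    simp [Matrix.vecMul, dotProduct, Fin.sum_univ_castSucc, blockHom]
    exact (LinearMap.zero_apply (M := Fin n → A) (M₂ := A) (σ₁₂ := RingHom.id A) _).symm ▸ rfl
  | cast a => simp [Matrix.vecMul, dotProduct, Fin.sum_univ_castSucc, blockHom]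

variable (A) in
lemma comp_projFirst (g : MatrixMonoid A n) :
    (matrixFunctor A (n + 1)).map (OneObj.hom (blockHom A n g)) ≫ projFirst A n  =
      projFirst A n ≫ (matrixFunctor A n).map (OneObj.hom g) := by
  refine ObjectProperty.hom_ext _ (ModuleCat.hom_ext (LinearMap.ext fun v => funext fun a => ?_))
  change Matrix.vecMul (v : Fin (n + 1) → A) (blockHom A n g) a.castSucc =
    Matrix.vecMul (fun a : Fin n => v a.castSucc) g a
  simp [Matrix.vecMul, dotProduct, Fin.sum_univ_castSucc, blockHom]

/-- The morphism `B(A^n, A^n) → B(A^{n+1}, A^{n+1})` induced by the projection `A^{n+1} → A^n` in the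
first variable and the inclusion `A^n → A^{n+1}` in the second one. -/
def stabCoeff : CoeffMatrix A B n →+ CoeffMatrix A B (n + 1) :=
  (B.map (X := (op (free A n), free A n)) (Y := (op (free A (n + 1)), free A (n + 1)))
    ((projFirst A n).op, inclFirst A n)).hom

lemma stabCoeff_act (f g : MatrixMonoid A n) (b : CoeffMatrix A B n) :
    stabCoeff B n (act _ f g b) = act _ (blockHom A n f) (blockHom A n g) (stabCoeff B n b) := by
  refine DFunLike.congr_fun (f := (stabCoeff B n).comp (act _ f g))
    (g := (act _ (blockHom A n f) (blockHom A n g)).comp (stabCoeff B n)) ?_ b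
  let p : ((op (free A n), free A n) : (Proj A)ᵒᵖ × Proj A) ⟶
      (op (free A (n + 1)), free A (n + 1)) := ((projFirst A n).op, inclFirst A n)
  let q (m : ℕ) (f g : MatrixMonoid A m) : ((op (free A m), free A m) : (Proj A)ᵒᵖ × Proj A) ⟶
      (op (free A m), free A m) :=
    (((matrixFunctor A m).map (OneObj.hom f)).op, (matrixFunctor A m).map (OneObj.hom g))
  have key : q n f g ≫ p = p ≫ q (n + 1) (blockHom A n f) (blockHom A n g) :=
    Prod.ext (Quiver.Hom.unop_inj (comp_projFirst A n f).symm) (inclFirst_comp A n g).symm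
  have := congrArg (fun z => (B.map z).hom) key
  simp only [B.map_comp, AddCommGrpCat.hom_comp] at this
  exact this

lemma stabCoeff_smul (r : MonoidAlgebra ℤ (MatrixMonoid A n)) (b : CoeffMatrix A B n) :
    stabCoeff B n (r • b) =
      MonoidAlgebra.mapDomainRingHom ℤ (blockHom A n) r • stabCoeff B n b := by
  induction r using MonoidAlgebra.induction_linear with
  | zero => simp
  | add r r' h h' => rw [add_smul, map_add, map_add, add_smul, h, h']
  | single m a =>
    rw [single_smul, map_zsmul, stabCoeff_act, MonoidAlgebra.mapDomainRingHom_apply,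
      MonoidAlgebra.mapDomain_single, single_smul, map_one]

lemma stabCoeff_op_smul (r : MonoidAlgebra ℤ (MatrixMonoid A n)) (b : CoeffMatrix A B n) :
    stabCoeff B n (MulOpposite.op r • b) =
      MulOpposite.op (MonoidAlgebra.mapDomainRingHom ℤ (blockHom A n) r) • stabCoeff B n b := by
  induction r using MonoidAlgebra.induction_linear with
  | zero => simp
  | add r r' h h' =>
    rw [MulOpposite.op_add, add_smul, map_add, map_add, MulOpposite.op_add, add_smul, h, h']
  | single m a =>
    rw [op_single_smul, map_zsmul, stabCoeff_act, MonoidAlgebra.mapDomainRingHom_apply,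
      MonoidAlgebra.mapDomain_single, op_single_smul, map_one]

/-- The stabilization morphism
`HH_i(ℤ[M_n(A)]; B(A^n, A^n)) → HH_i(ℤ[M_{n+1}(A)]; B(A^{n+1}, A^{n+1}))`. -/
def stabilization (i : ℕ) : matrixHH B n i →+ matrixHH B (n + 1) i :=
  (HomologicalComplex.homologyMap (ringChainComplexMap (stabCoeff_smul B n)
    (stabCoeff_op_smul B n)) i).hom

end Matrix

end

end MatrixMonoidHH

open MatrixMonoidHH

/-!
The comparison of `P(A)` with its full subcategory on `A^n`, the monoid `M_n(A)`, is governed by a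
vanishing theorem for `Ext` groups of functors with values in abelian groups.

*Polynomial functors.* The deviation of a functor `F` at `p : X ⟶ Y` in the directions
`f_k : X ⟶ Y`, for `1 ≤ k ≤ m`, is the alternating sum of the maps `F(p + ∑_{k ∈ S} f_k)` over the
subsets `S` of `{1, …, m}`. If `F` is polynomial of degree at most `d`, its deviations in `d + 1`
directions that factor through `A` vanish (`SplitShift.deviation_eq_zero`), so those in `d`
directions do not depend on the base point `p`. Nothing else is used about `F`.

*Vanishing of `Ext`.* Let `F` be as above, and let `G` vanish on `A^n`, hence on all the objects
that are retracts of `A^n`. Then `Ext^j(G, F) = 0` if `d (j + 1) ≤ n`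
(`ext_eq_zero_of_deviationVanishes`). The functor `L G : W ↦ ⨁_ψ G(W ⊕ A^d)`, where `ψ` runs
through the morphisms `A^d ⟶ W`, is exact in `G`. It has a natural transformation to `G`: a
difference of deviations of `G` in the `d` directions given by `ψ`, at the projection to `W` and at
`0`. This transformation is zero on `F`, so by naturality the classes in `Ext(G, F)` become zero
when pulled back to `L G`. It is surjective on `G`: for `r > d`, a value of `G` at a sum of `r`
morphisms of rank one is, modulo the image, a combination of values at shorter sums, and the values
at sums of at most `n` such morphisms are zero. Thus `Hom(G, F) = 0`, each class in `Ext^j(G, F)`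
for `j ≥ 1` comes from a class of degree `j - 1` on the kernel of `L G → G`, which vanishes on
`A^{n-d}`, and induction on `j` applies.

*Cohomology.* Let `B(-, V)` be polynomial of degree at most `d` for all `V`. Bifunctors coinduced
from `A^n` in the first variable have no cohomology in positive degrees, and dimension shifting
along the embedding in such a bifunctor turns the vanishing of `Ext` into the vanishing of the
cohomology of `P(A)` relative to `M_n(A)` in the degrees `j` with `d (j + 1) ≤ n`
(`isRelativeCoboundary_of_extVanishes`). The other variable reduces to this one by the reversal of
strings. Relative cohomology in degrees `i` and `i + 1` controls the injectivity and the
surjectivity of restriction in degree `i`, which accounts for the bounds `d (i + 1)` and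
`d (i + 2)`.

*Homology.* The dual of the chain complex of `B` with respect to `ℚ/ℤ` is the cochain complex of
the bifunctor `(U, V) ↦ Hom(B(V, U), ℚ/ℤ)`, which is again polynomial in one variable. As `ℚ/ℤ` is
an injective cogenerator, injectivity and surjectivity in cohomology for this bifunctor give
surjectivity and injectivity in homology for `B`.

*Stabilization.* The inclusions `A^n ⟶ A^{n+1}` and the projections `A^{n+1} ⟶ A^n` make the
functor given by `A^n` a retract of the functor given by `diag(g, 1)` acting on `A^{n+1}`. A
functor and a retract of it induce the same map in Hochschild homology (`exists_chainD_eq_sub`), so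
the comparison map for `n` is the composite of stabilization and the comparison map for `n + 1`
(`homologyComparison_stabilization`), and the claims on stabilization follow from those on the
comparison maps.
-/

namespace MatrixMonoidHH

noncomputable section

/-! ### Ext groups of functors with values in abelian groups -/

section Ext

universe u₁ v₁ t
variable {C : Type u₁} [Category.{v₁} C]

lemma naturality_hom {F G : C ⥤ AddCommGrpCat.{w}} (f : F ⟶ G) {X Y : C} (k : X ⟶ Y)
    (x : F.obj X) : (f.app Y).hom ((F.map k).hom x) = (G.map k).hom ((f.app X).hom x) :=
  ConcreteCategory.congr_hom (f.naturality k) x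

lemma map_comp_hom (F : C ⥤ AddCommGrpCat.{w}) {X Y Z : C} (k : X ⟶ Y) (l : Y ⟶ Z)
    (x : F.obj X) : (F.map (k ≫ l)).hom x = (F.map l).hom ((F.map k).hom x) :=
  ConcreteCategory.congr_hom (F.map_comp k l) x

lemma map_id_hom (F : C ⥤ AddCommGrpCat.{w}) {X : C} (x : F.obj X) :
    (F.map (𝟙 X)).hom x = x :=
  ConcreteCategory.congr_hom (F.map_id X) x

/-- The functor `U ↦ ∏_x Map(Hom(U, x), I x)` attached to a family of abelian groups. -/
def coinducedFamily (I : C → AddCommGrpCat.{max u₁ v₁ t}) : C ⥤ AddCommGrpCat.{max u₁ v₁ t} where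
  obj U := AddCommGrpCat.of (∀ x : C, (U ⟶ x) → I x)
  map k := AddCommGrpCat.ofHom
    { toFun := fun s x y => s x (k ≫ y)
      map_zero' := rfl
      map_add' := fun _ _ => rfl }
  map_id _ := AddCommGrpCat.hom_ext (AddMonoidHom.ext fun s => funext fun x => funext fun y =>
    congrArg (s x) (Category.id_comp y))
  map_comp k l := AddCommGrpCat.hom_ext (AddMonoidHom.ext fun s => funext fun x => funext fun y =>
    congrArg (s x) (Category.assoc k l y))

/-- The morphism to a coinduced functor given by morphisms `F x ⟶ I x`. -/
def toCoinducedFamily (F : C ⥤ AddCommGrpCat.{max u₁ v₁ t}) (I : C → AddCommGrpCat.{max u₁ v₁ t})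
    (h : ∀ x, F.obj x ⟶ I x) : F ⟶ coinducedFamily.{u₁, v₁, t} I where
  app _ := AddCommGrpCat.ofHom
    { toFun := fun s x y => (h x).hom ((F.map y).hom s)
      map_zero' := by funext x y; simp
      map_add' := fun a b => by funext x y; simp }
  naturality U _ k := by
    ext s; funext x y
    exact congrArg (h x).hom (map_comp_hom F k y s).symm

lemma injective_coinducedFamily (I : C → AddCommGrpCat.{max u₁ v₁ t}) [∀ x, Injective (I x)] :
    Injective (coinducedFamily.{u₁, v₁, t} I) where
  factors {X Y} g f _ := by
    let gx (x : C) : X.obj x ⟶ I x := AddCommGrpCat.ofHom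
      { toFun := fun s => ((g.app x).hom s : ∀ z : C, (x ⟶ z) → I z) x (𝟙 x)
        map_zero' := by rw [map_zero]; rfl
        map_add' := fun a b => by rw [map_add]; rfl }
    refine ⟨toCoinducedFamily Y I fun x => Injective.factorThru (gx x) (f.app x), ?_⟩
    ext U s
    funext x y
    change (Injective.factorThru (gx x) (f.app x)).hom ((Y.map y).hom ((f.app U).hom s)) = _
    rw [← naturality_hom]
    refine (ConcreteCategory.congr_hom (Injective.comp_factorThru (gx x) (f.app x)) _).trans ?_
    change ((g.app x).hom ((X.map y).hom s) : ∀ z : C, (x ⟶ z) → I z) x (𝟙 x) = _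
    rw [naturality_hom]
    exact congrArg (((g.app U).hom s : ∀ z : C, (U ⟶ z) → I z) x) (Category.comp_id y)

/-- A functor embeds in the functor coinduced from injective groups that contain its values. -/
instance enoughInjectives_functor : EnoughInjectives (C ⥤ AddCommGrpCat.{max u₁ v₁ t}) where
  presentation F := by
    have := injective_coinducedFamily.{u₁, v₁, t} fun x => Injective.under (F.obj x)
    refine ⟨⟨coinducedFamily.{u₁, v₁, t} fun x => Injective.under (F.obj x), inferInstance,
      toCoinducedFamily F _ fun x => Injective.ι (F.obj x), ?_⟩⟩
    have : ∀ U, Mono ((toCoinducedFamily.{u₁, v₁, t} F _ fun x =>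
        Injective.ι (F.obj x)).app U) := by
      intro U
      rw [AddCommGrpCat.mono_iff_injective, injective_iff_map_eq_zero]
      intro s hs
      have h := congrFun (congrFun hs U) (𝟙 U)
      change (Injective.ι (F.obj U)).hom ((F.map (𝟙 U)).hom s) = 0 at h
      rw [map_id_hom] at h
      exact (injective_iff_map_eq_zero (Injective.ι (F.obj U)).hom).1
        ((AddCommGrpCat.mono_iff_injective _).1 inferInstance) s h
    exact NatTrans.mono_of_mono_app _

end Ext

section ExtNaturality

universe u₁ v₁ t
open Abelian

variable {D : Type u₁} [Category.{v₁} D] [Abelian D] [HasExt.{t} D]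

/-- Two commutative squares of `Ext` classes can be pasted; the second one is a morphism between
short exact sequences. -/
lemma comp_comp_eq_of_squares {X X' Y Y' Z Z' : D} {n : ℕ} {f : Ext X X' 0} {e' : Ext X' Y' n}
    {e : Ext X Y n} {g : Ext Y Y' 0} {d : Ext Y Z 1} {d' : Ext Y' Z' 1} {h : Ext Z Z' 0}
    (sq : f.comp e' (zero_add n) = e.comp g (add_zero n))
    (sq' : d.comp h (add_zero 1) = g.comp d' (zero_add 1)) :
    f.comp (e'.comp d' rfl) (zero_add (n + 1)) = (e.comp d rfl).comp h (add_zero (n + 1)) := by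
  rw [← Ext.comp_assoc f e' d' (zero_add n) rfl (by omega), sq,
    Ext.comp_assoc e g d' (add_zero n) (zero_add 1) (by omega),
    Ext.comp_assoc e d h rfl (add_zero 1) (by omega), sq']

/-- A natural transformation between exact endofunctors acts compatibly on `Ext`. It is checked on
morphisms and on classes of short exact sequences, from which all classes are composed when there
are enough injectives. -/
lemma mapExactFunctor_naturality [EnoughInjectives D] (L L' : D ⥤ D) [L.Additive] [L'.Additive]
    [Limits.PreservesFiniteLimits L] [Limits.PreservesFiniteColimits L]
    [Limits.PreservesFiniteLimits L'] [Limits.PreservesFiniteColimits L'] (τ : L ⟶ L')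
    {G F : D} {n : ℕ} (e : Ext G F n) :
    (Ext.mk₀ (τ.app G)).comp (e.mapExactFunctor L') (zero_add n) =
      (e.mapExactFunctor L).comp (Ext.mk₀ (τ.app F)) (add_zero n) := by
  induction n generalizing F with
  | zero =>
    obtain ⟨f, rfl⟩ := (Ext.mk₀_bijective G F).2 e
    rw [Ext.mapExactFunctor_mk₀, Ext.mapExactFunctor_mk₀, Ext.mk₀_comp_mk₀, Ext.mk₀_comp_mk₀,
      τ.naturality]
  | succ n ih =>
    let S : ShortComplex D := ShortComplex.mk (Injective.ι F) (Limits.cokernel.π (Injective.ι F))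
      (Limits.cokernel.condition _)
    have hS : S.ShortExact :=
      { exact := ShortComplex.exact_of_g_is_cokernel _ (Limits.cokernelIsCokernel _)
        mono_f := inferInstanceAs (Mono (Injective.ι F))
        epi_g := inferInstanceAs (Epi (Limits.cokernel.π (Injective.ι F))) }
    obtain ⟨e', rfl⟩ := Ext.covariant_sequence_exact₁ G hS e
      (Ext.eq_zero_of_injective (I := Injective.under F) _) rfl
    rw [Ext.mapExactFunctor_comp, Ext.mapExactFunctor_comp, Ext.mapExactFunctor_extClass,
      Ext.mapExactFunctor_extClass]
    exact comp_comp_eq_of_squares (ih e') (ShortComplex.ShortExact.extClass_naturality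
      (hS.map_of_exact L) (hS.map_of_exact L') (S.mapNatTrans τ))

lemma mapExactFunctor_id [EnoughInjectives D] {G F : D} {n : ℕ} (e : Ext G F n) :
    e.mapExactFunctor (𝟭 D) = e := by
  induction n generalizing F with
  | zero =>
    obtain ⟨f, rfl⟩ := (Ext.mk₀_bijective G F).2 e
    exact Ext.mapExactFunctor_mk₀ _ _
  | succ n ih =>
    let S : ShortComplex D := ShortComplex.mk (Injective.ι F) (Limits.cokernel.π (Injective.ι F))
      (Limits.cokernel.condition _)
    have hS : S.ShortExact :=
      { exact := ShortComplex.exact_of_g_is_cokernel _ (Limits.cokernelIsCokernel _)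
        mono_f := inferInstanceAs (Mono (Injective.ι F))
        epi_g := inferInstanceAs (Epi (Limits.cokernel.π (Injective.ι F))) }
    obtain ⟨e', rfl⟩ := Ext.covariant_sequence_exact₁ G hS e
      (Ext.eq_zero_of_injective (I := Injective.under F) _) rfl
    rw [Ext.mapExactFunctor_comp, Ext.mapExactFunctor_extClass, ih]
    rfl

/-- If a natural transformation `λ` from an exact functor `L` to the identity vanishes on `F`, then
the pullback along `λ_G` of each class in `Ext(G, F)` is zero. -/
lemma mk₀_comp_eq_zero_of_app_eq_zero [EnoughInjectives D] (L : D ⥤ D) [L.Additive]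
    [Limits.PreservesFiniteLimits L] [Limits.PreservesFiniteColimits L] (τ : L ⟶ 𝟭 D)
    {G F : D} (h : τ.app F = 0) {n : ℕ} (e : Ext G F n) :
    (Ext.mk₀ (τ.app G)).comp e (zero_add n) = 0 := by
  have := mapExactFunctor_naturality L (𝟭 D) τ e
  rw [mapExactFunctor_id, h, Ext.mk₀_zero, Ext.comp_zero] at this
  exact this

/-- If a natural transformation `η` from the identity to an exact functor vanishes on `G` and is
split injective on `F`, then `Ext(G, F) = 0`. -/
lemma ext_eq_zero_of_app_eq_zero [EnoughInjectives D] (Q : D ⥤ D) [Q.Additive]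
    [Limits.PreservesFiniteLimits Q] [Limits.PreservesFiniteColimits Q] (η : 𝟭 D ⟶ Q)
    {G F : D} (h : η.app G = 0) (r : Q.obj F ⟶ F) (hr : η.app F ≫ r = 𝟙 F) {n : ℕ}
    (e : Ext G F n) : e = 0 := by
  have := mapExactFunctor_naturality (𝟭 D) Q η e
  rw [mapExactFunctor_id, h, Ext.mk₀_zero, Ext.zero_comp] at this
  have h2 := congrArg (fun z => z.comp (Ext.mk₀ r) (add_zero n)) this
  simp only [Ext.zero_comp] at h2
  rw [Ext.comp_assoc (a₂ := 0) (a₁₂ := n) (a₂₃ := 0) _ _ _ (by omega) (by omega) (by omega)] at h2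
  rw [← Ext.comp_mk₀_id e, ← hr, ← Ext.mk₀_comp_mk₀]
  exact h2.symm

end ExtNaturality

/-! ### Exactness of sequences of functors -/

section Pointwise

universe u₁ v₁
variable {C : Type u₁} [Category.{v₁} C]

/-- A short exact sequence of functors is exact at each object. -/
lemma ShortExact.pointwise {S : ShortComplex (C ⥤ AddCommGrpCat.{w})} (hS : S.ShortExact) (X : C) :
    Function.Injective (S.f.app X).hom ∧
    (∀ y, (S.g.app X).hom y = 0 → ∃ x, (S.f.app X).hom x = y) ∧
    Function.Surjective (S.g.app X).hom := by
  have h := hS.map_of_exact ((evaluation C AddCommGrpCat.{w}).obj X)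
  exact ⟨(AddCommGrpCat.mono_iff_injective _).1 h.mono_f,
    (ShortComplex.ab_exact_iff _).1 h.exact, (AddCommGrpCat.epi_iff_surjective _).1 h.epi_g⟩

/-- A sequence of functors that is short exact at each object is short exact. -/
lemma shortExact_of_pointwise {S : ShortComplex (C ⥤ AddCommGrpCat.{w})}
    (hf : ∀ X, Function.Injective (S.f.app X).hom)
    (hfg : ∀ X y, (S.g.app X).hom y = 0 → ∃ x, (S.f.app X).hom x = y)
    (hg : ∀ X, Function.Surjective (S.g.app X).hom) : S.ShortExact where
  exact := by
    rw [ShortComplex.exact_iff_isZero_homology, Functor.isZero_iff]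
    intro X
    refine Limits.IsZero.of_iso ?_
      (S.mapHomologyIso ((evaluation C AddCommGrpCat.{w}).obj X)).symm
    rw [← ShortComplex.exact_iff_isZero_homology, ShortComplex.ab_exact_iff]
    exact hfg X
  mono_f := by
    have : ∀ X, Mono (S.f.app X) := fun X => (AddCommGrpCat.mono_iff_injective _).2 (hf X)
    exact NatTrans.mono_of_mono_app _
  epi_g := by
    have : ∀ X, Epi (S.g.app X) := fun X => (AddCommGrpCat.epi_iff_surjective _).2 (hg X)
    exact NatTrans.epi_of_epi_app _

lemma shortExact_kernel_of_surjective {F G : C ⥤ AddCommGrpCat.{w}} (g : F ⟶ G)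
    (hg : ∀ X, Function.Surjective (g.app X).hom) :
    (ShortComplex.mk (Limits.kernel.ι g) g (Limits.kernel.condition g)).ShortExact where
  exact := ShortComplex.exact_of_f_is_kernel _ (Limits.kernelIsKernel g)
  mono_f := inferInstanceAs (Mono (Limits.kernel.ι g))
  epi_g := by
    have : ∀ X, Epi (g.app X) := fun X => (AddCommGrpCat.epi_iff_surjective _).2 (hg X)
    exact NatTrans.epi_of_epi_app g

lemma shortExact_cokernel_of_injective {F G : C ⥤ AddCommGrpCat.{w}} (f : F ⟶ G)
    (hf : ∀ X, Function.Injective (f.app X).hom) :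
    (ShortComplex.mk f (Limits.cokernel.π f) (Limits.cokernel.condition f)).ShortExact where
  exact := ShortComplex.exact_of_g_is_cokernel _ (Limits.cokernelIsCokernel f)
  mono_f := by
    have : ∀ X, Mono (f.app X) := fun X => (AddCommGrpCat.mono_iff_injective _).2 (hf X)
    exact NatTrans.mono_of_mono_app f
  epi_g := inferInstanceAs (Epi (Limits.cokernel.π f))

end Pointwise

/-! ### Deviations of functors on additive categories -/

section Deviation

universe u₁ v₁ t
variable {C : Type u₁} [Category.{v₁} C] [Preadditive C] (a : C)

/-- A morphism that factors through `a`. -/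
def RankOne {X Y : C} (f : X ⟶ Y) : Prop := ∃ (α : X ⟶ a) (β : a ⟶ Y), f = α ≫ β

/-- The identity of `X` is a sum of `n` morphisms that factor through `a`; equivalently, `X` is a
retract of a sum of `n` copies of `a`. -/
def RankLE (n : ℕ) (X : C) : Prop :=
  ∃ (α : Fin n → (X ⟶ a)) (β : Fin n → (a ⟶ X)), ∑ k, α k ≫ β k = 𝟙 X

/-- A sum of `n` copies of `a`. -/
structure Power (n : ℕ) where
  /-- The sum. -/
  obj : C
  /-- The inclusions of the summands. -/
  ι : Fin n → (a ⟶ obj)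
  /-- The projections on the summands. -/
  π : Fin n → (obj ⟶ a)
  ι_π_self : ∀ k, ι k ≫ π k = 𝟙 a
  ι_π_ne : ∀ k l, k ≠ l → ι k ≫ π l = 0
  total : ∑ k, π k ≫ ι k = 𝟙 obj

variable {a}

lemma Power.rankLE {n : ℕ} (P : Power a n) : RankLE a n P.obj := ⟨P.π, P.ι, P.total⟩

lemma RankLE.mono {m n : ℕ} (h : m ≤ n) {X : C} (hX : RankLE a m X) : RankLE a n X := by
  obtain ⟨k, rfl⟩ := Nat.exists_eq_add_of_le h
  obtain ⟨α, β, hαβ⟩ := hX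
  refine ⟨Fin.addCases α (fun _ => 0), Fin.addCases β (fun _ => 0), ?_⟩
  simp [Fin.sum_univ_add, hαβ]

lemma RankLE.biprod [Limits.HasBinaryBiproducts C] {m n : ℕ} {X Y : C} (hX : RankLE a m X)
    (hY : RankLE a n Y) : RankLE a (m + n) (X ⊞ Y) := by
  obtain ⟨α, β, h⟩ := hX
  obtain ⟨α', β', h'⟩ := hY
  refine ⟨Fin.addCases (fun k => Limits.biprod.fst ≫ α k) (fun k => Limits.biprod.snd ≫ α' k),
    Fin.addCases (fun k => β k ≫ Limits.biprod.inl) (fun k => β' k ≫ Limits.biprod.inr), ?_⟩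
  have e (k : Fin m) :
      (Limits.biprod.fst (X := X) (Y := Y) ≫ α k) ≫ β k ≫ Limits.biprod.inl (Y := Y) =
      Limits.biprod.fst ≫ (α k ≫ β k) ≫ Limits.biprod.inl := by simp
  have e' (k : Fin n) :
      (Limits.biprod.snd (X := X) (Y := Y) ≫ α' k) ≫ β' k ≫ Limits.biprod.inr (X := X) =
      Limits.biprod.snd ≫ (α' k ≫ β' k) ≫ Limits.biprod.inr := by simp
  simp only [Fin.sum_univ_add, Fin.addCases_left, Fin.addCases_right, e, e']
  rw [← Preadditive.comp_sum, ← Preadditive.sum_comp, ← Preadditive.comp_sum,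
    ← Preadditive.sum_comp, h, h', Category.id_comp, Category.id_comp, Limits.biprod.total]

/-- A sum of `n` morphisms that factor through `a` factors through a sum of `n` copies of `a`. -/
lemma Power.lift_comp_desc {n : ℕ} (P : Power a n) {X Y : C} (α : Fin n → (X ⟶ a))
    (β : Fin n → (a ⟶ Y)) :
    (∑ k, α k ≫ P.ι k) ≫ (∑ k, P.π k ≫ β k) = ∑ k, α k ≫ β k := by
  rw [Preadditive.sum_comp]
  refine Finset.sum_congr rfl fun k _ => ?_
  rw [Category.assoc, Preadditive.comp_sum, Finset.sum_eq_single k]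
  · rw [← Category.assoc (P.ι k), P.ι_π_self, Category.id_comp]
  · intro l _ hl
    rw [← Category.assoc, P.ι_π_ne k l hl.symm, Limits.zero_comp]
  · simp

/-- The deviation `∑_{S ⊆ T} (-1)^|S| F(p + ∑_{k ∈ S} f_k)` of a functor on an additive category:
up to a sign, the iterated difference at `p`, in the directions `f_k`, of the map `F` on
morphisms. -/
def deviation {ι : Type*} (F : C ⥤ AddCommGrpCat.{w}) (T : Finset ι) {X Y : C} (f : ι → (X ⟶ Y))
    (p : X ⟶ Y) : F.obj X →+ F.obj Y :=
  ∑ S ∈ T.powerset, (-1 : ℤ) ^ S.card • (F.map (p + ∑ k ∈ S, f k)).hom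

section

variable {ι : Type*} {F : C ⥤ AddCommGrpCat.{w}} (T : Finset ι) {X Y : C} (f : ι → (X ⟶ Y))
    (p : X ⟶ Y)

lemma deviation_apply (x : F.obj X) : deviation F T f p x =
    ∑ S ∈ T.powerset, (-1 : ℤ) ^ S.card • (F.map (p + ∑ k ∈ S, f k)).hom x := by
  simp [deviation]

lemma deviation_comp {Z : C} (k : Y ⟶ Z) (x : F.obj X) :
    (F.map k).hom (deviation F T f p x) = deviation F T (fun l => f l ≫ k) (p ≫ k) x := by
  simp only [deviation_apply, map_sum, map_zsmul, ← map_comp_hom, Preadditive.add_comp,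
    Preadditive.sum_comp]

lemma comp_deviation {Z : C} (k : Z ⟶ X) (x : F.obj Z) :
    deviation F T f p ((F.map k).hom x) = deviation F T (fun l => k ≫ f l) (k ≫ p) x := by
  simp only [deviation_apply, ← map_comp_hom, Preadditive.comp_add, Preadditive.comp_sum]

lemma deviation_naturality {G : C ⥤ AddCommGrpCat.{w}} (τ : F ⟶ G) (x : F.obj X) :
    (τ.app Y).hom (deviation F T f p x) = deviation G T f p ((τ.app X).hom x) := by
  simp only [deviation_apply, map_sum, map_zsmul, naturality_hom]

/-- A deviation in one more direction is a difference of two deviations. -/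
lemma deviation_insert [DecidableEq ι] {j : ι} (hj : j ∉ T) :
    deviation F (insert j T) f p = deviation F T f p - deviation F T f (p + f j) := by
  ext x
  simp only [AddMonoidHom.sub_apply, deviation_apply]
  rw [Finset.sum_powerset_insert hj, sub_eq_add_neg, ← Finset.sum_neg_distrib]
  refine congrArg₂ _ rfl (Finset.sum_congr rfl fun S hS => ?_)
  have hjS : j ∉ S := fun h => hj (Finset.mem_powerset.1 hS h)
  rw [Finset.card_insert_of_notMem hjS, Finset.sum_insert hjS, pow_succ, add_assoc]
  simp

lemma deviation_map {κ : Type*} (e : κ ↪ ι) (T : Finset κ) :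
    deviation F (T.map e) f p = deviation F T (fun k => f (e k)) p := by
  classical
  induction T using Finset.induction_on generalizing p with
  | empty => simp [deviation]
  | insert j T hj ih =>
    rw [Finset.map_insert, deviation_insert _ _ _ (by simpa using hj), deviation_insert _ _ _ hj,
      ih, ih]

end

variable (a) in
/-- The deviations of `F` in `d + 1` directions that factor through `a` vanish: for
`C = P(A)` and `a = A`, the functor `F` is polynomial of degree at most `d`. -/
def DeviationVanishes (F : C ⥤ AddCommGrpCat.{w}) (d : ℕ) : Prop :=
  ∀ (X Y : C) (p : X ⟶ Y) (f : ℕ → (X ⟶ Y)), (∀ k, RankOne a (f k)) →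
    deviation F (Finset.range (d + 1)) f p = 0

/-- If the deviations in `d + 1` directions vanish, those in `d` directions do not depend on the
base point. -/
lemma DeviationVanishes.deviation_eq {F : C ⥤ AddCommGrpCat.{w}} {d m : ℕ}
    (hF : DeviationVanishes a F d) {X Y : C} (hX : RankLE a m X) (f : ℕ → (X ⟶ Y))
    (hf : ∀ k, RankOne a (f k)) (p : X ⟶ Y) :
    deviation F (Finset.range d) f p = deviation F (Finset.range d) f 0 := by
  -- The base point can be moved along a morphism that factors through `a`.
  have step (q r : X ⟶ Y) (hr : RankOne a r) :
      deviation F (Finset.range d) f (q + r) = deviation F (Finset.range d) f q := by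
    have h := hF X Y q (Function.update f d r) fun k => by
      by_cases hk : k = d
      · subst hk; simpa using hr
      · simpa [hk] using hf k
    rw [Finset.range_add_one, deviation_insert _ _ _ Finset.notMem_range_self, sub_eq_zero] at h
    have e (s : X ⟶ Y) : deviation F (Finset.range d) (Function.update f d r) s =
        deviation F (Finset.range d) f s := by
      refine Finset.sum_congr rfl fun S hS => ?_
      have : ∑ k ∈ S, Function.update f d r k = ∑ k ∈ S, f k := by
        refine Finset.sum_congr rfl fun k hk => Function.update_of_ne ?_ _ _
        exact (Finset.mem_range.1 (Finset.mem_powerset.1 hS hk)).ne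
      rw [this]
    rw [e, e, Function.update_self] at h
    exact h.symm
  obtain ⟨α, β, h⟩ := hX
  -- Every morphism out of `X` is a sum of morphisms that factor through `a`.
  have key (s : Finset (Fin m)) :
      deviation F (Finset.range d) f (∑ k ∈ s, α k ≫ β k ≫ p) =
        deviation F (Finset.range d) f 0 := by
    classical
    induction s using Finset.induction_on with
    | empty => simp
    | insert k s hk ih =>
      rw [Finset.sum_insert hk, add_comm, step _ _ ⟨α k, β k ≫ p, rfl⟩, ih]
  have := key Finset.univ
  simp only [← Category.assoc] at this
  rwa [← Preadditive.sum_comp, h, Category.id_comp] at this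

/-- The form of `DeviationVanishes.deviation_eq` for directions indexed by `Fin d`. -/
lemma DeviationVanishes.deviation_fin_eq {F : C ⥤ AddCommGrpCat.{w}} {d m : ℕ}
    (hF : DeviationVanishes a F d) {X Y : C} (hX : RankLE a m X) (f : Fin d → (X ⟶ Y))
    (hf : ∀ k, RankOne a (f k)) (p : X ⟶ Y) :
    deviation F Finset.univ f p = deviation F Finset.univ f 0 := by
  let f' (k : ℕ) : X ⟶ Y := if h : k < d then f ⟨k, h⟩ else 0
  have e (q : X ⟶ Y) : deviation F Finset.univ f q = deviation F (Finset.range d) f' q := by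
    have h : Finset.range d = (Finset.univ : Finset (Fin d)).map Fin.valEmbedding := by
      ext k
      simp
    rw [h, deviation_map]
    refine congrArg (fun g => deviation F Finset.univ g q) (funext fun k => ?_)
    simp [f']
  rw [e, e]
  refine hF.deviation_eq hX f' (fun k => ?_) p
  by_cases h : k < d
  · simpa [f', h] using hf _
  · exact ⟨0, 0, by simp [f', h]⟩

/-- If `G` vanishes on the objects of rank at most `n`, then it vanishes on the sums of at most `n`
morphisms that factor through `a`. -/
lemma map_sum_rankOne_eq_zero (powers : ∀ r, Power a r) {G : C ⥤ AddCommGrpCat.{w}} {n : ℕ}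
    (hG : ∀ X, RankLE a n X → ∀ x : G.obj X, x = 0) {X Y : C} {ι : Type} [LinearOrder ι]
    (S : Finset ι) (hS : S.card ≤ n) (f : ι → (X ⟶ Y)) (hf : ∀ k, RankOne a (f k)) (x : G.obj X) :
    (G.map (∑ k ∈ S, f k)).hom x = 0 := by
  choose α β hαβ using hf
  have h : ∑ k ∈ S, f k = ∑ k : Fin S.card, α (S.orderEmbOfFin rfl k) ≫
      β (S.orderEmbOfFin rfl k) := by
    simp only [← hαβ]
    refine Eq.trans ?_ (Finset.sum_map Finset.univ (S.orderEmbOfFin rfl).toEmbedding f)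
    rw [Finset.map_orderEmbOfFin_univ]
  rw [h, ← (powers S.card).lift_comp_desc, map_comp_hom]
  rw [hG (powers S.card).obj ((powers S.card).rankLE.mono hS) ((G.map _).hom x), map_zero]

end Deviation

/-! ### Sums of shifts of a functor -/

section ShiftSum

universe u₁ v₁ t
variable {C : Type u₁} [Category.{v₁} C] [Preadditive C] [Limits.HasBinaryBiproducts C] (b : C)

/-- The map `⨁_{ψ : b ⟶ W} G(W ⊞ b) → ⨁_{ψ : b ⟶ W'} G(W' ⊞ b)` induced by `k : W ⟶ W'`. -/
def shiftSumHom (G : C ⥤ AddCommGrpCat.{w}) {W W' : C} (k : W ⟶ W') :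
    ((b ⟶ W) →₀ G.obj (W ⊞ b)) →+ ((b ⟶ W') →₀ G.obj (W' ⊞ b)) :=
  Finsupp.liftAddHom fun ψ =>
    (Finsupp.singleAddHom (ψ ≫ k)).comp (G.map (Limits.biprod.map k (𝟙 b))).hom

lemma shiftSumHom_single (G : C ⥤ AddCommGrpCat.{w}) {W W' : C} (k : W ⟶ W')
    (ψ : b ⟶ W) (x : G.obj (W ⊞ b)) : shiftSumHom b G k (Finsupp.single ψ x) =
      Finsupp.single (ψ ≫ k) ((G.map (Limits.biprod.map k (𝟙 b))).hom x) :=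
  Finsupp.liftAddHom_apply_single _ _ _

lemma shiftSumHom_id (G : C ⥤ AddCommGrpCat.{w}) (W : C) :
    shiftSumHom b G (𝟙 W) = AddMonoidHom.id _ := by
  refine Finsupp.addHom_ext fun ψ x => ?_
  have h : Limits.biprod.map (𝟙 W) (𝟙 b) = 𝟙 (W ⊞ b) := by ext <;> simp
  rw [shiftSumHom_single, h, map_id_hom, Category.comp_id, AddMonoidHom.id_apply]

lemma shiftSumHom_comp (G : C ⥤ AddCommGrpCat.{w}) {W W' W'' : C} (k : W ⟶ W') (l : W' ⟶ W'') :
    shiftSumHom b G (k ≫ l) = (shiftSumHom b G l).comp (shiftSumHom b G k) := by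
  refine Finsupp.addHom_ext fun ψ x => ?_
  have h : Limits.biprod.map (k ≫ l) (𝟙 b) =
    Limits.biprod.map k (𝟙 b) ≫ Limits.biprod.map l (𝟙 b) := by ext <;> simp
  rw [AddMonoidHom.comp_apply, shiftSumHom_single, shiftSumHom_single, shiftSumHom_single, h,
    map_comp_hom, Category.assoc]

lemma shiftSumHom_mapRange {G H : C ⥤ AddCommGrpCat.{w}} (τ : G ⟶ H) {W W' : C} (k : W ⟶ W') :
    (Finsupp.mapRange.addMonoidHom (τ.app (W' ⊞ b)).hom).comp (shiftSumHom b G k) =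
      (shiftSumHom b H k).comp (Finsupp.mapRange.addMonoidHom (τ.app (W ⊞ b)).hom) := by
  refine Finsupp.addHom_ext fun ψ x => ?_
  rw [AddMonoidHom.comp_apply, AddMonoidHom.comp_apply, shiftSumHom_single,
    Finsupp.mapRange.addMonoidHom_apply, Finsupp.mapRange.addMonoidHom_apply,
    Finsupp.mapRange_single, Finsupp.mapRange_single, shiftSumHom_single, naturality_hom]

/-- The functor `W ↦ ⨁_{ψ : b ⟶ W} G(W ⊞ b)`. The sum over `ψ` is there because a
map `G(W ⊞ b) → G(W)` that uses `ψ` is natural only if `ψ` moves along with `W`. -/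
def shiftSum (G : C ⥤ AddCommGrpCat.{max u₁ v₁ t}) : C ⥤ AddCommGrpCat.{max u₁ v₁ t} where
  obj W := AddCommGrpCat.of ((b ⟶ W) →₀ G.obj (W ⊞ b))
  map k := AddCommGrpCat.ofHom (shiftSumHom b G k)
  map_id W := AddCommGrpCat.hom_ext (shiftSumHom_id b G W)
  map_comp k l := AddCommGrpCat.hom_ext (shiftSumHom_comp b G k l)

/-- `shiftSum` as an endofunctor of the category of functors. -/
def shiftSumFunctor :
    (C ⥤ AddCommGrpCat.{max u₁ v₁ t}) ⥤ (C ⥤ AddCommGrpCat.{max u₁ v₁ t}) where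
  obj G := shiftSum.{u₁, v₁, t} b G
  map τ :=
    { app := fun W => AddCommGrpCat.ofHom (Finsupp.mapRange.addMonoidHom (τ.app (W ⊞ b)).hom)
      naturality := fun _ _ k => AddCommGrpCat.hom_ext (shiftSumHom_mapRange b τ k) }
  map_id _ := NatTrans.ext (funext fun _ => AddCommGrpCat.hom_ext
    (AddMonoidHom.ext fun _ => Finsupp.ext fun _ => rfl))
  map_comp _ _ := NatTrans.ext (funext fun _ => AddCommGrpCat.hom_ext
    (AddMonoidHom.ext fun _ => Finsupp.ext fun _ => rfl))

instance : (shiftSumFunctor.{u₁, v₁, t} b).Additive where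
  map_add := NatTrans.ext (funext fun _ => AddCommGrpCat.hom_ext
    (AddMonoidHom.ext fun _ => Finsupp.ext fun _ => rfl))

/-- The functor `shiftSum` is exact: kernels, cokernels and direct sums are computed pointwise. -/
lemma shiftSumFunctor_exact : Limits.PreservesFiniteLimits (shiftSumFunctor.{u₁, v₁, t} b) ∧
    Limits.PreservesFiniteColimits (shiftSumFunctor.{u₁, v₁, t} b) := by
  refine ((Functor.exact_tfae (shiftSumFunctor.{u₁, v₁, t} b)).out 0 3).1 fun S hS => ?_
  refine shortExact_of_pointwise (fun W => ?_) (fun W => ?_) (fun W => ?_)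
  · exact Finsupp.mapRange_injective _ (map_zero _) (ShortExact.pointwise hS (W ⊞ b)).1
  · intro (z : (b ⟶ W) →₀ S.X₂.obj (W ⊞ b)) hz
    -- Preimages are chosen with `0 ↦ 0`, so that they preserve finiteness of supports.
    have h (x : S.X₂.obj (W ⊞ b)) : ∃ y, ((S.g.app (W ⊞ b)).hom x = 0 →
        (S.f.app (W ⊞ b)).hom y = x) ∧ (x = 0 → y = 0) := by
      by_cases hx : x = 0
      · exact ⟨0, by simp [hx]⟩
      · by_cases hx' : (S.g.app (W ⊞ b)).hom x = 0
        · obtain ⟨y, hy⟩ := (ShortExact.pointwise hS (W ⊞ b)).2.1 x hx'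
          exact ⟨y, fun _ => hy, fun h => absurd h hx⟩
        · exact ⟨0, fun h => absurd h hx', fun _ => rfl⟩
    choose s hs hs0 using h
    refine ⟨Finsupp.mapRange s (hs0 0 rfl) z, Finsupp.ext fun ψ => hs _ ?_⟩
    exact DFunLike.congr_fun
      (show Finsupp.mapRange (S.g.app (W ⊞ b)).hom (map_zero _) z = 0 from hz) ψ
  · exact Finsupp.mapRange_surjective _ (map_zero _) (ShortExact.pointwise hS (W ⊞ b)).2.2

variable {b} {a : C} {d : ℕ} (P : Power a d)

/-- The `k`-th direction `W ⊞ a^d ⟶ a ⟶ W` given by `ψ : a^d ⟶ W`. -/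
def Power.direction {W : C} (ψ : P.obj ⟶ W) (k : Fin d) : W ⊞ P.obj ⟶ W :=
  (Limits.biprod.snd ≫ P.π k) ≫ (P.ι k ≫ ψ)

/-- The map `G(W ⊞ a^d) → G(W)` attached to `ψ : a^d ⟶ W`: the difference of the deviations at the
projection `W ⊞ a^d ⟶ W` and at `0`, in the `d` directions given by `ψ`. -/
def shiftSumMap (G : C ⥤ AddCommGrpCat.{w}) {W : C} (ψ : P.obj ⟶ W) :
    G.obj (W ⊞ P.obj) →+ G.obj W :=
  deviation G Finset.univ (P.direction ψ) Limits.biprod.fst -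
    deviation G Finset.univ (P.direction ψ) 0

lemma map_shiftSumMap (G : C ⥤ AddCommGrpCat.{w}) {W W' : C} (k : W ⟶ W') (ψ : P.obj ⟶ W)
    (x : G.obj (W ⊞ P.obj)) : (G.map k).hom (shiftSumMap P G ψ x) =
      shiftSumMap P G (ψ ≫ k) ((G.map (Limits.biprod.map k (𝟙 P.obj))).hom x) := by
  simp only [shiftSumMap, AddMonoidHom.sub_apply, comp_deviation, map_sub, deviation_comp,
    Power.direction]
  simp

/-- The sum over `ψ` of the maps `shiftSumMap`. -/
def shiftSumCounitHom (G : C ⥤ AddCommGrpCat.{w}) (W : C) :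
    ((P.obj ⟶ W) →₀ G.obj (W ⊞ P.obj)) →+ G.obj W :=
  Finsupp.liftAddHom fun ψ => shiftSumMap P G ψ

lemma shiftSumCounitHom_single (G : C ⥤ AddCommGrpCat.{w}) {W : C} (ψ : P.obj ⟶ W)
    (x : G.obj (W ⊞ P.obj)) :
    shiftSumCounitHom P G W (Finsupp.single ψ x) = shiftSumMap P G ψ x :=
  Finsupp.liftAddHom_apply_single _ _ _

lemma shiftSumCounitHom_comp (G : C ⥤ AddCommGrpCat.{w}) {W W' : C} (k : W ⟶ W') :
    (shiftSumCounitHom P G W').comp (shiftSumHom P.obj G k) =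
      (G.map k).hom.comp (shiftSumCounitHom P G W) := by
  refine Finsupp.addHom_ext fun ψ x => ?_
  rw [AddMonoidHom.comp_apply, AddMonoidHom.comp_apply, shiftSumHom_single,
    shiftSumCounitHom_single, shiftSumCounitHom_single, map_shiftSumMap]

lemma shiftSumCounitHom_mapRange {G H : C ⥤ AddCommGrpCat.{w}} (τ : G ⟶ H) (W : C) :
    (shiftSumCounitHom P H W).comp (Finsupp.mapRange.addMonoidHom (τ.app (W ⊞ P.obj)).hom) =
      (τ.app W).hom.comp (shiftSumCounitHom P G W) := by
  refine Finsupp.addHom_ext fun ψ x => ?_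
  rw [AddMonoidHom.comp_apply, AddMonoidHom.comp_apply, Finsupp.mapRange.addMonoidHom_apply,
    Finsupp.mapRange_single, shiftSumCounitHom_single, shiftSumCounitHom_single]
  simp only [shiftSumMap, AddMonoidHom.sub_apply, map_sub, deviation_naturality]

/-- The natural transformation from `shiftSum` to the identity with components `shiftSumMap`. -/
def shiftSumCounit : shiftSumFunctor.{u₁, v₁, t} P.obj ⟶ 𝟭 (C ⥤ AddCommGrpCat.{max u₁ v₁ t}) where
  app G :=
    { app := fun W => AddCommGrpCat.ofHom (shiftSumCounitHom P G W)
      naturality := fun _ _ k => AddCommGrpCat.hom_ext (shiftSumCounitHom_comp P G k) }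
  naturality _ _ τ := NatTrans.ext (funext fun W =>
    AddCommGrpCat.hom_ext (shiftSumCounitHom_mapRange P τ W))

/-- The natural transformation `shiftSumCounit` vanishes on polynomial functors. -/
lemma shiftSumCounit_app_eq_zero {F : C ⥤ AddCommGrpCat.{max u₁ v₁ t}}
    (hF : DeviationVanishes a F d) (hC : ∀ X : C, ∃ m, RankLE a m X) :
    (shiftSumCounit.{u₁, v₁, t} P).app F = 0 := by
  have h (W : C) : shiftSumCounitHom P F W = 0 := by
    refine Finsupp.addHom_ext fun ψ x => ?_
    obtain ⟨m, hm⟩ := hC (W ⊞ P.obj)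
    rw [shiftSumCounitHom_single, shiftSumMap,
      hF.deviation_fin_eq hm (P.direction ψ) (fun k => ⟨_, _, rfl⟩), sub_self]
    rfl
  exact NatTrans.ext (funext fun W => AddCommGrpCat.hom_ext (h W))

/-- If `G` vanishes on the objects of rank at most `n`, where `d ≤ n`, then `shiftSumCounit` is an
epimorphism at `G`: modulo its image, `G(h₁ + ⋯ + h_r)` is, for `h_k` of rank one and `r > d`, an
alternating sum of values of `G` at shorter sums. -/
lemma shiftSumCounitHom_surjective (powers : ∀ r, Power a r)
    (hC : ∀ X : C, ∃ m, RankLE a m X) {G : C ⥤ AddCommGrpCat.{w}} {n : ℕ} (hd : d ≤ n)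
    (hG : ∀ X, RankLE a n X → ∀ x : G.obj X, x = 0) (W : C) :
    Function.Surjective (shiftSumCounitHom P G W) := by
  intro z
  obtain ⟨m, α, β, hαβ⟩ := hC W
  let I : AddSubgroup (G.obj W) := (shiftSumCounitHom P G W).range
  let h (k : Fin m) : W ⟶ W := α k ≫ β k
  have hh (k : Fin m) : RankOne a (h k) := ⟨α k, β k, rfl⟩
  -- The image contains the deviations in `d` of the directions `h k`, at each base point.
  have step (p : W ⟶ W) (σ : Fin d → Fin m) :
      deviation G Finset.univ (fun k => h (σ k)) p z ∈ I := by
    let ψ : P.obj ⟶ W := ∑ k, P.π k ≫ β (σ k)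
    let q : W ⟶ W ⊞ P.obj := Limits.biprod.lift p (∑ k, α (σ k) ≫ P.ι k)
    have e (k : Fin d) : q ≫ P.direction ψ k = h (σ k) := by
      have e₁ : (∑ l, α (σ l) ≫ P.ι l) ≫ P.π k = α (σ k) := by
        rw [Preadditive.sum_comp, Finset.sum_eq_single k]
        · rw [Category.assoc, P.ι_π_self, Category.comp_id]
        · intro l _ hl
          rw [Category.assoc, P.ι_π_ne l k hl, Limits.comp_zero]
        · simp
      have e₂ : P.ι k ≫ ψ = β (σ k) := by
        rw [Preadditive.comp_sum, Finset.sum_eq_single k]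
        · rw [← Category.assoc, P.ι_π_self, Category.id_comp]
        · intro l _ hl
          rw [← Category.assoc, P.ι_π_ne k l hl.symm, Limits.zero_comp]
        · simp
      rw [Power.direction, e₂, ← Category.assoc, ← Category.assoc, Limits.biprod.lift_snd, e₁]
    have key := shiftSumCounitHom_single P G ψ ((G.map q).hom z)
    rw [shiftSumMap, AddMonoidHom.sub_apply, comp_deviation, comp_deviation] at key
    simp only [e, Limits.comp_zero] at key
    -- At the base point `0`, the terms of the deviation are values of `G` at sums of at most `d`
    -- morphisms of rank one.
    have zero : deviation G Finset.univ (fun k => h (σ k)) 0 z = 0 := by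
      rw [deviation_apply]
      refine Finset.sum_eq_zero fun S _ => ?_
      rw [zero_add, map_sum_rankOne_eq_zero powers hG S
        (by simpa using S.card_le_univ.trans (by simpa using hd)) _ (fun k => hh _), smul_zero]
    rw [zero, sub_zero, Limits.biprod.lift_fst] at key
    exact ⟨_, key⟩
  have main (R : Finset (Fin m)) : (G.map (∑ k ∈ R, h k)).hom z ∈ I := by
    induction R using Finset.strongInduction with
    | H R ih =>
      by_cases hR : R.card ≤ d
      · rw [map_sum_rankOne_eq_zero powers hG R (hR.trans hd) _ hh]
        exact I.zero_mem
      · obtain ⟨T, hTR, hT⟩ := Finset.exists_subset_card_eq (not_le.1 hR).le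
        have mem := step (∑ k ∈ R \ T, h k) (T.orderEmbOfFin hT)
        have e := deviation_map (F := G) h (∑ k ∈ R \ T, h k) (T.orderEmbOfFin hT).toEmbedding
          Finset.univ
        rw [Finset.map_orderEmbOfFin_univ] at e
        have mem' : deviation G T h (∑ k ∈ R \ T, h k) z ∈ I := by rw [e]; exact mem
        rw [deviation_apply, ← Finset.sum_erase_add _ _ (Finset.mem_powerset_self T)] at mem'
        -- In the deviation in the directions `T` at `∑ k ∈ R \ T, h k`, all the terms but that of
        -- the full set are values of `G` at sums over proper subsets of `R`.
        have rest : ∑ S ∈ T.powerset.erase T, (-1 : ℤ) ^ S.card •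
            (G.map (∑ k ∈ R \ T, h k + ∑ k ∈ S, h k)).hom z ∈ I := by
          refine I.sum_mem fun S hS => I.zsmul_mem ?_ _
          have hST : S ⊂ T := Finset.mem_ssubsets.1 hS
          have disj : Disjoint (R \ T) S := Finset.sdiff_disjoint.mono_right hST.1
          rw [← Finset.sum_union disj]
          refine ih _ (Finset.ssubset_iff_subset_ne.2
            ⟨Finset.union_subset Finset.sdiff_subset (hST.1.trans hTR), fun hEq =>
              hST.2 fun k hk => ?_⟩)
          rcases Finset.mem_union.1 (hEq.symm ▸ hTR hk) with h | h
          · exact absurd hk (Finset.mem_sdiff.1 h).2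
          · exact h
        have last := (I.add_mem_cancel_left rest).1 mem'
        rw [← Finset.sum_union Finset.sdiff_disjoint, Finset.sdiff_union_of_subset hTR] at last
        rcases neg_one_pow_eq_or ℤ T.card with hs | hs
        · simpa [hs] using last
        · simpa [hs] using last
  have := main Finset.univ
  rw [hαβ, map_id_hom] at this
  exact this

/-- If `G` vanishes on the objects of rank at most `n`, then `shiftSum` of `G` at a sum of `d`
copies of `a` vanishes on those of rank at most `n - d`. -/
lemma shiftSum_eq_zero {G : C ⥤ AddCommGrpCat.{w}} {m n : ℕ} (h : m + d ≤ n)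
    (hG : ∀ X, RankLE a n X → ∀ x : G.obj X, x = 0) {W : C} (hW : RankLE a m W)
    (z : (P.obj ⟶ W) →₀ G.obj (W ⊞ P.obj)) : z = 0 :=
  Finsupp.ext fun _ => hG _ ((hW.biprod P.rankLE).mono h) _

end ShiftSum

/-! ### Vanishing of Ext groups -/

section ExtVanishing

universe u₁ v₁ t t'
open Abelian
variable {C : Type u₁} [Category.{v₁} C]

lemma hasExt_functor : HasExt.{max u₁ v₁ t} (C ⥤ AddCommGrpCat.{max u₁ v₁ t}) := by
  have := enoughInjectives_functor.{u₁, v₁, t} (C := C)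
  exact hasExt_of_enoughInjectives _

lemma eq_zero_of_pointwise {F G : C ⥤ AddCommGrpCat.{w}} (f : F ⟶ G)
    (h : ∀ X (x : F.obj X), (f.app X).hom x = 0) : f = 0 :=
  NatTrans.ext (funext fun X => AddCommGrpCat.hom_ext (AddMonoidHom.ext (h X)))

variable (c : C)

/-- The functor `F ↦ (U ↦ Map(Hom(U, c), F c))`: coinduction from the object `c`, after
restriction to `c`. -/
def coinduction : (C ⥤ AddCommGrpCat.{max u₁ v₁ t}) ⥤ (C ⥤ AddCommGrpCat.{max u₁ v₁ t}) where
  obj F :=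
    { obj := fun U => AddCommGrpCat.of ((U ⟶ c) → F.obj c)
      map := fun k => AddCommGrpCat.ofHom
        { toFun := fun s y => s (k ≫ y)
          map_zero' := rfl
          map_add' := fun _ _ => rfl }
      map_id := fun _ => AddCommGrpCat.hom_ext (AddMonoidHom.ext fun s => funext fun y =>
        congrArg s (Category.id_comp y))
      map_comp := fun k l => AddCommGrpCat.hom_ext (AddMonoidHom.ext fun s => funext fun y =>
        congrArg s (Category.assoc k l y)) }
  map τ :=
    { app := fun _ => AddCommGrpCat.ofHom
        { toFun := fun s y => (τ.app c).hom (s y)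
          map_zero' := funext fun _ => map_zero _
          map_add' := fun _ _ => funext fun _ => map_add _ _ _ } }

instance : (coinduction.{u₁, v₁, t} c).Additive where

lemma coinduction_exact : Limits.PreservesFiniteLimits (coinduction.{u₁, v₁, t} c) ∧
    Limits.PreservesFiniteColimits (coinduction.{u₁, v₁, t} c) := by
  refine ((Functor.exact_tfae (coinduction.{u₁, v₁, t} c)).out 0 3).1 fun S hS => ?_
  obtain ⟨h₁, h₂, h₃⟩ := ShortExact.pointwise hS c
  refine shortExact_of_pointwise (fun U s s' h => ?_) (fun U s h => ?_) (fun U s => ?_)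
  · exact funext fun y => h₁ (congrFun h y)
  · choose x hx using fun y => h₂ (s y) (congrFun h y)
    exact ⟨x, funext hx⟩
  · choose x hx using fun y => h₃ (s y)
    exact ⟨x, funext hx⟩

/-- The unit `F U → Map(Hom(U, c), F c)`. -/
def coinductionUnit : 𝟭 (C ⥤ AddCommGrpCat.{max u₁ v₁ t}) ⟶ coinduction.{u₁, v₁, t} c where
  app F :=
    { app := fun _ => AddCommGrpCat.ofHom
        { toFun := fun s y => (F.map y).hom s
          map_zero' := funext fun _ => map_zero _
          map_add' := fun _ _ => funext fun _ => map_add _ _ _ }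
      naturality := fun _ _ k => AddCommGrpCat.hom_ext (AddMonoidHom.ext fun s => funext fun y =>
        (map_comp_hom F k y s).symm) }
  naturality _ _ τ := NatTrans.ext (funext fun _ => AddCommGrpCat.hom_ext (AddMonoidHom.ext
    fun s => funext fun y => (naturality_hom τ y s).symm))

variable [HasExt.{t'} (C ⥤ AddCommGrpCat.{max u₁ v₁ t})]

/-- There are no extensions in degrees at most `j` of a functor `G` that vanishes on the objects of
rank at most `n` by a polynomial functor `F` of degree at most `d`, provided that `d (j + 1) ≤ n`.
Indeed a class in `Ext(G, F)` becomes zero on `shiftSum G`, because the natural transformation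
`shiftSumCounit` is zero at `F`; hence it comes from the kernel of `shiftSum G → G`, which vanishes
on the objects of rank at most `n - d`, and the degree has dropped by one. -/
theorem ext_eq_zero_of_deviationVanishes [Preadditive C] [Limits.HasBinaryBiproducts C] {a : C}
    (powers : ∀ r, Power a r) (hC : ∀ X : C, ∃ m, RankLE a m X)
    {F : C ⥤ AddCommGrpCat.{max u₁ v₁ t}} {d : ℕ} (hF : DeviationVanishes a F d) (j : ℕ) {n : ℕ}
    (hn : d * (j + 1) ≤ n) {G : C ⥤ AddCommGrpCat.{max u₁ v₁ t}}
    (hG : ∀ X, RankLE a n X → ∀ x : G.obj X, x = 0) (e : Ext G F j) : e = 0 := by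
  have := enoughInjectives_functor.{u₁, v₁, t} (C := C)
  obtain ⟨h₁, h₂⟩ := shiftSumFunctor_exact.{u₁, v₁, t} (powers d).obj
  have hd : d ≤ n := le_trans (Nat.le_mul_of_pos_right d (Nat.succ_pos j)) hn
  let g := (shiftSumCounit.{u₁, v₁, t} (powers d)).app G
  have hS := shortExact_kernel_of_surjective g
    (shiftSumCounitHom_surjective (powers d) powers hC hd hG)
  have he : (Ext.mk₀ g).comp e (zero_add j) = 0 :=
    mk₀_comp_eq_zero_of_app_eq_zero (shiftSumFunctor.{u₁, v₁, t} (powers d).obj)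
      (shiftSumCounit.{u₁, v₁, t} (powers d))
      (shiftSumCounit_app_eq_zero.{u₁, v₁, t} (powers d) hF hC) e
  induction j generalizing n G with
  | zero =>
    have : Epi g := hS.epi_g
    obtain ⟨f, rfl⟩ := (Ext.mk₀_bijective G F).2 e
    rw [Ext.mk₀_comp_mk₀, Ext.mk₀_eq_zero_iff] at he
    rw [(cancel_epi g).1 (he.trans Limits.comp_zero.symm), Ext.mk₀_zero]
  | succ j ih =>
    obtain ⟨e', rfl⟩ := Ext.contravariant_sequence_exact₃ hS F e he (add_comm 1 j)
    have hn' : d * (j + 1) ≤ n - d := by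
      rw [Nat.le_sub_iff_add_le hd]
      linarith
    have hK : ∀ X, RankLE a (n - d) X → ∀ x : (Limits.kernel g).obj X, x = 0 := by
      intro X hX x
      refine (ShortExact.pointwise hS X).1 (Eq.trans ?_ (map_zero _).symm)
      exact shiftSum_eq_zero (powers d) (Nat.sub_add_cancel hd).le hG hX _
    have hd' : d ≤ n - d := le_trans (Nat.le_mul_of_pos_right d (Nat.succ_pos j)) hn'
    rw [ih hn' hK e' hd' (shortExact_kernel_of_surjective _
        (shiftSumCounitHom_surjective (powers d) powers hC hd' hK))
      (mk₀_comp_eq_zero_of_app_eq_zero (shiftSumFunctor.{u₁, v₁, t} (powers d).obj)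
        (shiftSumCounit.{u₁, v₁, t} (powers d))
        (shiftSumCounit_app_eq_zero.{u₁, v₁, t} (powers d) hF hC) e'), Ext.comp_zero]

/-- `F` has no extensions in degrees at most `i` by functors that vanish on `c`. -/
def ExtVanishes (F : C ⥤ AddCommGrpCat.{max u₁ v₁ t}) (i : ℕ) : Prop :=
  ∀ (G : C ⥤ AddCommGrpCat.{max u₁ v₁ t}), (∀ x : G.obj c, x = 0) →
    ∀ j ≤ i, ∀ e : Ext G F j, e = 0

variable {c}

/-- If the unit of coinduction splits at `F`, then `F` has no extensions by functors that vanish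
on `c`, since coinduction is exact and kills these functors. -/
lemma ExtVanishes.of_retract {F : C ⥤ AddCommGrpCat.{max u₁ v₁ t}}
    (r : (coinduction.{u₁, v₁, t} c).obj F ⟶ F)
    (hr : (coinductionUnit.{u₁, v₁, t} c).app F ≫ r = 𝟙 F) (i : ℕ) :
    ExtVanishes.{u₁, v₁, t, t'} c F i := by
  intro G hG j _ e
  have := enoughInjectives_functor.{u₁, v₁, t} (C := C)
  obtain ⟨h₁, h₂⟩ := coinduction_exact.{u₁, v₁, t} c
  refine ext_eq_zero_of_app_eq_zero (coinduction.{u₁, v₁, t} c)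
    (coinductionUnit.{u₁, v₁, t} c) ?_ r hr e
  exact eq_zero_of_pointwise _ fun U s => funext fun y => hG _

/-- In degree zero: `F` has no nonzero subfunctor that vanishes on `c`, so that elements of `F U`
are detected by the morphisms to `c`. -/
lemma ExtVanishes.eq_zero {F : C ⥤ AddCommGrpCat.{max u₁ v₁ t}} {i : ℕ}
    (hF : ExtVanishes.{u₁, v₁, t, t'} c F i) {U : C} (s : F.obj U)
    (hs : ∀ y : U ⟶ c, (F.map y).hom s = 0) : s = 0 := by
  let η := (coinductionUnit.{u₁, v₁, t} c).app F
  have hι : Limits.kernel.ι η = 0 := by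
    refine (Ext.mk₀_eq_zero_iff _).1 (hF _ (fun x => ?_) 0 (Nat.zero_le i) _)
    have h : (η.app c).hom (((Limits.kernel.ι η).app c).hom x) = 0 :=
      ConcreteCategory.congr_hom (NatTrans.congr_app (Limits.kernel.condition η) c) x
    have h' := congrFun h (𝟙 c)
    change (F.map (𝟙 c)).hom (((Limits.kernel.ι η).app c).hom x) = 0 at h'
    rw [map_id_hom] at h'
    exact (AddCommGrpCat.mono_iff_injective ((Limits.kernel.ι η).app c)).1 inferInstance
      (h'.trans (map_zero _).symm)
  have : Mono η := Preadditive.mono_of_kernel_zero hι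
  have : Function.Injective (η.app U).hom := (AddCommGrpCat.mono_iff_injective _).1 inferInstance
  exact this (Eq.trans (funext hs) (map_zero _).symm)

/-- Dimension shifting for `ExtVanishes`. -/
lemma ExtVanishes.cokernel {S : ShortComplex (C ⥤ AddCommGrpCat.{max u₁ v₁ t})}
    (hS : S.ShortExact) {i : ℕ} (h₁ : ExtVanishes.{u₁, v₁, t, t'} c S.X₁ (i + 1))
    (h₂ : ExtVanishes.{u₁, v₁, t, t'} c S.X₂ i) : ExtVanishes.{u₁, v₁, t, t'} c S.X₃ i := by
  intro G hG j hj e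
  obtain ⟨e', rfl⟩ := Ext.covariant_sequence_exact₃ G hS e rfl
    (h₁ G hG (j + 1) (Nat.succ_le_succ hj) _)
  rw [h₂ G hG j hj e', Ext.zero_comp]

end ExtVanishing

/-! ### Cochains on strings of morphisms -/

section Cochains

variable {C : Type u} [Category.{v} C]

/-- The string `x ∘ θ`: the morphisms of the string `x` are composed as prescribed by `θ`. -/
def pull {m n : ℕ} (θ : Fin (m + 1) →o Fin (n + 1)) (x : ComposableArrows C n) :
    ComposableArrows C m :=
  θ.monotone.functor ⋙ x

/-- The `k`-th coface map, the injection whose image omits `k`. -/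
def coface {m : ℕ} (k : Fin (m + 2)) : Fin (m + 1) →o Fin (m + 2) :=
  (Fin.succAboveOrderEmb k).toOrderHom

lemma map_homOfLE_congr {n : ℕ} (x : ComposableArrows C n) {a a' b b' : Fin (n + 1)} (ha : a = a')
    (hb : b = b') (h : a ≤ b) (h' : a' ≤ b') :
    x.map (homOfLE h) = eqToHom (by rw [ha]) ≫ x.map (homOfLE h') ≫ eqToHom (by rw [hb]) := by
  subst ha hb
  simp

/-- The `m`-cochains of `C` with coefficients in `B`. -/
abbrev Cochain (B : Cᵒᵖ × C ⥤ AddCommGrpCat.{w}) (m : ℕ) : Type _ :=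
  ∀ x : ComposableArrows C m, B.obj (op (x.obj 0), x.obj (Fin.last m))

variable {B : Cᵒᵖ × C ⥤ AddCommGrpCat.{w}}

/-- The value of a cochain at the string `x`, transported to `B(U, V)` along morphisms
`U ⟶ x_0` and `x_m ⟶ V`. -/
def evalAt {m : ℕ} (f : Cochain B m) (x : ComposableArrows C m) {U V : C} (α : U ⟶ x.obj 0)
    (β : x.obj (Fin.last m) ⟶ V) : B.obj (op U, V) :=
  (B.map (X := (op (x.obj 0), x.obj (Fin.last m))) (Y := (op U, V)) (α.op, β)).hom (f x)

lemma evalAt_congr {m : ℕ} (f : Cochain B m) {x x' : ComposableArrows C m} (h : x = x') {U V : C}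
    {α : U ⟶ x.obj 0} {β : x.obj (Fin.last m) ⟶ V} {α' : U ⟶ x'.obj 0}
    {β' : x'.obj (Fin.last m) ⟶ V} (hα : α ≫ eqToHom (by rw [h]) = α')
    (hβ : eqToHom (by rw [h]) ≫ β = β') : evalAt f x α β = evalAt f x' α' β' := by
  subst h
  simp only [eqToHom_refl, Category.comp_id, Category.id_comp] at hα hβ
  rw [hα, hβ]

lemma map_evalAt {m : ℕ} (f : Cochain B m) (x : ComposableArrows C m) {U V U' V' : C}
    (α : U ⟶ x.obj 0) (β : x.obj (Fin.last m) ⟶ V) (α' : U' ⟶ U) (β' : V ⟶ V') :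
    (B.map (X := (op U, V)) (Y := (op U', V')) (α'.op, β')).hom (evalAt f x α β) =
      evalAt f x (α' ≫ α) (β ≫ β') :=
  (map_comp_hom B (X := (op (x.obj 0), x.obj (Fin.last m))) (Y := (op U, V)) (Z := (op U', V'))
    (α.op, β) (α'.op, β') (f x)).symm

lemma evalAt_id {m : ℕ} (f : Cochain B m) (x : ComposableArrows C m) :
    evalAt f x (𝟙 _) (𝟙 _) = f x :=
  map_id_hom B (f x)

variable (B) in
/-- The differential of the complex of cochains. -/
def cochainD (m : ℕ) : Cochain B m →+ Cochain B (m + 1) :=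
  ((cochainComplex B).d m (m + 1)).hom

lemma cochainD_apply (m : ℕ) (f : Cochain B m) (x : ComposableArrows C (m + 1)) :
    cochainD B m f x = ∑ k : Fin (m + 2), (-1 : ℤ) ^ (k : ℕ) •
      evalAt f (pull (coface k) x) (x.map (homOfLE (Fin.zero_le _)))
        (x.map (homOfLE (Fin.le_last _))) := by
  have h := congrFun (cochainComplex_d_apply B m f) x
  refine h.trans ?_
  exact map_signed_sum (Pi.evalAddMonoidHom
    (fun x : (nerve C).obj (op ⦋m + 1⦌) => B.obj (op (x.obj 0), x.obj (Fin.last _))) x) _ _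

lemma cochainD_cochainD (m : ℕ) (f : Cochain B m) : cochainD B (m + 1) (cochainD B m f) = 0 :=
  ConcreteCategory.congr_hom ((cochainComplex B).d_comp_d m (m + 1) (m + 2)) f

universe w'

/-- The map on cochains induced by additive maps on the coefficients. -/
def cochainMap {B' : Cᵒᵖ × C ⥤ AddCommGrpCat.{w'}} (τ : ∀ X, B.obj X →+ B'.obj X) (m : ℕ) :
    Cochain B m →+ Cochain B' m where
  toFun f x := τ _ (f x)
  map_zero' := funext fun _ => map_zero _
  map_add' _ _ := funext fun _ => map_add _ _ _

lemma cochainMap_d {B' : Cᵒᵖ × C ⥤ AddCommGrpCat.{w'}} (τ : ∀ X, B.obj X →+ B'.obj X)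
    (hτ : ∀ {X Y} (k : X ⟶ Y) (b : B.obj X), τ Y ((B.map k).hom b) = (B'.map k).hom (τ X b))
    (m : ℕ) (f : Cochain B m) :
    cochainMap τ (m + 1) (cochainD B m f) = cochainD B' m (cochainMap τ m f) := by
  funext x
  refine (congrArg (τ _) (cochainD_apply m f x)).trans ?_
  rw [cochainD_apply, map_sum]
  refine Finset.sum_congr rfl fun k _ => ?_
  rw [map_zsmul]
  exact congrArg _ (hτ _ _)

/-! ### Coinduced bifunctors -/

section Coinduced

variable {ι : Type u} (e : ι → C) (B : Cᵒᵖ × C ⥤ AddCommGrpCat.{max u v w})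

/-- The bifunctor `(U, V) ↦ ∏_i Map(Hom(e_i, U), B(e_i, V))`. -/
def coinduced : Cᵒᵖ × C ⥤ AddCommGrpCat.{max u v w} where
  obj X := AddCommGrpCat.of (∀ i, (e i ⟶ X.1.unop) → B.obj (op (e i), X.2))
  map {X Y} k := AddCommGrpCat.ofHom
    { toFun := fun s i y => (B.map (X := (op (e i), X.2)) (Y := (op (e i), Y.2))
        (𝟙 _, k.2)).hom (s i (y ≫ k.1.unop))
      map_zero' := funext fun _ => funext fun _ => map_zero _
      map_add' := fun _ _ => funext fun _ => funext fun _ => map_add _ _ _ }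
  map_id X := AddCommGrpCat.hom_ext (AddMonoidHom.ext fun s => funext fun i => funext fun y =>
    (map_id_hom B (X := (op (e i), X.2)) _).trans (congrArg (s i) (Category.comp_id y)))
  map_comp {X Y Z} k l := AddCommGrpCat.hom_ext (AddMonoidHom.ext fun s => funext fun i =>
    funext fun y => by
      have h := map_comp_hom B (X := (op (e i), X.2)) (Y := (op (e i), Y.2)) (Z := (op (e i), Z.2))
        (𝟙 _, k.2) (𝟙 _, l.2) (s i ((y ≫ l.1.unop) ≫ k.1.unop))
      refine Eq.trans ?_ h
      let k' : ((op (e i), X.2) : Cᵒᵖ × C) ⟶ (op (e i), Y.2) := (𝟙 (op (e i)), k.2)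
      let l' : ((op (e i), Y.2) : Cᵒᵖ × C) ⟶ (op (e i), Z.2) := (𝟙 (op (e i)), l.2)
      have h' : ((𝟙 (op (e i)), (k ≫ l).2) : ((op (e i), X.2) : Cᵒᵖ × C) ⟶ (op (e i), Z.2)) =
          k' ≫ l' :=
        Prod.ext (Category.comp_id _).symm rfl
      exact congrArg₂ (fun (g : ((op (e i), X.2) : Cᵒᵖ × C) ⟶ (op (e i), Z.2)) z =>
        (B.map g).hom (s i z)) h' (Category.assoc _ _ _).symm)

/-- The morphism `B(U, V) → ∏_i Map(Hom(e_i, U), B(e_i, V))`, given by the action of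
`Hom(e_i, U)` on the first variable. -/
def coinducedUnit : B ⟶ coinduced.{u, v, w} e B where
  app X := AddCommGrpCat.ofHom
    { toFun := fun s i y => (B.map (X := X) (Y := (op (e i), X.2)) (y.op, 𝟙 _)).hom s
      map_zero' := funext fun _ => funext fun _ => map_zero _
      map_add' := fun _ _ => funext fun _ => funext fun _ => map_add _ _ _ }
  naturality X Y k := AddCommGrpCat.hom_ext (AddMonoidHom.ext fun s => funext fun i =>
    funext fun y => by
      have h := map_comp_hom B (X := X) (Y := Y) (Z := (op (e i), Y.2)) k (y.op, 𝟙 _) s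
      have h' := map_comp_hom B (X := X) (Y := (op (e i), X.2)) (Z := (op (e i), Y.2))
        ((y ≫ k.1.unop).op, 𝟙 _) (𝟙 _, k.2) s
      refine h.symm.trans (Eq.trans ?_ h')
      refine congrArg (fun g => (B.map g).hom s) (Prod.ext ?_ ?_)
      · exact (Category.comp_id _).symm
      · exact (Category.comp_id _).trans (Category.id_comp _).symm)

variable {e B}

/-- The evaluation of the coinduced bifunctor at `y : e_i ⟶ U`. -/
def coinducedEval {X : Cᵒᵖ × C} (i : ι) (y : e i ⟶ X.1.unop) :
    (coinduced.{u, v, w} e B).obj X →+ B.obj (op (e i), X.2) where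
  toFun s := s i y
  map_zero' := rfl
  map_add' _ _ := rfl

lemma precomp_map_zero_succ {m : ℕ} (x : ComposableArrows C m) {X : C} (y : X ⟶ x.left)
    (j : Fin (m + 1)) : (x.precomp y).map (homOfLE (Fin.zero_le j.succ)) =
      y ≫ x.map (homOfLE (Fin.zero_le j)) := by
  have h : (0 : Fin (m + 2)) ≤ (0 : Fin (m + 1)).succ := Fin.zero_le _
  have h' : (0 : Fin (m + 1)).succ ≤ j.succ := Fin.succ_le_succ_iff.2 (Fin.zero_le j)
  have := (x.precomp y).map_comp (homOfLE h) (homOfLE h')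
  exact this

/-- The faces with positive index of the string `y, x` are the faces of `x`, with `y` put in front;
the first morphism of the face of index `1` is the composite of `y` and the first one of `x`. -/
lemma pull_coface_succ_precomp {m : ℕ} (l : Fin (m + 2)) (x : ComposableArrows C (m + 1)) {X : C}
    (y : X ⟶ x.left) : pull (coface l.succ) (x.precomp y) =
      (pull (coface l) x).precomp (y ≫ x.map (homOfLE (Fin.zero_le _))) := by
  refine ComposableArrows.ext_succ ?_ ?_ ?_
  · exact congrArg (x.precomp y).obj (Fin.succ_succAbove_zero l)
  · have h : (coface l.succ).comp ⟨Fin.succ, Fin.strictMono_succ.monotone⟩ =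
        (⟨Fin.succ, Fin.strictMono_succ.monotone⟩ : Fin (m + 2) →o Fin (m + 3)).comp (coface l) :=
      OrderHom.ext _ _ (funext fun k => Fin.succ_succAbove_succ l k)
    exact congrArg (fun θ => pull θ (x.precomp y)) h
  · refine (map_homOfLE_congr (x.precomp y) (Fin.succ_succAbove_zero l)
      (Fin.succ_succAbove_succ l 0) ((coface l.succ).monotone (Fin.zero_le _))
      (Fin.zero_le (l.succAbove 0).succ)).trans ?_
    rw [precomp_map_zero_succ]
    rfl

/-- The term of index `0` of a vanishing alternating sum is equal, after application of `φ`, to the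
alternating sum of the other terms, reindexed from `0`. -/
lemma map_signed_sum_of_eq_zero {G G' H : Type*} [AddCommGroup G] [AddCommGroup G']
    [AddCommGroup H] (φ : G →+ H) (φ' : G' →+ H) {n : ℕ} (a : Fin (n + 1) → G) (b : Fin n → G')
    {c : H} (ha : ∑ k : Fin (n + 1), (-1 : ℤ) ^ (k : ℕ) • a k = 0) (h₀ : φ (a 0) = c)
    (hs : ∀ l, φ (a (Fin.succ l)) = φ' (b l)) :
    φ' (∑ l : Fin n, (-1 : ℤ) ^ (l : ℕ) • b l) = c := by
  rw [Fin.sum_univ_succ] at ha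
  have h := congrArg φ ha
  simp only [map_add, map_neg, map_sum, map_zsmul, h₀, hs, map_zero, Fin.val_zero, pow_zero,
    one_smul, Fin.val_succ, pow_succ, mul_neg, mul_one, neg_smul, Finset.sum_neg_distrib] at h
  simp only [map_sum, map_zsmul]
  exact (sub_eq_zero.1 ((sub_eq_add_neg _ _).trans h)).symm

/-- The contracting homotopy of the cochains with coinduced coefficients: the variable
`y : e_i ⟶ x_0` of the value is put in front of the string `x`. -/
def contraction (m : ℕ) (f : Cochain (coinduced.{u, v, w} e B) (m + 1)) :
    Cochain (coinduced.{u, v, w} e B) m :=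
  fun x i y => f (x.precomp y) i (𝟙 (e i))

/-- The coinduced bifunctors have no cohomology in positive degrees. -/
lemma cochainD_contraction (m : ℕ) (f : Cochain (coinduced.{u, v, w} e B) (m + 1))
    (hf : cochainD _ (m + 1) f = 0) : cochainD _ m (contraction m f) = f := by
  funext x i y
  have h := (cochainD_apply (m + 1) f (x.precomp y)).symm.trans (congrFun hf (x.precomp y))
  -- The cocycle condition on the string `y, x` has one term that recovers `f x`, and its other
  -- terms form the coboundary of the contraction.
  have h₀ : evalAt f (pull (coface 0) (x.precomp y))
      ((x.precomp y).map (homOfLE (Fin.zero_le ((coface 0) 0))))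
      ((x.precomp y).map (homOfLE (Fin.le_last ((coface 0) (Fin.last _))))) i (𝟙 (e i)) =
      f x i y := by
    have hα : (x.precomp y).map (homOfLE (Fin.zero_le ((coface 0) 0))) = y :=
      (precomp_map_zero_succ x y 0).trans (by
        refine (congrArg (fun z => y ≫ z) (x.map_id 0)).trans (Category.comp_id _))
    have hβ : (x.precomp y).map (homOfLE (Fin.le_last ((coface 0) (Fin.last _)))) =
      𝟙 (x.obj (Fin.last (m + 1))) := (x.precomp y).map_id (Fin.last (m + 2))
    refine (congrArg₂ (fun α β => evalAt f x α β i (𝟙 (e i))) hα hβ).trans ?_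
    refine (map_id_hom B _).trans ?_
    exact congrArg (f x i) (Category.id_comp y)
  have hs (l : Fin (m + 2)) : evalAt f (pull (coface l.succ) (x.precomp y))
      ((x.precomp y).map (homOfLE (Fin.zero_le ((coface l.succ) 0))))
      ((x.precomp y).map (homOfLE (Fin.le_last ((coface l.succ) (Fin.last _))))) i (𝟙 (e i)) =
      evalAt (contraction m f) (pull (coface l) x) (x.map (homOfLE (Fin.zero_le _)))
        (x.map (homOfLE (Fin.le_last _))) i y := by
    have h0 : coface l.succ 0 = 0 := Fin.succ_succAbove_zero l
    have h1 : coface l.succ (Fin.last (m + 1)) = (coface l (Fin.last m)).succ :=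
      Fin.succ_succAbove_succ l (Fin.last m)
    have key := evalAt_congr f (pull_coface_succ_precomp l x y)
      (α := (x.precomp y).map (homOfLE (Fin.zero_le ((coface l.succ) 0))))
      (β := (x.precomp y).map (homOfLE (Fin.le_last ((coface l.succ) (Fin.last _)))))
      (α' := 𝟙 (e i)) (β' := x.map (homOfLE (Fin.le_last ((coface l) (Fin.last _))))) (by
        rw [map_homOfLE_congr (x.precomp y) rfl h0 _ le_rfl]
        have : (x.precomp y).map (homOfLE (le_refl 0)) = 𝟙 _ := (x.precomp y).map_id _
        rw [this]
        simp only [eqToHom_refl, Category.id_comp]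
        exact eqToHom_trans _ _) (by
        refine (congrArg (fun z => eqToHom _ ≫ z) (map_homOfLE_congr (x.precomp y) h1 rfl _
          (Fin.le_last _))).trans ?_
        refine (eqToHom_trans_assoc _ _ _).trans ?_
        exact (Category.id_comp _).trans (Category.comp_id _))
    refine (congrArg (fun z => z i (𝟙 (e i))) key).trans ?_
    exact congrArg (fun z => (B.map _).hom (f _ i z)) (Category.comp_id _)
  refine (congrArg (coinducedEval (X := (op (x.obj 0), x.obj (Fin.last (m + 1)))) i y)
    (cochainD_apply m (contraction m f) x)).trans ?_
  exact map_signed_sum_of_eq_zero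
    (coinducedEval (X := (op (e i), x.obj (Fin.last (m + 1)))) i (𝟙 (e i)))
    (coinducedEval (X := (op (x.obj 0), x.obj (Fin.last (m + 1)))) i y) _ _ h h₀ hs

end Coinduced

end Cochains

/-! ### Cocycles that vanish on the endomorphisms of an object -/

section Relative

universe t'

variable {C : Type u} [Category.{v} C] (e : C)

/-- The cochain `f` vanishes on the strings of endomorphisms of `e`. -/
def VanishesAt {B : Cᵒᵖ × C ⥤ AddCommGrpCat.{w}} {m : ℕ} (f : Cochain B m) : Prop :=
  ∀ x : ComposableArrows C m, (∀ k, x.obj k = e) → f x = 0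

/-- The cochain `f` is the coboundary of a cochain that vanishes on the strings of endomorphisms
of `e`; in degree zero this means `f = 0`. -/
def IsRelativeCoboundary {B : Cᵒᵖ × C ⥤ AddCommGrpCat.{w}} (m : ℕ) : Cochain B m → Prop :=
  match m with
  | 0 => fun f => f = 0
  | m + 1 => fun f => ∃ g : Cochain B m, VanishesAt e g ∧ cochainD B m g = f

variable {e}

lemma VanishesAt.cochainD {B : Cᵒᵖ × C ⥤ AddCommGrpCat.{w}} {m : ℕ} {f : Cochain B m}
    (hf : VanishesAt e f) : VanishesAt e (cochainD B m f) := by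
  intro x hx
  rw [cochainD_apply]
  refine Finset.sum_eq_zero fun k _ => ?_
  have h : f (pull (coface k) x) = 0 := hf _ fun l => hx _
  exact (congrArg _ ((congrArg _ h).trans (map_zero _))).trans (smul_zero _)

/-- A `0`-cocycle is an element of the end of `B`: a family that is compatible with morphisms. -/
lemma map_eq_map_of_cocycle {B : Cᵒᵖ × C ⥤ AddCommGrpCat.{w}} (f : Cochain B 0)
    (hf : cochainD B 0 f = 0) {X Y : C} (y : X ⟶ Y) :
    (B.map (X := (op X, X)) (Y := (op X, Y)) (𝟙 _, y)).hom (f (ComposableArrows.mk₀ X)) =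
      (B.map (X := (op Y, Y)) (Y := (op X, Y)) (y.op, 𝟙 _)).hom (f (ComposableArrows.mk₀ Y)) := by
  let x := ComposableArrows.mk₁ y
  have h := (cochainD_apply 0 f x).symm.trans (congrFun hf x)
  rw [Fin.sum_univ_two] at h
  have h₀ : evalAt f (pull (coface 0) x) (x.map (homOfLE (Fin.zero_le ((coface 0) 0))))
      (x.map (homOfLE (Fin.le_last ((coface 0) (Fin.last 0))))) =
      evalAt f (ComposableArrows.mk₀ Y) y (𝟙 Y) :=
    evalAt_congr f (x := pull (coface 0) x) (x' := ComposableArrows.mk₀ Y)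
      (ComposableArrows.ext₀ rfl) (Category.comp_id _) (Category.id_comp _)
  have h₁ : evalAt f (pull (coface 1) x) (x.map (homOfLE (Fin.zero_le ((coface 1) 0))))
      (x.map (homOfLE (Fin.le_last ((coface 1) (Fin.last 0))))) =
      evalAt f (ComposableArrows.mk₀ X) (𝟙 X) y :=
    evalAt_congr f (x := pull (coface 1) x) (x' := ComposableArrows.mk₀ X)
      (ComposableArrows.ext₀ rfl) (Category.comp_id _) (Category.id_comp _)
  have h' : evalAt f (ComposableArrows.mk₀ Y) y (𝟙 Y) -
      evalAt f (ComposableArrows.mk₀ X) (𝟙 X) y = 0 := by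
    rw [← h₀, ← h₁]
    refine Eq.trans ?_ h
    simp only [Fin.val_zero, pow_zero, one_smul, Fin.val_one, pow_one, neg_smul]
    exact sub_eq_add_neg _ _
  exact (sub_eq_zero.1 h').symm

lemma cochainMap_app_d {B B' : Cᵒᵖ × C ⥤ AddCommGrpCat.{w}} (τ : B ⟶ B') {m : ℕ}
    (f : Cochain B m) : cochainMap (fun X => (τ.app X).hom) (m + 1) (cochainD B m f) =
      cochainD B' m (cochainMap (fun X => (τ.app X).hom) m f) :=
  cochainMap_d _ (fun k b => naturality_hom τ k b) m f

section Coinduced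

variable (e) (B : Cᵒᵖ × C ⥤ AddCommGrpCat.{max u v w})

/-- Coinduction from the object `e` in the first variable. -/
abbrev coinducedAt : Cᵒᵖ × C ⥤ AddCommGrpCat.{max u v w} :=
  coinduced.{u, v, w} (fun _ : PUnit.{u + 1} => e) B

/-- The unit of coinduction from the object `e`. -/
abbrev coinducedAtUnit : B ⟶ coinducedAt.{u, v, w} e B :=
  coinducedUnit.{u, v, w} (fun _ : PUnit.{u + 1} => e) B

variable [HasExt.{t'} (Cᵒᵖ ⥤ AddCommGrpCat.{max u v w})]

/-- The unit of coinduction from `e` splits at the coinduced bifunctors. -/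
lemma extVanishes_coinducedAt (V : C) (i : ℕ) :
    ExtVanishes.{u, v, w, t'} (op e) (Prod.sectL Cᵒᵖ V ⋙ coinducedAt.{u, v, w} e B) i := by
  refine ExtVanishes.of_retract.{u, v, w, t'}
    (F := Prod.sectL Cᵒᵖ V ⋙ coinducedAt.{u, v, w} e B)
    { app := fun U => AddCommGrpCat.ofHom
        { toFun := fun t i y => coinducedEval (e := fun _ : PUnit.{u + 1} => e)
            (X := (op e, V)) i (𝟙 e) (t (show U ⟶ op e from Quiver.Hom.op y))
          map_zero' := funext fun _ => funext fun _ => map_zero _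
          map_add' := fun _ _ => funext fun _ => funext fun _ => map_add _ _ _ }
      naturality := ?_ } ?_ i
  · intro U U' k
    refine AddCommGrpCat.hom_ext (AddMonoidHom.ext fun t => funext fun i => funext fun y => ?_)
    exact (map_id_hom B (X := (op e, V)) _).symm
  · refine NatTrans.ext (funext fun U => AddCommGrpCat.hom_ext (AddMonoidHom.ext fun s =>
      funext fun i => funext fun y => ?_))
    refine (map_id_hom B (X := (op e, V)) _).trans ?_
    exact congrArg (s i) (Category.id_comp _)

variable {e B}

/-- The degree zero part of the vanishing assumption says that `B(U, V)` embeds in the coinduced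
bifunctor. -/
lemma coinducedAtUnit_injective {i : ℕ}
    (hB : ∀ V, ExtVanishes.{u, v, w, t'} (op e) (Prod.sectL Cᵒᵖ V ⋙ B) i) (X : Cᵒᵖ × C) :
    Function.Injective ((coinducedAtUnit.{u, v, w} e B).app X).hom := by
  rw [injective_iff_map_eq_zero]
  intro s hs
  refine (hB X.2).eq_zero (U := X.1) s fun y => ?_
  exact congrFun (congrFun hs PUnit.unit) y.unop

/-- If the functors `B(-, V)` have no extensions in degrees at most `j` by functors that vanish
on `e`, then there is no cohomology of `C` relative to the endomorphisms of `e` in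
degree `j`. The proof is by dimension shifting along the embedding of `B` in the bifunctor coinduced
from `e`: a cocycle that vanishes at `e` becomes the coboundary of its contraction `g`, which
vanishes at `e` too, and the class of `g` in the cokernel is a cocycle of degree one less. -/
theorem isRelativeCoboundary_of_extVanishes (j : ℕ) : ∀ {B : Cᵒᵖ × C ⥤ AddCommGrpCat.{max u v w}},
    (∀ V, ExtVanishes.{u, v, w, t'} (op e) (Prod.sectL Cᵒᵖ V ⋙ B) j) → ∀ (f : Cochain B j),
    cochainD B j f = 0 → VanishesAt e f → IsRelativeCoboundary e j f := by
  induction j with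
  | zero =>
    intro B hB f hf hfe
    refine funext fun x => coinducedAtUnit_injective hB _ (Eq.trans ?_ (map_zero _).symm)
    obtain ⟨X, rfl⟩ := ComposableArrows.mk₀_surjective x
    refine funext fun _ => funext fun (y : e ⟶ X) => ?_
    refine (map_eq_map_of_cocycle f hf y).symm.trans ?_
    exact (congrArg _ (hfe (ComposableArrows.mk₀ e) fun _ => rfl)).trans (map_zero _)
  | succ j ih =>
    intro B hB f hf hfe
    let η := coinducedAtUnit.{u, v, w} e B
    have hη := coinducedAtUnit_injective hB
    have hS := shortExact_cokernel_of_injective η hη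
    let π := Limits.cokernel.π η
    have hπη (X) (b) : (π.app X).hom ((η.app X).hom b) = 0 :=
      ConcreteCategory.congr_hom (NatTrans.congr_app (Limits.cokernel.condition η) X) b
    have hB' (V : C) : ExtVanishes.{u, v, w, t'} (op e)
        (Prod.sectL Cᵒᵖ V ⋙ Limits.cokernel η) j := by
      refine ExtVanishes.cokernel.{u, v, w, t'} (S := ShortComplex.mk
        (Functor.whiskerLeft (Prod.sectL Cᵒᵖ V) η) (Functor.whiskerLeft (Prod.sectL Cᵒᵖ V) π) ?_)
        ?_ (hB V) (extVanishes_coinducedAt.{u, v, w, t'} e B V j)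
      · refine NatTrans.ext (funext fun U => AddCommGrpCat.hom_ext (AddMonoidHom.ext fun b => ?_))
        exact hπη _ b
      · exact shortExact_of_pointwise (fun U => hη _) (fun U => (ShortExact.pointwise hS _).2.1)
          (fun U => (ShortExact.pointwise hS _).2.2)
    let ηc (m : ℕ) := cochainMap (fun X => (η.app X).hom) m
    let πc (m : ℕ) := cochainMap (fun X => (π.app X).hom) m
    have hπηc (m : ℕ) (f) : πc m (ηc m f) = 0 := funext fun x => hπη _ _
    have hηc (m : ℕ) : Function.Injective (ηc m) := fun f g h =>
      funext fun x => hη _ (congrFun h x)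
    -- With coinduced coefficients, `f` is the coboundary of a cochain that vanishes at `e`.
    let g := contraction j (ηc (j + 1) f)
    have hg : cochainD _ j g = ηc (j + 1) f := cochainD_contraction j _
      ((cochainMap_app_d η f).symm.trans (by rw [hf, map_zero]))
    have hge : VanishesAt e g := by
      intro x hx
      refine funext fun _ => funext fun (y : e ⟶ x.obj 0) => ?_
      have h0 : f (x.precomp y) = 0 := hfe _ fun k => by
        induction k using Fin.cases with
        | zero => rfl
        | succ k => exact hx k
      exact (congrArg (fun z => ((η.app _).hom z) PUnit.unit (𝟙 e)) h0).trans
        (congrFun (congrFun (map_zero (η.app _).hom) _) _)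
    -- The image of `g` in the cokernel is a relative coboundary; a lift of it is subtracted from
    -- `g`, which leaves a cochain with values in `B`.
    have key : ∃ h : Cochain (coinducedAt.{u, v, w} e B) j, VanishesAt e h ∧
        cochainD _ j h = 0 ∧ πc j h = πc j g := by
      have hd : cochainD _ j (πc j g) = 0 := by
        rw [← cochainMap_app_d π g, hg]
        exact hπηc _ _
      have hv : VanishesAt e (πc j g) := fun x hx =>
        (congrArg (π.app _).hom (hge x hx)).trans (map_zero _)
      have h := ih hB' (πc j g) hd hv
      cases j with
      | zero => exact ⟨0, fun _ _ => rfl, map_zero _, (map_zero _).trans (Eq.symm h)⟩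
      | succ j =>
        obtain ⟨k, hk, hk'⟩ := h
        -- The lift to the coinduced bifunctor is chosen to be zero on the endomorphisms of `e`.
        have hl (x : ComposableArrows C j) : ∃ b, (π.app (op (x.obj 0), x.obj (Fin.last _))).hom b =
            k x ∧ ((∀ l, x.obj l = e) → b = 0) := by
          by_cases hx : ∀ l, x.obj l = e
          · exact ⟨0, (map_zero _).trans (hk x hx).symm, fun _ => rfl⟩
          · obtain ⟨b, hb⟩ := (ShortExact.pointwise hS (op (x.obj 0), x.obj (Fin.last _))).2.2 (k x)
            exact ⟨b, hb, fun h => (hx h).elim⟩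
        choose l hl hl' using hl
        refine ⟨cochainD _ j l, VanishesAt.cochainD hl', cochainD_cochainD _ _, ?_⟩
        rw [← hk']
        refine (cochainMap_app_d π l).trans ?_
        exact congrArg _ (funext hl)
    obtain ⟨h, hhe, hhd, hh⟩ := key
    have hl (x : ComposableArrows C j) : ∃ b, (η.app (op (x.obj 0), x.obj (Fin.last _))).hom b =
        (g - h) x := by
      refine (ShortExact.pointwise hS (op (x.obj 0), x.obj (Fin.last _))).2.1 _ ?_
      refine congrFun (?_ : πc j (g - h) = 0) x
      rw [map_sub, hh, sub_self]
    choose l hl using hl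
    have hl' : ηc j l = g - h := funext hl
    refine ⟨l, fun x hx => hη _ ?_, hηc _ ?_⟩
    · rw [hl, map_zero]
      exact (congrArg₂ (fun y z => y - z) (hge x hx) (hhe x hx)).trans (sub_zero _)
    · refine (cochainMap_app_d η l).trans ?_
      refine (congrArg (cochainD _ j) hl').trans ?_
      rw [map_sub, hg, hhd, sub_zero]

end Coinduced

end Relative

/-! ### Invariance of Hochschild cohomology under retractions of functors -/

section Triangle

universe u' v'

/-- The cochain `f` is a coboundary; in degree zero this means `f = 0`. -/
def IsCoboundary {C : Type u} [Category.{v} C] {B : Cᵒᵖ × C ⥤ AddCommGrpCat.{w}} (m : ℕ) :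
    Cochain B m → Prop :=
  match m with
  | 0 => fun f => f = 0
  | m + 1 => fun f => ∃ g : Cochain B m, cochainD B m g = f

variable {C : Type u} [Category.{v} C] {D : Type u'} [Category.{v'} D] {Φ Ψ : D ⥤ C}
  (ι : Φ ⟶ Ψ) (p : Ψ ⟶ Φ)

section

variable (B : Cᵒᵖ × C ⥤ AddCommGrpCat.{w})

/-- The map `B(Ψ U, Ψ V) → B(Φ U, Φ V)` induced by `ι` and `p`. -/
def restrictMap (X : Dᵒᵖ × D) : (restrict Ψ B).obj X →+ (restrict Φ B).obj X :=
  (B.map (X := (op (Ψ.obj X.1.unop), Ψ.obj X.2)) (Y := (op (Φ.obj X.1.unop), Φ.obj X.2))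
    ((ι.app X.1.unop).op, p.app X.2)).hom

lemma restrictMap_naturality {X Y : Dᵒᵖ × D} (k : X ⟶ Y) (b : (restrict Ψ B).obj X) :
    restrictMap ι p B Y (((restrict Ψ B).map k).hom b) =
      ((restrict Φ B).map k).hom (restrictMap ι p B X b) := by
  have h₁ := map_comp_hom B (X := (op (Ψ.obj X.1.unop), Ψ.obj X.2))
    (Y := (op (Ψ.obj Y.1.unop), Ψ.obj Y.2)) (Z := (op (Φ.obj Y.1.unop), Φ.obj Y.2))
    ((Ψ.map k.1.unop).op, Ψ.map k.2) ((ι.app Y.1.unop).op, p.app Y.2) b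
  have h₂ := map_comp_hom B (X := (op (Ψ.obj X.1.unop), Ψ.obj X.2))
    (Y := (op (Φ.obj X.1.unop), Φ.obj X.2)) (Z := (op (Φ.obj Y.1.unop), Φ.obj Y.2))
    ((ι.app X.1.unop).op, p.app X.2) ((Φ.map k.1.unop).op, Φ.map k.2) b
  refine h₁.symm.trans (Eq.trans ?_ h₂)
  refine congrArg (fun g => (B.map g).hom b) (Prod.ext ?_ ?_)
  · exact Quiver.Hom.unop_inj (ι.naturality k.1.unop).symm
  · exact p.naturality k.2

variable (Φ) in
/-- The map `cochainsMap` as a map of cochains. -/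
def cochainRestrict (m : ℕ) : Cochain B m →+ Cochain (restrict Φ B) m := cochainsMap Φ B m

variable (Φ) in
lemma cochainRestrict_d (m : ℕ) (f : Cochain B m) : cochainRestrict Φ B (m + 1) (cochainD B m f) =
    cochainD (restrict Φ B) m (cochainRestrict Φ B m f) :=
  cochainsMap_d Φ B m f

/-- The difference of the two cochains on `D` that `Φ` and `Ψ` induce from a cochain on `C`; the
values of the second one are transported to `B(Φ U, Φ V)` along `ι` and `p`. -/
def restrictDifference (m : ℕ) : Cochain B m →+ Cochain (restrict Φ B) m :=
  cochainRestrict Φ B m - (cochainMap (restrictMap ι p B) m).comp (cochainRestrict Ψ B m)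

lemma restrictDifference_d (m : ℕ) (f : Cochain B m) :
    restrictDifference ι p B (m + 1) (cochainD B m f) =
      cochainD (restrict Φ B) m (restrictDifference ι p B m f) := by
  simp only [restrictDifference, AddMonoidHom.sub_apply, AddMonoidHom.comp_apply, map_sub,
    cochainRestrict_d, cochainMap_d _ (restrictMap_naturality ι p B)]

/-- The map `restrictDifference` is natural in the bifunctor. -/
lemma restrictDifference_app {B B' : Cᵒᵖ × C ⥤ AddCommGrpCat.{w}} (τ : B ⟶ B') (m : ℕ)
    (f : Cochain B m) :
    restrictDifference ι p B' m (cochainMap (fun X => (τ.app X).hom) m f) =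
      cochainMap (fun X => ((Functor.whiskerLeft (Φ.op.prod Φ) τ).app X).hom) m
        (restrictDifference ι p B m f) := by
  funext x
  refine Eq.trans ?_ (map_sub (τ.app _).hom _ _).symm
  exact congrArg (fun y => _ - y) (naturality_hom τ _ _).symm

end

variable {ι p}

/-- The case of `isCoboundary_restrictDifference` in which the coefficients have a large universe,
so that coinduced bifunctors are available. In degree zero, a cocycle is an element of the end of
`B`, and the claim follows from `ι ≫ p = 𝟙`; dimension shifting along the embedding of `B` in a
coinduced bifunctor reduces to that case. -/
lemma isCoboundary_restrictDifference_of_universe (hι : ι ≫ p = 𝟙 Φ) (m : ℕ) :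
    ∀ {B : Cᵒᵖ × C ⥤ AddCommGrpCat.{max u v w}} (f : Cochain B m), cochainD B m f = 0 →
      IsCoboundary m (restrictDifference ι p B m f) := by
  induction m with
  | zero =>
    intro B f hf
    funext x
    obtain ⟨z, rfl⟩ := ComposableArrows.mk₀_surjective x
    have e (Θ : D ⥤ C) {U V : C} (α : U ⟶ Θ.obj z) (β : Θ.obj z ⟶ V) :
        evalAt f ((Θ.mapComposableArrows 0).obj (ComposableArrows.mk₀ z)) α β =
          evalAt f (ComposableArrows.mk₀ (Θ.obj z)) α β :=
      evalAt_congr f (x := (Θ.mapComposableArrows 0).obj (ComposableArrows.mk₀ z))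
        (x' := ComposableArrows.mk₀ (Θ.obj z)) (ComposableArrows.ext₀ rfl) (Category.comp_id _)
        (Category.id_comp _)
    have h₁ : cochainRestrict Φ B 0 f (ComposableArrows.mk₀ z) =
        evalAt f (ComposableArrows.mk₀ (Φ.obj z)) (𝟙 _) (𝟙 _) :=
      (evalAt_id f _).symm.trans (e Φ (𝟙 _) (𝟙 _))
    have h₂ : restrictMap ι p B (op z, z) (cochainRestrict Ψ B 0 f (ComposableArrows.mk₀ z)) =
        evalAt f (ComposableArrows.mk₀ (Ψ.obj z)) (ι.app z) (p.app z) := e Ψ _ _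
    have h₃ := map_evalAt f (ComposableArrows.mk₀ (Ψ.obj z)) (𝟙 _) (p.app z) (ι.app z) (𝟙 _)
    have h₄ := map_evalAt f (ComposableArrows.mk₀ (Φ.obj z)) (p.app z) (𝟙 _) (ι.app z) (𝟙 _)
    have h₅ : evalAt f (ComposableArrows.mk₀ (Ψ.obj z)) (𝟙 _) (p.app z) =
      evalAt f (ComposableArrows.mk₀ (Φ.obj z)) (p.app z) (𝟙 _) :=
        map_eq_map_of_cocycle f hf (p.app z)
    rw [h₅] at h₃
    refine sub_eq_zero.2 (h₁.trans (Eq.trans ?_ h₂.symm))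
    refine Eq.trans ?_ (h₄.symm.trans (h₃.trans ?_))
    · refine congrArg₂ (evalAt f _) (NatTrans.congr_app hι z).symm (Category.comp_id _).symm
    · exact congrArg₂ (evalAt f _) (Category.comp_id _) (Category.comp_id _)
  | succ m ih =>
    intro B f hf
    let η := coinducedUnit.{u, v, w} (fun U : C => U) B
    have hη (X : Cᵒᵖ × C) : Function.Injective (η.app X).hom := by
      rw [injective_iff_map_eq_zero]
      intro s hs
      exact (map_id_hom B s).symm.trans (congrFun (congrFun hs X.1.unop) (𝟙 _))
    have hS := shortExact_cokernel_of_injective η hη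
    let π := Limits.cokernel.π η
    have hπη (X) (b) : (π.app X).hom ((η.app X).hom b) = 0 :=
      ConcreteCategory.congr_hom (NatTrans.congr_app (Limits.cokernel.condition η) X) b
    let ηc (m : ℕ) := cochainMap (fun X => (η.app X).hom) m
    let πc (m : ℕ) := cochainMap (fun X => (π.app X).hom) m
    let η' := Functor.whiskerLeft (Φ.op.prod Φ) η
    let π' := Functor.whiskerLeft (Φ.op.prod Φ) π
    let ηc' (m : ℕ) := cochainMap (fun X => (η'.app X).hom) m
    let πc' (m : ℕ) := cochainMap (fun X => (π'.app X).hom) m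
    have hπηc (m : ℕ) (f) : πc m (ηc m f) = 0 := funext fun x => hπη _ _
    have hηc (m : ℕ) : Function.Injective (ηc' m) := fun f g h =>
      funext fun x => hη _ (congrFun h x)
    -- With coinduced coefficients, `f` is the coboundary of `g`.
    let g := contraction m (ηc (m + 1) f)
    have hg : cochainD _ m g = ηc (m + 1) f := cochainD_contraction m _
      ((cochainMap_app_d η f).symm.trans (by rw [hf, map_zero]))
    let Δ := restrictDifference ι p (coinduced.{u, v, w} (fun U : C => U) B) m g
    -- By induction, the difference for the image of `g` in the cokernel is a coboundary, so `Δ`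
    -- agrees modulo `η` with a cocycle.
    have key : ∃ h : Cochain (restrict Φ (coinduced.{u, v, w} (fun U : C => U) B)) m,
        cochainD _ m h = 0 ∧ πc' m h = πc' m Δ := by
      have h := ih (πc m g) (by rw [← cochainMap_app_d π g, hg]; exact hπηc _ _)
      cases m with
      | zero =>
        exact ⟨0, map_zero _, (map_zero _).trans
          ((restrictDifference_app ι p π 0 g).symm.trans h).symm⟩
      | succ m =>
        obtain ⟨k, hk⟩ := h
        choose l hl using fun x : ComposableArrows D m => (ShortExact.pointwise hS
          (op (Φ.obj (x.obj 0)), Φ.obj (x.obj (Fin.last _)))).2.2 (k x)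
        refine ⟨cochainD _ m l, cochainD_cochainD _ _, ?_⟩
        refine (cochainMap_app_d π' l).trans ((congrArg (cochainD _ m) (funext hl)).trans ?_)
        exact hk.trans (restrictDifference_app ι p π (m + 1) g)
    obtain ⟨h, hhd, hh⟩ := key
    choose l hl using fun x : ComposableArrows D m => (ShortExact.pointwise hS
      (op (Φ.obj (x.obj 0)), Φ.obj (x.obj (Fin.last _)))).2.1 ((Δ - h) x)
        (congrFun (by rw [map_sub, hh, sub_self] : πc' m (Δ - h) = 0) x)
    have hl' : ηc' m l = Δ - h := funext hl
    refine ⟨l, hηc _ ?_⟩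
    refine (cochainMap_app_d η' l).trans ((congrArg (cochainD _ m) hl').trans ?_)
    rw [map_sub, hhd, sub_zero]
    refine (restrictDifference_d ι p _ m g).symm.trans ?_
    rw [hg]
    exact restrictDifference_app ι p η (m + 1) f

end Triangle

/-! ### Universes of coefficients -/

section Universe

universe t u' v'

variable {C : Type u} [Category.{v} C]

/-- An enlargement of the universe of the coefficients does not change the cochains. -/
def uliftCochain (B : Cᵒᵖ × C ⥤ AddCommGrpCat.{w}) (m : ℕ) :
    Cochain B m ≃+ Cochain (B ⋙ AddCommGrpCat.uliftFunctor.{t}) m where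
  toFun f x := ULift.up (f x)
  invFun f x := ULift.down (f x)
  map_add' _ _ := rfl

lemma uliftCochain_d (B : Cᵒᵖ × C ⥤ AddCommGrpCat.{w}) (m : ℕ) (f : Cochain B m) :
    uliftCochain.{u, v, w, t} B (m + 1) (cochainD B m f) =
      cochainD _ m (uliftCochain.{u, v, w, t} B m f) := by
  let τ (X : Cᵒᵖ × C) : B.obj X →+ (B ⋙ AddCommGrpCat.uliftFunctor.{t}).obj X :=
    AddEquiv.ulift.symm.toAddMonoidHom
  exact cochainMap_d τ (fun _ _ => rfl) m f

lemma IsCoboundary.of_uliftCochain {B : Cᵒᵖ × C ⥤ AddCommGrpCat.{w}} {m : ℕ} {f : Cochain B m}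
    (h : IsCoboundary m (uliftCochain.{u, v, w, t} B m f)) : IsCoboundary m f := by
  cases m with
  | zero => exact (uliftCochain B 0).injective (h.trans (map_zero _).symm)
  | succ m =>
    obtain ⟨g, hg⟩ := h
    refine ⟨(uliftCochain B m).symm g, (uliftCochain B (m + 1)).injective ?_⟩
    rw [uliftCochain_d, AddEquiv.apply_symm_apply, hg]

variable {D : Type u'} [Category.{v'} D] {Φ Ψ : D ⥤ C} {ι : Φ ⟶ Ψ} {p : Ψ ⟶ Φ}

/-- If `Φ` is a retract of `Ψ`, then the two functors induce the same map in cohomology. -/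
theorem isCoboundary_restrictDifference {B : Cᵒᵖ × C ⥤ AddCommGrpCat.{w}} (hι : ι ≫ p = 𝟙 Φ)
    (m : ℕ) (f : Cochain B m) (hf : cochainD B m f = 0) :
    IsCoboundary m (restrictDifference ι p B m f) :=
  IsCoboundary.of_uliftCochain.{u', v', w, max u v}
    (isCoboundary_restrictDifference_of_universe.{u, v, w} hι m
      (uliftCochain.{u, v, w, max u v} B m f) (by rw [← uliftCochain_d, hf, map_zero]))

end Universe

/-! ### Reversal of strings -/

section Reversal

universe t'

variable {C : Type u} [Category.{v} C]

/-- The string in `C` obtained from a string in `Cᵒᵖ` and an antitone map of indices. -/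
def pullOp {m n : ℕ} {θ : Fin (m + 1) → Fin (n + 1)} (hθ : Antitone θ)
    (x : ComposableArrows Cᵒᵖ n) : ComposableArrows C m where
  obj k := (x.obj (θ k)).unop
  map h := (x.map (homOfLE (hθ (leOfHom h)))).unop
  map_id k := congrArg Quiver.Hom.unop (x.map_id (θ k))
  map_comp h h' := congrArg Quiver.Hom.unop
    (x.map_comp (homOfLE (hθ (leOfHom h'))) (homOfLE (hθ (leOfHom h))))

/-- The string in `Cᵒᵖ` that is the reversal of a string in `C`. -/
def revOp {m : ℕ} (x : ComposableArrows C m) : ComposableArrows Cᵒᵖ m where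
  obj k := op (x.obj k.rev)
  map h := (x.map (homOfLE (Fin.rev_anti (leOfHom h)))).op
  map_id k := congrArg Quiver.Hom.op (x.map_id k.rev)
  map_comp h h' := congrArg Quiver.Hom.op
    (x.map_comp (homOfLE (Fin.rev_anti (leOfHom h'))) (homOfLE (Fin.rev_anti (leOfHom h))))

/-- The bifunctor on `Cᵒᵖ` that corresponds to a bifunctor on `C`, with the variables exchanged. -/
def swapOp (B : Cᵒᵖ × C ⥤ AddCommGrpCat.{w}) : Cᵒᵖᵒᵖ × Cᵒᵖ ⥤ AddCommGrpCat.{w} where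
  obj X := B.obj (X.2, X.1.unop.unop)
  map {X Y} k := B.map (X := (X.2, X.1.unop.unop)) (Y := (Y.2, Y.1.unop.unop))
    (k.2, k.1.unop.unop)
  map_id X := B.map_id (X.2, X.1.unop.unop)
  map_comp {X Y Z} k l := B.map_comp (X := (X.2, X.1.unop.unop)) (Y := (Y.2, Y.1.unop.unop))
    (Z := (Z.2, Z.1.unop.unop)) (k.2, k.1.unop.unop) (l.2, l.1.unop.unop)

variable {B : Cᵒᵖ × C ⥤ AddCommGrpCat.{w}}

/-- The value of the cochain `f` at the string `pullOp hθ x`, transported to the end points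
of `x`. -/
def evalOp {m n : ℕ} (f : Cochain B m) {θ : Fin (m + 1) → Fin (n + 1)} (hθ : Antitone θ)
    (x : ComposableArrows Cᵒᵖ n) : (swapOp B).obj (op (x.obj 0), x.obj (Fin.last n)) :=
  evalAt f (pullOp hθ x) (U := (x.obj (Fin.last n)).unop) (V := (x.obj 0).unop)
    (x.map (homOfLE (Fin.le_last (θ 0)))).unop (x.map (homOfLE (Fin.zero_le (θ (Fin.last m))))).unop

lemma evalOp_congr {m n : ℕ} (f : Cochain B m) {θ θ' : Fin (m + 1) → Fin (n + 1)}
    (h : θ = θ') (hθ : Antitone θ) (hθ' : Antitone θ') (x : ComposableArrows Cᵒᵖ n) :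
    evalOp f hθ x = evalOp f hθ' x := by
  subst h
  rfl

/-- The cochain on `Cᵒᵖ` that corresponds to a cochain on `C`. -/
def reversal (m : ℕ) : Cochain B m →+ Cochain (swapOp B) m where
  toFun f x := evalOp f Fin.rev_anti x
  map_zero' := funext fun _ => map_zero _
  map_add' _ _ := funext fun _ => map_add _ _ _

/-- The inverse of `reversal`. -/
def reversalInv (m : ℕ) (f : Cochain (swapOp B) m) : Cochain B m := fun x =>
  evalAt f (revOp x) (U := op (x.obj (Fin.last m))) (V := op (x.obj 0))
    (x.map (homOfLE (Fin.le_last (Fin.rev 0)))).op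
    (x.map (homOfLE (Fin.zero_le (Fin.rev (Fin.last m))))).op

lemma unop_map_comp {n : ℕ} (x : ComposableArrows Cᵒᵖ n) {i j k : Fin (n + 1)} (h : i ≤ j)
    (h' : j ≤ k) : (x.map (homOfLE h')).unop ≫ (x.map (homOfLE h)).unop =
      (x.map (homOfLE (h.trans h'))).unop :=
  congrArg Quiver.Hom.unop (x.map_comp (homOfLE h) (homOfLE h')).symm

lemma evalAt_pull_of_eq_id {m : ℕ} {B : Cᵒᵖ × C ⥤ AddCommGrpCat.{w}} (f : Cochain B m)
    {θ : Fin (m + 1) →o Fin (m + 1)} (hθ : ∀ k, θ k = k) (x : ComposableArrows C m) :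
    evalAt f (pull θ x) (x.map (homOfLE (Fin.zero_le (θ 0))))
      (x.map (homOfLE (Fin.le_last (θ (Fin.last m))))) = f x := by
  obtain rfl : θ = OrderHom.id := OrderHom.ext _ _ (funext hθ)
  refine Eq.trans ?_ (evalAt_id f x)
  exact congrArg₂ (evalAt f x) (x.map_id 0) (x.map_id (Fin.last m))

/-- The order-preserving map `Fin.rev ∘ Fin.rev`, which is the identity. -/
def revRev (m : ℕ) : Fin (m + 1) →o Fin (m + 1) := ⟨_, Fin.rev_anti.comp Fin.rev_anti⟩

lemma reversal_reversalInv (m : ℕ) (f : Cochain (swapOp B) m) :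
    reversal m (reversalInv m f) = f := by
  funext x
  refine Eq.trans ?_ (evalAt_pull_of_eq_id f (θ := revRev m) Fin.rev_rev x)
  refine (map_evalAt f (revOp (pullOp Fin.rev_anti x)) _ _ (x.map (homOfLE (Fin.zero_le _)))
    (x.map (homOfLE (Fin.le_last _)))).trans ?_
  exact congrArg₂ (evalAt f (pull (revRev m) x)) (x.map_comp _ _).symm (x.map_comp _ _).symm

lemma reversalInv_reversal (m : ℕ) (f : Cochain B m) :
    reversalInv m (reversal m f) = f := by
  funext x
  refine Eq.trans ?_ (evalAt_pull_of_eq_id f (θ := revRev m) Fin.rev_rev x)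
  refine (map_evalAt f (pullOp Fin.rev_anti (revOp x)) _ _ (x.map (homOfLE (Fin.zero_le _)))
    (x.map (homOfLE (Fin.le_last _)))).trans ?_
  exact congrArg₂ (evalAt f (pull (revRev m) x)) (x.map_comp _ _).symm (x.map_comp _ _).symm

/-- Reversal commutes with the differentials up to sign: the `k`-th face becomes the face of index
`m + 1 - k`. -/
lemma reversal_d (m : ℕ) (f : Cochain B m) : reversal (m + 1) (cochainD B m f) =
    (-1 : ℤ) ^ (m + 1) • cochainD (swapOp B) m (reversal m f) := by
  funext x
  have h₁ (k : Fin (m + 2)) : evalAt (reversal m f) (pull (coface k) x)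
      (x.map (homOfLE (Fin.zero_le ((coface k) 0))))
      (x.map (homOfLE (Fin.le_last ((coface k) (Fin.last _))))) =
      evalOp f (fun _ _ h => (coface k).monotone (Fin.rev_anti h) :
        Antitone fun j => coface k (Fin.rev j)) x := by
    refine (map_evalAt f (pullOp Fin.rev_anti (pull (coface k) x)) _ _
      (x.map (homOfLE (Fin.le_last ((coface k) (Fin.last _))))).unop
      (x.map (homOfLE (Fin.zero_le ((coface k) 0)))).unop).trans ?_
    exact congrArg₂ (evalAt f (pullOp _ x)) (unop_map_comp x _ _) (unop_map_comp x _ _)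
  have h₂ (l : Fin (m + 2)) :
      (B.map (X := (op ((pullOp Fin.rev_anti x).obj 0), (pullOp Fin.rev_anti x).obj (Fin.last _)))
        (Y := (op (x.obj (Fin.last (m + 1))).unop, (x.obj 0).unop))
        ((x.map (homOfLE (Fin.le_last (Fin.rev 0)))).unop.op,
          (x.map (homOfLE (Fin.zero_le (Fin.rev (Fin.last (m + 1)))))).unop)).hom
        (evalAt f (pull (coface l) (pullOp Fin.rev_anti x))
          (U := (pullOp Fin.rev_anti x).obj 0)
          (V := (pullOp Fin.rev_anti x).obj (Fin.last (m + 1)))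
          ((pullOp Fin.rev_anti x).map (homOfLE (Fin.zero_le ((coface l) 0))))
          ((pullOp Fin.rev_anti x).map (homOfLE (Fin.le_last ((coface l) (Fin.last _)))))) =
      evalOp f (fun _ _ h => Fin.rev_anti ((coface l).monotone h) :
        Antitone fun j => Fin.rev (coface l j)) x := by
    refine (map_evalAt f (pull (coface l) (pullOp Fin.rev_anti x)) _ _
      (x.map (homOfLE (Fin.le_last (Fin.rev 0)))).unop
      (x.map (homOfLE (Fin.zero_le (Fin.rev (Fin.last (m + 1)))))).unop).trans ?_
    exact congrArg₂ (evalAt f (pullOp _ x)) (unop_map_comp x _ _) (unop_map_comp x _ _)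
  have h₃ (l : Fin (m + 2)) : (fun j : Fin (m + 1) => Fin.rev (coface l.rev j)) =
      fun j => coface l (Fin.rev j) :=
    funext fun j => (Fin.rev_succAbove l.rev j).trans (by rw [Fin.rev_rev]; rfl)
  have hl : reversal (m + 1) (cochainD B m f) x = ∑ l : Fin (m + 2), (-1 : ℤ) ^ (l : ℕ) •
      evalOp f (fun _ _ h => Fin.rev_anti ((coface l).monotone h) :
        Antitone fun j => Fin.rev (coface l j)) x := by
    refine (congrArg _ (cochainD_apply m f (pullOp Fin.rev_anti x))).trans ?_
    refine (map_signed_sum (AddCommGrpCat.Hom.hom (B.map _)) _ _).trans ?_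
    exact Finset.sum_congr rfl fun l _ => congrArg _ (h₂ l)
  have hr : cochainD (swapOp B) m (reversal m f) x = ∑ k : Fin (m + 2), (-1 : ℤ) ^ (k : ℕ) •
      evalOp f (fun _ _ h => (coface k).monotone (Fin.rev_anti h) :
        Antitone fun j => coface k (Fin.rev j)) x :=
    (cochainD_apply m (reversal m f) x).trans
      (Finset.sum_congr rfl fun k _ => congrArg _ (h₁ k))
  refine hl.trans (Eq.trans ?_ (congrArg (fun y => (-1 : ℤ) ^ (m + 1) • y) hr).symm)
  rw [Finset.smul_sum, ← Equiv.sum_comp Fin.revPerm]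
  refine Finset.sum_congr rfl fun k _ => ?_
  rw [smul_smul, ← pow_add]
  refine congrArg₂ (fun (y : ℤ) z => y • z) ?_ (evalOp_congr f (h₃ k) _ _ x)
  have hk : m + 1 + (k : ℕ) = (Fin.revPerm k : ℕ) + 2 * k := by
    simp only [Fin.revPerm_apply, Fin.val_rev]
    omega
  rw [hk, pow_add, pow_mul]
  simp

lemma VanishesAt.reversal {e : C} {m : ℕ} {f : Cochain B m} (hf : VanishesAt e f) :
    VanishesAt (op e) (reversal m f) := fun _ hx =>
  (congrArg _ (hf _ fun _ => congrArg unop (hx _))).trans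
    (map_zero (AddCommGrpCat.Hom.hom (B.map _)))

lemma VanishesAt.reversalInv {e : C} {m : ℕ} {f : Cochain (swapOp B) m}
    (hf : VanishesAt (op e) f) : VanishesAt e (reversalInv m f) := fun _ hx =>
  (congrArg _ (hf _ fun _ => congrArg op (hx _))).trans
    (map_zero (AddCommGrpCat.Hom.hom ((swapOp B).map _)))

lemma IsRelativeCoboundary.of_reversal {e : C} {m : ℕ} {f : Cochain B m}
    (h : IsRelativeCoboundary (op e) m (MatrixMonoidHH.reversal m f)) :
    IsRelativeCoboundary e m f := by
  have hinj (m : ℕ) : Function.Injective (MatrixMonoidHH.reversal (B := B) m) :=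
    Function.LeftInverse.injective (reversalInv_reversal m)
  cases m with
  | zero => exact hinj 0 (h.trans (map_zero _).symm)
  | succ m =>
    obtain ⟨g, hg, hg'⟩ := h
    refine ⟨(-1 : ℤ) ^ (m + 1) • MatrixMonoidHH.reversalInv m g, fun x hx => ?_, hinj _ ?_⟩
    · exact (congrArg (SubNegMonoid.toZSMul.1 _) (hg.reversalInv x hx)).trans (zsmul_zero _)
    · rw [map_zsmul, map_zsmul, reversal_d, reversal_reversalInv, hg', smul_smul, ← pow_add,
        ← two_mul, pow_mul]
      simp

/-- The variant of `isRelativeCoboundary_of_extVanishes` for the second variable. -/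
theorem isRelativeCoboundary_of_extVanishes_right [HasExt.{t'} (Cᵒᵖᵒᵖ ⥤ AddCommGrpCat.{max u v w})]
    {B : Cᵒᵖ × C ⥤ AddCommGrpCat.{max u v w}} {e : C} (j : ℕ)
    (hB : ∀ U, ExtVanishes.{u, v, w, t'} (op (op e)) (unopUnop C ⋙ Prod.sectR U C ⋙ B) j)
    (f : Cochain B j) (hf : cochainD B j f = 0) (hfe : VanishesAt e f) :
    IsRelativeCoboundary e j f := by
  refine IsRelativeCoboundary.of_reversal (isRelativeCoboundary_of_extVanishes.{u, v, w, t'} j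
    (fun V => hB V) _ ?_ hfe.reversal)
  have h := reversal_d j f
  rw [hf, map_zero] at h
  rcases neg_one_pow_eq_or ℤ (j + 1) with h' | h' <;> rw [h'] at h <;> simpa using h.symm

end Reversal

/-! ### Polynomial functors have vanishing deviations -/

section Polynomial

universe u₁ v₁

section Abstract

variable {C : Type u₁} [Category.{v₁} C] [Preadditive C]

/-- An endofunctor `T` that behaves like `V ↦ V ⊕ a`: the maps `u α` and `v β` play the roles of
`(1, α) : X ⟶ X ⊕ a` and `(1, β) : Y ⊕ a ⟶ Y`. -/
structure SplitShift (a : C) where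
  /-- The endofunctor. -/
  T : C ⥤ C
  /-- The projection. -/
  p : T ⟶ 𝟭 C
  /-- The inclusion. -/
  s : 𝟭 C ⟶ T
  /-- The morphism with components `1` and `α`. -/
  u : ∀ {X : C}, (X ⟶ a) → (X ⟶ T.obj X)
  /-- The morphism with components `1` and `β`. -/
  v : ∀ {Y : C}, (a ⟶ Y) → (T.obj Y ⟶ Y)
  s_p : ∀ X : C, s.app X ≫ p.app X = 𝟙 X
  u_p : ∀ {X : C} (α : X ⟶ a), u α ≫ p.app X = 𝟙 X
  s_v : ∀ {Y : C} (β : a ⟶ Y), s.app Y ≫ v β = 𝟙 Y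
  u_T_v : ∀ {X Y : C} (α : X ⟶ a) (β : a ⟶ Y) (g : X ⟶ Y), u α ≫ T.map g ≫ v β = g + α ≫ β

namespace SplitShift

variable {a : C} (S : SplitShift a) (F : C ⥤ AddCommGrpCat.{w})

/-- The inclusion of `Δ F` in `F ∘ T`. -/
def differenceι : difference S.T S.p F ⟶ S.T ⋙ F := Limits.kernel.ι _

/-- The functor `Δ F` is the kernel of `F(T X) → F X` at each object. -/
lemma exists_differenceι_eq {X : C} (y : F.obj (S.T.obj X)) (hy : (F.map (S.p.app X)).hom y = 0) :
    ∃ z, ((S.differenceι F).app X).hom z = y := by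
  have hp (X : C) : Function.Surjective ((Functor.whiskerRight S.p F).app X).hom := fun x =>
    ⟨(F.map (S.s.app X)).hom x, (map_comp_hom F _ _ x).symm.trans
      ((congrArg (fun k => (F.map k).hom x) (S.s_p X)).trans (map_id_hom F x))⟩
  exact (ShortExact.pointwise (shortExact_kernel_of_surjective _ hp) X).2.1 y hy

/-- The difference `F(g + α ≫ β) - F(g)` factors through `(Δ F)(g)`, with factors that do not
depend on `g`. -/
lemma exists_map_add_eq {X Y : C} (α : X ⟶ a) (β : a ⟶ Y) :
    ∃ (l : F.obj X → (difference S.T S.p F).obj X) (r : (difference S.T S.p F).obj Y →+ F.obj Y),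
      ∀ (g : X ⟶ Y) (x : F.obj X), (F.map (g + α ≫ β)).hom x =
        (F.map g).hom x + r (((difference S.T S.p F).map g).hom (l x)) := by
  have hl (x : F.obj X) : ∃ z, ((S.differenceι F).app X).hom z =
      (F.map (S.u α)).hom x - (F.map (S.s.app X)).hom x := by
    refine S.exists_differenceι_eq F _ ?_
    rw [map_sub, ← map_comp_hom, ← map_comp_hom, S.u_p, S.s_p, sub_self]
  choose l hl using hl
  refine ⟨l, (F.map (S.v β)).hom.comp ((S.differenceι F).app Y).hom, fun g x => ?_⟩
  have h : ((S.differenceι F).app Y).hom (((difference S.T S.p F).map g).hom (l x)) =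
      (F.map (S.T.map g)).hom ((F.map (S.u α)).hom x - (F.map (S.s.app X)).hom x) := by
    rw [naturality_hom, hl]
    rfl
  rw [AddMonoidHom.comp_apply, h]
  have hs : S.s.app X ≫ S.T.map g ≫ S.v β = g := by
    have := S.s.naturality_assoc g (S.v β)
    rw [← this, S.s_v]
    exact Category.comp_id _
  rw [map_sub, map_sub, ← map_comp_hom, ← map_comp_hom, ← map_comp_hom, ← map_comp_hom,
    S.u_T_v, hs, add_sub_cancel]

/-- If the `m`-th difference of `F` is zero, then so are its deviations in `m` directions. By
`exists_map_add_eq`, the deviations of `F` are obtained from those of `Δ F` in one direction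
less. -/
lemma deviation_eq_zero {ι : Type*} [DecidableEq ι] (T : Finset ι) :
    ∀ (F : C ⥤ AddCommGrpCat.{w}), Limits.IsZero ((difference S.T S.p)^[T.card] F) →
      ∀ {X Y : C} (p : X ⟶ Y) (f : ι → (X ⟶ Y)), (∀ k, RankOne a (f k)) →
        deviation F T f p = 0 := by
  induction T using Finset.induction_on with
  | empty =>
    intro F hF X Y p f _
    ext x
    have : Subsingleton (F.obj X) := AddCommGrpCat.subsingleton_of_isZero
      ((Functor.isZero_iff F).1 hF X)
    rw [Subsingleton.elim x 0, map_zero, map_zero]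
  | insert j T hj ih =>
    intro F hF X Y p f hf
    rw [Finset.card_insert_of_notMem hj] at hF
    obtain ⟨α, β, hαβ⟩ := hf j
    obtain ⟨l, r, hlr⟩ := S.exists_map_add_eq F α β
    ext x
    have h := DFunLike.congr_fun (ih _ hF p f hf) (l x)
    rw [deviation_apply] at h
    rw [deviation_insert _ _ _ hj, AddMonoidHom.sub_apply, deviation_apply, deviation_apply,
      ← Finset.sum_sub_distrib]
    refine Eq.trans ?_ (neg_eq_zero.2 ((congrArg r h).trans (map_zero r)))
    rw [map_sum, ← Finset.sum_neg_distrib]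
    refine Finset.sum_congr rfl fun U _ => ?_
    rw [map_zsmul, add_right_comm, hαβ, hlr, smul_add, sub_add_cancel_left]

end SplitShift

lemma RankLE.of_retract {a : C} {n : ℕ} {X Y : C} (h : RankLE a n Y) (i : X ⟶ Y) (r : Y ⟶ X)
    (hir : i ≫ r = 𝟙 X) : RankLE a n X := by
  obtain ⟨α, β, h⟩ := h
  refine ⟨fun k => i ≫ α k, fun k => β k ≫ r, ?_⟩
  have e (k : Fin n) : (i ≫ α k) ≫ β k ≫ r = i ≫ (α k ≫ β k) ≫ r := by simp
  simp only [e]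
  rw [← Preadditive.comp_sum, ← Preadditive.sum_comp, h, Category.id_comp, hir]

/-- A sum of copies of `a` is a sum of copies of `a` in the opposite category. -/
def Power.op {a : C} {n : ℕ} (P : Power a n) : Power (Opposite.op a) n where
  obj := Opposite.op P.obj
  ι k := (P.π k).op
  π k := (P.ι k).op
  ι_π_self k := congrArg Quiver.Hom.op (P.ι_π_self k)
  ι_π_ne k l h := congrArg Quiver.Hom.op (P.ι_π_ne l k h.symm)
  total := Quiver.Hom.unop_inj (by simpa using P.total)

lemma RankLE.op {a : C} {n : ℕ} {X : C} (h : RankLE a n X) :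
    RankLE (Opposite.op a) n (Opposite.op X) := by
  obtain ⟨α, β, h⟩ := h
  exact ⟨fun k => (β k).op, fun k => (α k).op, Quiver.Hom.unop_inj (by simpa using h)⟩

lemma DeviationVanishes.unopUnop {a : C} {F : C ⥤ AddCommGrpCat.{w}} {d : ℕ}
    (hF : DeviationVanishes a F d) :
    DeviationVanishes (Opposite.op (Opposite.op a)) (unopUnop C ⋙ F) d := by
  intro X Y p f hf
  ext x
  have h := DFunLike.congr_fun (hF X.unop.unop Y.unop.unop p.unop.unop (fun k => (f k).unop.unop)
    fun k => by
      obtain ⟨α, β, h⟩ := hf k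
      exact ⟨α.unop.unop, β.unop.unop, congrArg (fun g => g.unop.unop) h⟩) x
  rw [deviation_apply] at h ⊢
  refine Eq.trans (Finset.sum_congr rfl fun S _ => ?_) h
  have e : (p + ∑ k ∈ S, f k).unop.unop = p.unop.unop + ∑ k ∈ S, (f k).unop.unop := by simp
  exact congrArg (fun g => (-1 : ℤ) ^ S.card • (F.map g).hom x) e

end Abstract

section Proj

variable (A : Type u) [Ring A]

/-- The `A`-module `A`, as an object of `P(A)`. -/
def line : Proj A :=
  ⟨ModuleCat.of A A, inferInstanceAs (Module.Finite A A), inferInstanceAs (Module.Projective A A)⟩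

/-- The functor `V ↦ V ⊕ A` on `P(A)`. -/
def splitShift : SplitShift (line A) where
  T := shift A
  p := shiftProj A
  s := shiftIncl A
  u α := ObjectProperty.homMk (ModuleCat.ofHom (LinearMap.id.prod α.hom.hom))
  v β := ObjectProperty.homMk (ModuleCat.ofHom (LinearMap.id.coprod β.hom.hom))
  s_p _ := rfl
  u_p _ := rfl
  s_v β := ObjectProperty.hom_ext _ (ModuleCat.hom_ext (LinearMap.ext fun y =>
    (congrArg (fun z => y + z) (map_zero β.hom.hom)).trans (add_zero y)))
  u_T_v _ _ _ := rfl

/-- The functor `V ↦ V ⊕ A` on the opposite category of `P(A)`, where the projection and the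
inclusion exchange their roles. -/
def splitShiftOp : SplitShift (op (line A)) where
  T := (shift A).op
  p := NatTrans.op (shiftIncl A)
  s := NatTrans.op (shiftProj A)
  u α := ((splitShift A).v α.unop).op
  v β := ((splitShift A).u β.unop).op
  s_p X := congrArg Quiver.Hom.op ((splitShift A).s_p X.unop)
  u_p α := congrArg Quiver.Hom.op ((splitShift A).s_v α.unop)
  s_v β := congrArg Quiver.Hom.op ((splitShift A).u_p β.unop)
  u_T_v α β g := Quiver.Hom.unop_inj ((Category.assoc _ _ _).trans
    ((splitShift A).u_T_v β.unop α.unop g.unop))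

variable {A}

lemma IsPolynomialOfDegreeLE.deviationVanishes {F : Proj A ⥤ AddCommGrpCat.{w}} {d : ℕ}
    (hF : IsPolynomialOfDegreeLE A F d) : DeviationVanishes (line A) F d := fun _ _ p f hf =>
  (splitShift A).deviation_eq_zero (Finset.range (d + 1)) F
    (by rw [Finset.card_range]; exact hF) p f hf

lemma IsPolynomialOfDegreeLEOp.deviationVanishes {F : (Proj A)ᵒᵖ ⥤ AddCommGrpCat.{w}} {d : ℕ}
    (hF : IsPolynomialOfDegreeLEOp A F d) : DeviationVanishes (op (line A)) F d :=
  fun _ _ p f hf => (splitShiftOp A).deviation_eq_zero (Finset.range (d + 1)) F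
    (by rw [Finset.card_range]; exact hF) p f hf

variable (A)

instance : Limits.HasBinaryBiproducts (Proj A) where
  has_binary_biproduct X Y := by
    have := X.property.1
    have := X.property.2
    have := Y.property.1
    have := Y.property.2
    let b : Limits.BinaryBicone X Y :=
      { pt := ⟨ModuleCat.of A (X.obj × Y.obj), inferInstanceAs (Module.Finite A (X.obj × Y.obj)),
          inferInstanceAs (Module.Projective A (X.obj × Y.obj))⟩
        fst := ObjectProperty.homMk (ModuleCat.ofHom (LinearMap.fst A X.obj Y.obj))
        snd := ObjectProperty.homMk (ModuleCat.ofHom (LinearMap.snd A X.obj Y.obj))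
        inl := ObjectProperty.homMk (ModuleCat.ofHom (LinearMap.inl A X.obj Y.obj))
        inr := ObjectProperty.homMk (ModuleCat.ofHom (LinearMap.inr A X.obj Y.obj))
        inl_fst := rfl
        inl_snd := rfl
        inr_fst := rfl
        inr_snd := rfl }
    refine ⟨⟨⟨b, Limits.isBinaryBilimitOfTotal b ?_⟩⟩⟩
    refine ObjectProperty.hom_ext _ (ModuleCat.hom_ext (LinearMap.ext fun x => ?_))
    exact Prod.ext (add_zero _) (zero_add _)

/-- The morphisms of `P(A)` are the linear maps. -/
def linearMapHom (X Y : Proj A) : (X ⟶ Y) ≃+ (X.obj →ₗ[A] Y.obj) where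
  toFun f := f.hom.hom
  invFun f := ObjectProperty.homMk (ModuleCat.ofHom f)
  map_add' _ _ := rfl

/-- The module `A^n` is a sum of `n` copies of `A`. -/
def freePower (n : ℕ) : Power (line A) n where
  obj := free A n
  ι k := ObjectProperty.homMk (ModuleCat.ofHom (LinearMap.single A (fun _ => A) k))
  π k := ObjectProperty.homMk (ModuleCat.ofHom (LinearMap.proj k))
  ι_π_self k := ObjectProperty.hom_ext _ (ModuleCat.hom_ext
    (LinearMap.proj_comp_single_same A (fun _ => A) k))
  ι_π_ne k l h := ObjectProperty.hom_ext _ (ModuleCat.hom_ext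
    (LinearMap.proj_comp_single_ne A (fun _ => A) l k h.symm))
  total := by
    apply (linearMapHom A _ _).injective
    rw [map_sum]
    refine LinearMap.ext fun v => ?_
    rw [LinearMap.sum_apply]
    exact Finset.univ_sum_single (v : Fin n → A)

/-- A finitely generated projective module is a retract of some `A^m`. -/
lemma exists_rankLE (X : Proj A) : ∃ m, RankLE (line A) m X := by
  have := X.property.1
  have := X.property.2
  obtain ⟨m, f, g, hf, hg, hfg⟩ := Module.Finite.exists_comp_eq_id_of_projective A X.obj
  let i : X ⟶ free A m := ObjectProperty.homMk (ModuleCat.ofHom g)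
  let r : free A m ⟶ X := ObjectProperty.homMk (ModuleCat.ofHom f)
  have h : i ≫ r = 𝟙 X := ObjectProperty.hom_ext _ (ModuleCat.hom_ext hfg)
  exact ⟨m, (freePower A m).rankLE.of_retract i r h⟩

end Proj

end Polynomial

/-! ### Cohomology of a category and of the endomorphisms of an object -/

section Restriction

universe u' v' t t'

/-- The relative cohomology of `C` modulo the endomorphisms of `e` vanishes in degree `j`. -/
def RelativelyAcyclic {C : Type u} [Category.{v} C] (B : Cᵒᵖ × C ⥤ AddCommGrpCat.{w}) (e : C)
    (j : ℕ) : Prop :=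
  ∀ f : Cochain B j, cochainD B j f = 0 → VanishesAt e f → IsRelativeCoboundary e j f

/-- Extension of a section along an injective map of indices. -/
lemma exists_dependent_extension {α β : Type*} {P : β → Type*} [∀ b, Inhabited (P b)] {φ : α → β}
    (hφ : Function.Injective φ) (g : ∀ a, P (φ a)) : ∃ f : ∀ b, P b, ∀ a, f (φ a) = g a := by
  classical
  refine ⟨fun b => if h : ∃ a, φ a = b then h.choose_spec ▸ g h.choose else default, fun a => ?_⟩
  have h : ∃ a', φ a' = φ a := ⟨a, rfl⟩
  refine (dif_pos h).trans ?_
  have key : ∀ (a' : α) (h' : φ a' = φ a), (h' ▸ g a' : P (φ a)) = g a := by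
    intro a' h'
    obtain rfl := hφ h'
    rfl
  exact key _ _

section Functor

variable {C : Type u} [Category.{v} C] {D : Type u'} [Category.{v'} D] {Φ : D ⥤ C}
  {z₀ : D} {B : Cᵒᵖ × C ⥤ AddCommGrpCat.{w}}

lemma mapComposableArrows_injective [Φ.Faithful] (hD : ∀ z, z = z₀) (m : ℕ) :
    Function.Injective (Φ.mapComposableArrows m).obj := by
  intro x y h
  refine CategoryTheory.Functor.ext (fun k => (hD _).trans (hD _).symm) fun k l q => ?_
  apply Φ.map_injective
  rw [Φ.map_comp, Φ.map_comp, eqToHom_map, eqToHom_map]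
  exact Functor.congr_hom h q

lemma exists_mapComposableArrows_eq [Φ.Full] [Φ.Faithful] {m : ℕ} (x : ComposableArrows C m)
    (hx : ∀ k, x.obj k = Φ.obj z₀) : ∃ y, (Φ.mapComposableArrows m).obj y = x := by
  refine ⟨{ obj := fun _ => z₀
            map := fun {k l} q => Φ.preimage (eqToHom (hx k).symm ≫ x.map q ≫ eqToHom (hx l))
            map_id := fun k => Φ.map_injective (by simp)
            map_comp := fun q q' => Φ.map_injective (by simp) }, ?_⟩
  refine CategoryTheory.Functor.ext (fun k => (hx k).symm) fun k l q => ?_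
  exact Φ.map_preimage _

/-- Cochains are arbitrary families, so a cochain on the subcategory can be extended. -/
lemma cochainRestrict_surjective [Φ.Faithful] (hD : ∀ z, z = z₀) (m : ℕ) :
    Function.Surjective (cochainRestrict Φ B m) := by
  intro g
  have : ∀ x : ComposableArrows C m, Inhabited (B.obj (op (x.obj 0), x.obj (Fin.last m))) :=
    fun x => ⟨0⟩
  obtain ⟨f, hf⟩ := exists_dependent_extension
    (P := fun x : ComposableArrows C m => B.obj (op (x.obj 0), x.obj (Fin.last m)))
    (mapComposableArrows_injective (Φ := Φ) hD m) g
  exact ⟨f, funext hf⟩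

lemma vanishesAt_of_cochainRestrict_eq_zero [Φ.Full] [Φ.Faithful] {m : ℕ} {f : Cochain B m}
    (hf : cochainRestrict Φ B m f = 0) : VanishesAt (Φ.obj z₀) f := by
  intro x hx
  obtain ⟨y, rfl⟩ := exists_mapComposableArrows_eq x hx
  exact congrFun hf y

lemma cochainRestrict_eq_zero_of_vanishesAt (hD : ∀ z, z = z₀) {m : ℕ} {f : Cochain B m}
    (hf : VanishesAt (Φ.obj z₀) f) : cochainRestrict Φ B m f = 0 :=
  funext fun _ => hf _ fun _ => congrArg Φ.obj (hD _)

/-- Restriction to a full subcategory with one object is injective in cohomology of degree `i` if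
the relative cohomology of degree `i` vanishes. -/
lemma isCoboundary_of_cochainRestrict [Φ.Faithful] (hD : ∀ z, z = z₀) [Φ.Full] {i : ℕ}
    (hB : RelativelyAcyclic B (Φ.obj z₀) i) {f : Cochain B i} (hf : cochainD B i f = 0)
    (h : IsCoboundary i (cochainRestrict Φ B i f)) : IsCoboundary i f := by
  cases i with
  | zero => exact hB f hf (vanishesAt_of_cochainRestrict_eq_zero h)
  | succ i =>
    obtain ⟨g, hg⟩ := h
    obtain ⟨k, rfl⟩ := cochainRestrict_surjective (Φ := Φ) hD i g
    obtain ⟨l, _, hl⟩ := hB (f - cochainD B i k) (by rw [map_sub, hf, cochainD_cochainD, sub_zero])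
      (vanishesAt_of_cochainRestrict_eq_zero
        (by rw [map_sub, cochainRestrict_d, hg, sub_self]))
    exact ⟨l + k, by rw [map_add, hl, sub_add_cancel]⟩

/-- Restriction to a full subcategory with one object is surjective in cohomology of degree `i` if
the relative cohomology of degree `i + 1` vanishes; even each cocycle lifts to a cocycle. -/
lemma exists_cocycle_cochainRestrict_eq [Φ.Faithful] (hD : ∀ z, z = z₀) [Φ.Full] {i : ℕ}
    (hB : RelativelyAcyclic B (Φ.obj z₀) (i + 1)) {g : Cochain (restrict Φ B) i}
    (hg : cochainD _ i g = 0) : ∃ f, cochainD B i f = 0 ∧ cochainRestrict Φ B i f = g := by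
  obtain ⟨k, rfl⟩ := cochainRestrict_surjective (Φ := Φ) hD i g
  obtain ⟨l, hl, hl'⟩ := hB (cochainD B i k) (cochainD_cochainD _ _)
    (vanishesAt_of_cochainRestrict_eq_zero (by rw [cochainRestrict_d, hg]))
  refine ⟨k - l, by rw [map_sub, hl', sub_self], ?_⟩
  rw [map_sub, cochainRestrict_eq_zero_of_vanishesAt hD hl, sub_zero]

end Functor

section ExtVanishing

variable {C : Type u} [Category.{v} C] [Preadditive C] [Limits.HasBinaryBiproducts C]

/-- The vanishing of the groups `Ext(G, F)` for polynomial `F`, when `G` vanishes at `a^n`. -/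
lemma extVanishes_of_deviationVanishes [HasExt.{t'} (C ⥤ AddCommGrpCat.{max u v t})] {a : C}
    (powers : ∀ r, Power a r) (hC : ∀ X : C, ∃ m, RankLE a m X)
    {F : C ⥤ AddCommGrpCat.{max u v t}} {d : ℕ} (hF : DeviationVanishes a F d) {j n : ℕ}
    (hn : d * (j + 1) ≤ n) : ExtVanishes.{u, v, t, t'} (powers n).obj F j := by
  intro G hG k hk e
  refine ext_eq_zero_of_deviationVanishes.{u, v, t, t'} powers hC hF k
    ((Nat.mul_le_mul_left d (Nat.succ_le_succ hk)).trans hn) (fun X hX x => ?_) e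
  obtain ⟨α, β, h⟩ := hX
  rw [← (powers n).lift_comp_desc] at h
  refine (map_id_hom G x).symm.trans ?_
  rw [← h, map_comp_hom]
  exact (congrArg _ (hG _)).trans (map_zero _)

end ExtVanishing

section Proj

variable {A : Type u} [Ring A]

/-- The bifunctor `B` is polynomial of degree at most `d` in one of its variables, in terms of
deviations. -/
def DeviationVanishesInOneVariable (B : (Proj A)ᵒᵖ × Proj A ⥤ AddCommGrpCat.{w}) (d : ℕ) : Prop :=
  (∀ V : Proj A, DeviationVanishes (op (line A)) (Prod.sectL (Proj A)ᵒᵖ V ⋙ B) d) ∨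
    (∀ U : (Proj A)ᵒᵖ, DeviationVanishes (line A) (Prod.sectR U (Proj A) ⋙ B) d)

lemma exists_rankLE_op (X : (Proj A)ᵒᵖ) : ∃ m, RankLE (op (line A)) m X := by
  obtain ⟨m, h⟩ := exists_rankLE A X.unop
  exact ⟨m, h.op⟩

/-- The case of `relativelyAcyclic` in which the coefficients have a large universe. -/
lemma relativelyAcyclic_of_universe {B : (Proj A)ᵒᵖ × Proj A ⥤ AddCommGrpCat.{max (u + 1) w}}
    {d : ℕ} (hB : DeviationVanishesInOneVariable B d) {j n : ℕ} (hn : d * (j + 1) ≤ n) :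
    RelativelyAcyclic B (free A n) j := by
  intro f hf hfe
  rcases hB with hB | hB
  · have := hasExt_functor.{u + 1, u, w} (C := (Proj A)ᵒᵖ)
    refine isRelativeCoboundary_of_extVanishes.{u + 1, u, w, max (u + 1) w} j (fun V => ?_) f hf hfe
    exact extVanishes_of_deviationVanishes (fun r => (freePower A r).op) exists_rankLE_op (hB V) hn
  · have := hasExt_functor.{u + 1, u, w} (C := (Proj A)ᵒᵖᵒᵖ)
    refine isRelativeCoboundary_of_extVanishes_right.{u + 1, u, w, max (u + 1) w} j
      (fun U => ?_) f hf hfe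
    exact extVanishes_of_deviationVanishes (fun r => (freePower A r).op.op)
      (fun X => (exists_rankLE_op X.unop).imp fun _ h => h.op) (hB U).unopUnop hn

/-- Relative acyclicity can be checked after an enlargement of the universe of the coefficients. -/
lemma relativelyAcyclic_of_uliftFunctor {C : Type u} [Category.{v} C]
    {B : Cᵒᵖ × C ⥤ AddCommGrpCat.{w}} {e : C} {j : ℕ}
    (hB : RelativelyAcyclic (B ⋙ AddCommGrpCat.uliftFunctor.{t}) e j) :
    RelativelyAcyclic B e j := by
  intro f hf hfe
  have h := hB (uliftCochain.{u, v, w, t} B j f) (by rw [← uliftCochain_d, hf, map_zero])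
    fun x hx => congrArg ULift.up (hfe x hx)
  cases j with
  | zero => exact (uliftCochain B 0).injective (h.trans (map_zero _).symm)
  | succ j =>
    obtain ⟨g, hg, hg'⟩ := h
    refine ⟨(uliftCochain B j).symm g, fun x hx => congrArg ULift.down (hg x hx),
      (uliftCochain B (j + 1)).injective ?_⟩
    rw [uliftCochain_d, AddEquiv.apply_symm_apply, hg']

lemma DeviationVanishes.uliftFunctor {C : Type u} [Category.{v} C] [Preadditive C] {a : C}
    {F : C ⥤ AddCommGrpCat.{w}} {d : ℕ} (hF : DeviationVanishes a F d) :
    DeviationVanishes a (F ⋙ AddCommGrpCat.uliftFunctor.{t}) d := by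
  intro X Y p f hf
  refine AddMonoidHom.ext fun x => ?_
  have h := DFunLike.congr_fun (hF X Y p f hf) (ULift.down x)
  rw [deviation_apply] at h ⊢
  let φ : F.obj Y ≃+ (F ⋙ AddCommGrpCat.uliftFunctor.{t}).obj Y := AddEquiv.ulift.symm
  refine Eq.trans ?_ ((congrArg φ h).trans (map_zero φ))
  rw [map_sum]
  exact Finset.sum_congr rfl fun S _ => (map_zsmul φ _ _).symm

/-- The restriction from `P(A)` to `M_n(A)` has no relative cohomology in degree `j` with
polynomial coefficients of degree at most `d`, if `d (j + 1) ≤ n`. -/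
theorem relativelyAcyclic {B : (Proj A)ᵒᵖ × Proj A ⥤ AddCommGrpCat.{w}} {d : ℕ}
    (hB : DeviationVanishesInOneVariable B d) {j n : ℕ} (hn : d * (j + 1) ≤ n) :
    RelativelyAcyclic B (free A n) j := by
  refine relativelyAcyclic_of_uliftFunctor.{u + 1, u, w, u + 1}
    (relativelyAcyclic_of_universe.{u, w} (d := d) ?_ hn)
  exact hB.imp (fun h V => (h V).uliftFunctor) (fun h U => (h U).uliftFunctor)

variable (A) in
instance (n : ℕ) : (matrixFunctor A n).Faithful where
  map_injective h := (Matrix.toLinearMapRight' (R := A)).injective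
    (congrArg (fun k => k.hom.hom) h)

variable (A) in
instance (n : ℕ) : (matrixFunctor A n).Full where
  map_surjective f := ⟨(Matrix.toLinearMapRight' (R := A)).symm f.hom.hom,
    ObjectProperty.hom_ext _ (ModuleCat.hom_ext
      ((Matrix.toLinearMapRight' (R := A)).apply_symm_apply f.hom.hom))⟩

end Proj

end Restriction

/-! ### Pontryagin duality between chains and cochains -/

section Duality

universe u' v'

section Characters

/-- The group `ℚ/ℤ`. -/
abbrev RatMod : Type := AddCircle (1 : ℚ)

/-- Characters separate the points outside a subgroup from the subgroup. -/
lemma exists_character_of_notMem {G : Type*} [AddCommGroup G] (N : AddSubgroup G) {z : G}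
    (hz : z ∉ N) : ∃ φ : G →+ RatMod, (∀ y ∈ N, φ y = 0) ∧ φ z ≠ 0 := by
  have h : (QuotientAddGroup.mk z : G ⧸ N) ≠ 0 := fun h => hz ((QuotientAddGroup.eq_zero_iff z).1 h)
  obtain ⟨c, hc⟩ := CharacterModule.exists_character_apply_ne_zero_of_ne_zero h
  refine ⟨AddMonoidHom.comp c (QuotientAddGroup.mk' N), fun y hy => ?_, hc⟩
  exact (congrArg c ((QuotientAddGroup.eq_zero_iff y).2 hy)).trans (map_zero c)

/-- A character that vanishes on the kernel of `f` extends along `f`, as `ℚ/ℤ` is injective. -/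
lemma exists_character_comp_eq {G H : Type*} [AddCommGroup G] [AddCommGroup H] (f : G →+ H)
    (φ : G →+ RatMod) (hφ : ∀ z, f z = 0 → φ z = 0) : ∃ ψ : H →+ RatMod, ψ.comp f = φ := by
  let φ' : G ⧸ f.ker →+ RatMod := QuotientAddGroup.lift f.ker φ hφ
  obtain ⟨ψ, hψ⟩ := CharacterModule.dual_surjective_of_injective
    (QuotientAddGroup.kerLift f).toIntLinearMap (QuotientAddGroup.kerLift_injective f) φ'
  exact ⟨ψ, AddMonoidHom.ext fun z => DFunLike.congr_fun hψ (QuotientAddGroup.mk z)⟩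

end Characters

variable {C : Type u} [Category.{v} C] (B : Cᵒᵖ × C ⥤ AddCommGrpCat.{w})

/-- The bifunctor `(U, V) ↦ Hom(B(V, U), ℚ/ℤ)`. -/
def dual : Cᵒᵖ × C ⥤ AddCommGrpCat.{w} where
  obj X := AddCommGrpCat.of (B.obj (op X.2, X.1.unop) →+ RatMod)
  map {X Y} k := AddCommGrpCat.ofHom (AddMonoidHom.compHom'
    (B.map (X := (op Y.2, Y.1.unop)) (Y := (op X.2, X.1.unop)) (k.2.op, k.1.unop)).hom)
  map_id _ := AddCommGrpCat.hom_ext (AddMonoidHom.ext fun φ => AddMonoidHom.ext fun b =>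
    congrArg φ (map_id_hom B b))
  map_comp {X Y Z} k l := AddCommGrpCat.hom_ext (AddMonoidHom.ext fun φ => AddMonoidHom.ext fun b =>
    congrArg φ (map_comp_hom B (X := (op Z.2, Z.1.unop)) (Y := (op Y.2, Y.1.unop))
      (Z := (op X.2, X.1.unop)) (l.2.op, l.1.unop) (k.2.op, k.1.unop) b))

variable {B} in
/-- The pairing of `B^∨(U, V)` with `B(V, U)`. -/
def dualEval {X : Cᵒᵖ × C} (b : B.obj (op X.2, X.1.unop)) : (dual B).obj X →+ RatMod :=
  AddMonoidHom.eval b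

variable {B} in
lemma dual_ext {X : Cᵒᵖ × C} {φ ψ : (dual B).obj X} (h : ∀ b, dualEval b φ = dualEval b ψ) :
    φ = ψ :=
  AddMonoidHom.ext h

/-- The group of `m`-chains of `C` with coefficients in `B`. -/
abbrev Chain (m : ℕ) : Type _ := (chainComplex B).X m

/-- The differential of the complex of chains. -/
def chainD (m : ℕ) : Chain B (m + 1) →+ Chain B m := ((chainComplex B).d (m + 1) m).hom

variable {B}

open Classical in
/-- The chain supported at a string. -/
def Chain.of {m : ℕ} (x : ComposableArrows C m) (b : B.obj (op (x.obj (Fin.last m)), x.obj 0)) :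
    Chain B m :=
  DirectSum.of (fun x : (nerve C).obj (op ⦋m⦌) => B.obj (op (x.obj (Fin.last _)), x.obj 0)) x b

/-- The cochain of the dual coefficients that corresponds to a character of the group of chains. -/
def toDual {m : ℕ} (φ : Chain B m →+ RatMod) : Cochain (dual B) m := fun x => by
  classical exact φ.comp (DirectSum.of
    (fun x : (nerve C).obj (op ⦋m⦌) => B.obj (op (x.obj (Fin.last _)), x.obj 0)) x)

lemma dualEval_toDual {m : ℕ} (φ : Chain B m →+ RatMod) (x : ComposableArrows C m)
    (b : B.obj (op (x.obj (Fin.last m)), x.obj 0)) :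
    dualEval (X := (op (x.obj 0), x.obj (Fin.last m))) b (toDual φ x) = φ (Chain.of x b) := rfl

lemma Chain.addHom_ext {m : ℕ} {G : Type*} [AddCommGroup G] {φ ψ : Chain B m →+ G}
    (h : ∀ x b, φ (Chain.of x b) = ψ (Chain.of x b)) : φ = ψ := by
  classical
  exact DirectSum.addHom_ext h

lemma toDual_injective {m : ℕ} {φ ψ : Chain B m →+ RatMod} (h : toDual φ = toDual ψ) : φ = ψ :=
  Chain.addHom_ext fun x b => by rw [← dualEval_toDual, ← dualEval_toDual, h]

lemma toDual_surjective {m : ℕ} (f : Cochain (dual B) m) :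
    ∃ φ : Chain B m →+ RatMod, toDual φ = f := by
  classical
  refine ⟨DirectSum.toAddMonoid f, funext fun x => dual_ext fun b => ?_⟩
  exact DirectSum.toAddMonoid_of (β := fun x : (nerve C).obj (op ⦋m⦌) =>
    B.obj (op (x.obj (Fin.last _)), x.obj 0)) f x b

lemma chainD_of {m : ℕ} (x : ComposableArrows C (m + 1))
    (b : B.obj (op (x.obj (Fin.last _)), x.obj 0)) :
    chainD B m (Chain.of x b) = ∑ k : Fin (m + 2), (-1 : ℤ) ^ (k : ℕ) •
      Chain.of (pull (coface k) x) ((B.map (X := (op (x.obj (Fin.last _)), x.obj 0))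
        (Y := (op ((pull (coface k) x).obj (Fin.last m)), (pull (coface k) x).obj 0))
        ((x.map (homOfLE (Fin.le_last _))).op, x.map (homOfLE (Fin.zero_le _)))).hom b) := by
  classical
  refine (chainComplex_d_apply B m _).trans (Finset.sum_congr rfl fun k _ => congrArg _ ?_)
  exact simplicialChains_δ_of B m k x b

/-- The cochain complex of the dual coefficients is the dual of the chain complex. -/
lemma toDual_comp_chainD {m : ℕ} (φ : Chain B m →+ RatMod) :
    toDual (φ.comp (chainD B m)) = cochainD (dual B) m (toDual φ) := by
  funext x
  refine Eq.trans ?_ (cochainD_apply m (toDual φ) x).symm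
  refine dual_ext fun b => ?_
  refine (congrArg φ (chainD_of x b)).trans ?_
  refine (map_signed_sum φ _ _).trans ?_
  let ev := dualEval (B := B) (X := (op (x.obj 0), x.obj (Fin.last (m + 1)))) b
  refine Eq.symm ((map_signed_sum ev (fun k : Fin (m + 2) => (-1 : ℤ) ^ (k : ℕ)) fun k =>
    evalAt (toDual φ) (pull (coface k) x) (x.map (homOfLE (Fin.zero_le ((coface k) 0))))
      (x.map (homOfLE (Fin.le_last ((coface k) (Fin.last _)))))).trans ?_)
  rfl

variable (B) in
/-- The group of cycles of degree `m`. -/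
def cycles (m : ℕ) : AddSubgroup (Chain B m) :=
  match m with
  | 0 => ⊤
  | m + 1 => (chainD B m).ker

lemma cochainD_toDual_eq_zero_iff {m : ℕ} (φ : Chain B m →+ RatMod) :
    cochainD (dual B) m (toDual φ) = 0 ↔ ∀ w, φ (chainD B m w) = 0 := by
  rw [← toDual_comp_chainD]
  exact ⟨fun h w => DFunLike.congr_fun (toDual_injective (ψ := 0) h) w, fun h =>
    congrArg toDual (AddMonoidHom.ext h : φ.comp (chainD B m) = 0)⟩

/-- A character of the group of chains is a coboundary if and only if it vanishes on the cycles, by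
the injectivity of `ℚ/ℤ`. -/
lemma isCoboundary_toDual_iff {m : ℕ} (φ : Chain B m →+ RatMod) :
    IsCoboundary m (toDual φ) ↔ ∀ z ∈ cycles B m, φ z = 0 := by
  cases m with
  | zero =>
    exact ⟨fun h z _ => DFunLike.congr_fun (toDual_injective (ψ := 0) h) z, fun h =>
      congrArg toDual (AddMonoidHom.ext fun z => h z (AddSubgroup.mem_top z) : φ = 0)⟩
  | succ m =>
    constructor
    · rintro ⟨g, hg⟩ z hz
      obtain ⟨ψ, rfl⟩ := toDual_surjective g
      rw [← toDual_comp_chainD] at hg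
      rw [← toDual_injective hg, AddMonoidHom.comp_apply, (AddMonoidHom.mem_ker).1 hz, map_zero]
    · intro h
      obtain ⟨ψ, hψ⟩ := exists_character_comp_eq (chainD B m) φ h
      exact ⟨toDual ψ, by rw [← toDual_comp_chainD, hψ]⟩

section Functor

variable {D : Type u'} [Category.{v'} D] (Φ : D ⥤ C)

variable (B) in
/-- The map `chainsMap` as a map of chains. -/
def chainMap (m : ℕ) : Chain (restrict Φ B) m →+ Chain B m := chainsMap Φ B m

lemma chainMap_of {m : ℕ} (x : ComposableArrows D m)
    (b : (restrict Φ B).obj (op (x.obj (Fin.last m)), x.obj 0)) :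
    chainMap B Φ m (Chain.of x b) = Chain.of ((Φ.mapComposableArrows m).obj x) b :=
  chainsMap_of Φ B m x b

lemma toDual_comp_chainMap {m : ℕ} (φ : Chain B m →+ RatMod) :
    toDual (φ.comp (chainMap B Φ m)) = cochainRestrict Φ (dual B) m (toDual φ) :=
  funext fun x => dual_ext fun b => congrArg φ (chainMap_of Φ x b)

variable {Φ}

/-- Injectivity in cohomology with dual coefficients implies surjectivity in homology. -/
lemma exists_cycle_chainMap_eq {i : ℕ}
    (H : ∀ f : Cochain (dual B) i, cochainD _ i f = 0 →
      IsCoboundary i (cochainRestrict Φ (dual B) i f) → IsCoboundary i f)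
    {z : Chain B i} (hz : z ∈ cycles B i) :
    ∃ y ∈ cycles (restrict Φ B) i, ∃ w, chainMap B Φ i y + chainD B i w = z := by
  -- Otherwise a character separates `z` from the images of cycles and the boundaries. It is then a
  -- cocycle whose restriction along `Φ` is a coboundary.
  by_contra hcon
  have hz' : z ∉ (cycles (restrict Φ B) i).map (chainMap B Φ i) ⊔ (chainD B i).range := by
    intro h
    obtain ⟨_, ⟨y, hy, rfl⟩, _, ⟨w, rfl⟩, h⟩ := AddSubgroup.mem_sup.1 h
    exact hcon ⟨y, hy, w, h⟩
  obtain ⟨φ, hφ, hφz⟩ := exists_character_of_notMem _ hz'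
  refine hφz ((isCoboundary_toDual_iff φ).1 (H _ ((cochainD_toDual_eq_zero_iff φ).2 fun w =>
    hφ _ (AddSubgroup.mem_sup_right ⟨w, rfl⟩)) ?_) z hz)
  rw [← toDual_comp_chainMap]
  exact (isCoboundary_toDual_iff (B := restrict Φ B) _).2 fun y hy =>
    hφ _ (AddSubgroup.mem_sup_left ⟨y, hy, rfl⟩)

/-- Surjectivity in cohomology with dual coefficients implies injectivity in homology. -/
lemma exists_chainD_eq {i : ℕ}
    (H : ∀ g : Cochain (restrict Φ (dual B)) i, cochainD _ i g = 0 →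
      ∃ f, cochainD (dual B) i f = 0 ∧ cochainRestrict Φ (dual B) i f = g)
    {z : Chain (restrict Φ B) i} {w : Chain B (i + 1)} (hz : chainMap B Φ i z = chainD B i w) :
    ∃ y, chainD _ i y = z := by
  -- Otherwise a character vanishes on the boundaries but not on `z`; it extends to a
  -- cocycle on `C`.
  by_contra hcon
  obtain ⟨φ, hφ, hφz⟩ := exists_character_of_notMem (chainD (restrict Φ B) i).range hcon
  obtain ⟨f, hf, hf'⟩ := H (toDual φ) ((cochainD_toDual_eq_zero_iff (B := restrict Φ B) φ).2
    fun w => hφ _ ⟨w, rfl⟩)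
  obtain ⟨ψ, rfl⟩ := toDual_surjective f
  rw [← toDual_comp_chainMap] at hf'
  have h : ψ.comp (chainMap B Φ i) = φ := toDual_injective (B := restrict Φ B) hf'
  refine hφz ?_
  rw [← h, AddMonoidHom.comp_apply, hz]
  exact (cochainD_toDual_eq_zero_iff ψ).1 hf w

end Functor

section Triangle

variable {D : Type u'} [Category.{v'} D] {Φ Ψ : D ⥤ C} (ι : Φ ⟶ Ψ) (p : Ψ ⟶ Φ)

/-- The map `B(Φ U, Φ V) → B(Ψ U, Ψ V)` induced by `p` and `ι`. -/
def extendMap (X : Dᵒᵖ × D) : (restrict Φ B).obj X →+ (restrict Ψ B).obj X :=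
  restrictMap p ι B X

open Classical in
variable (B) in
/-- The map of chains of `D` induced by `extendMap`. -/
def chainExtend (m : ℕ) : Chain (restrict Φ B) m →+ Chain (restrict Ψ B) m :=
  DirectSum.toAddMonoid fun x : (nerve D).obj (op ⦋m⦌) =>
    (DirectSum.of (fun x : (nerve D).obj (op ⦋m⦌) =>
      (restrict Ψ B).obj (op (x.obj (Fin.last _)), x.obj 0)) x).comp (extendMap ι p _)

lemma chainExtend_of {m : ℕ} (x : ComposableArrows D m)
    (b : (restrict Φ B).obj (op (x.obj (Fin.last m)), x.obj 0)) :
    chainExtend B ι p m (Chain.of x b) =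
      Chain.of x (extendMap ι p (op (x.obj (Fin.last m)), x.obj 0) b) := by
  classical
  exact DirectSum.toAddMonoid_of _ _ _

variable {ι p}

/-- If `Φ` is a retract of `Ψ`, then the two functors induce the same map in homology: the dual
statement in cohomology is `isCoboundary_restrictDifference`. -/
lemma exists_chainD_eq_sub (hι : ι ≫ p = 𝟙 Φ) {i : ℕ}
    {z : Chain (restrict Φ B) i} (hz : z ∈ cycles _ i) :
    ∃ w, chainD B i w = chainMap B Φ i z - chainMap B Ψ i (chainExtend B ι p i z) := by
  by_contra hcon
  obtain ⟨φ, hφ, hφz⟩ := exists_character_of_notMem (chainD B i).range hcon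
  have h := isCoboundary_restrictDifference hι i (toDual φ)
    ((cochainD_toDual_eq_zero_iff φ).2 fun w => hφ _ ⟨w, rfl⟩)
  have e : restrictDifference ι p (dual B) i (toDual φ) =
      toDual (B := restrict Φ B) (φ.comp (chainMap B Φ i -
        (chainMap B Ψ i).comp (chainExtend B ι p i))) := by
    funext x
    refine dual_ext (B := restrict Φ B) fun b => ?_
    refine (map_sub (dualEval (B := restrict Φ B) (X := (op (x.obj 0), x.obj (Fin.last i))) b)
      _ _).trans ?_
    refine Eq.trans ?_ (map_sub φ (chainMap B Φ i (Chain.of x b))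
      (chainMap B Ψ i (chainExtend B ι p i (Chain.of x b)))).symm
    refine congrArg₂ (fun y z : RatMod => y - z) (congrArg φ (chainMap_of Φ x b).symm) ?_
    exact congrArg φ ((congrArg (chainMap B Ψ i) (chainExtend_of ι p x b)).trans
      (chainMap_of Ψ x _)).symm
  rw [e] at h
  exact hφz ((isCoboundary_toDual_iff (B := restrict Φ B) _).1 h z hz)

end Triangle

section Deviations

variable {A : Type u} [Ring A] {B : (Proj A)ᵒᵖ × Proj A ⥤ AddCommGrpCat.{w}} {d : ℕ}

/-- Duality exchanges the two variables and preserves the vanishing of deviations. -/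
lemma DeviationVanishesInOneVariable.dual (hB : DeviationVanishesInOneVariable B d) :
    DeviationVanishesInOneVariable (dual B) d := by
  rcases hB with hB | hB
  · refine Or.inr fun U X Y p f hf => AddMonoidHom.ext fun φ => dual_ext (B := B) fun b => ?_
    let b' : (Prod.sectL (Proj A)ᵒᵖ U.unop ⋙ B).obj (op Y) := b
    have h := DFunLike.congr_fun (hB U.unop (op Y) (op X) p.op (fun k => (f k).op) fun k => by
      obtain ⟨α, β, h⟩ := hf k
      exact ⟨β.op, α.op, congrArg Quiver.Hom.op h⟩) b'
    rw [deviation_apply] at h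
    let φ' : B.obj (op X, U.unop) →+ RatMod := φ
    let ev := dualEval (B := B) (X := (U, Y)) b
    refine (congrArg ev (deviation_apply _ _ _ φ)).trans (Eq.trans ?_
      ((congrArg φ' h).trans (map_zero φ')))
    refine (map_sum ev _ _).trans (Eq.trans ?_ (map_sum φ' _ _).symm)
    refine Finset.sum_congr rfl fun S _ => (map_zsmul ev _ _).trans (Eq.trans ?_
      (map_zsmul φ' _ _).symm)
    have e : p.op + ∑ k ∈ S, (f k).op = (p + ∑ k ∈ S, f k).op := by simp
    rw [e]
    rfl
  · refine Or.inl fun V X Y p f hf => AddMonoidHom.ext fun φ => dual_ext (B := B) fun b => ?_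
    let b' : (Prod.sectR (op V) (Proj A) ⋙ B).obj Y.unop := b
    have h := DFunLike.congr_fun (hB (op V) Y.unop X.unop p.unop (fun k => (f k).unop) fun k => by
      obtain ⟨α, β, h⟩ := hf k
      exact ⟨β.unop, α.unop, congrArg Quiver.Hom.unop h⟩) b'
    rw [deviation_apply] at h
    let φ' : B.obj (op V, X.unop) →+ RatMod := φ
    let ev := dualEval (B := B) (X := (Y, V)) b
    refine (congrArg ev (deviation_apply _ _ _ φ)).trans (Eq.trans ?_
      ((congrArg φ' h).trans (map_zero φ')))
    refine (map_sum ev _ _).trans (Eq.trans ?_ (map_sum φ' _ _).symm)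
    refine Finset.sum_congr rfl fun S _ => (map_zsmul ev _ _).trans (Eq.trans ?_
      (map_zsmul φ' _ _).symm)
    have e : p.unop + ∑ k ∈ S, (f k).unop = (p + ∑ k ∈ S, f k).unop := by simp
    rw [e]
    rfl

end Deviations

end Duality

/-! ### Homology of complexes of abelian groups in terms of elements -/

section Elementwise

variable {ι : Type*} {c : ComplexShape ι} {K L : HomologicalComplex AddCommGrpCat.{w} c}

lemma exists_cyclesMk {i : ι} (z : K.X i) (hz : ∀ j, (K.d i j).hom z = 0) :
    ∃ y : K.cycles i, (K.iCycles i).hom y = z := by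
  have h : (ShortComplex.mk (K.iCycles i) (K.d i (c.next i)) (K.iCycles_d i _)).Exact :=
    ShortComplex.exact_of_f_is_kernel _ (K.cyclesIsKernel i _ rfl)
  exact (ShortComplex.ab_exact_iff _).1 h z (hz _)

lemma homologyπ_surjective (i : ι) : Function.Surjective (K.homologyπ i).hom :=
  (AddCommGrpCat.epi_iff_surjective _).1 inferInstance

lemma iCycles_injective (i : ι) : Function.Injective (K.iCycles i).hom :=
  (AddCommGrpCat.mono_iff_injective _).1 inferInstance

lemma d_iCycles_apply {i : ι} (y : K.cycles i) (j : ι) :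
    (K.d i j).hom ((K.iCycles i).hom y) = 0 :=
  ConcreteCategory.congr_hom (K.iCycles_d i j) y

lemma homologyπ_eq_zero_iff {i : ι} (y : K.cycles i) :
    (K.homologyπ i).hom y = 0 ↔ ∃ j w, (K.d j i).hom w = (K.iCycles i).hom y := by
  constructor
  · intro h
    have hS : (ShortComplex.mk (K.toCycles (c.prev i) i) (K.homologyπ i)
        (K.toCycles_comp_homologyπ _ _)).Exact :=
      ShortComplex.exact_of_g_is_cokernel _ (K.homologyIsCokernel _ i rfl)
    obtain ⟨w, hw⟩ := (ShortComplex.ab_exact_iff _).1 hS y h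
    refine ⟨c.prev i, w, ?_⟩
    rw [← hw]
    exact (ConcreteCategory.congr_hom (K.toCycles_i (c.prev i) i) w).symm
  · rintro ⟨j, w, hw⟩
    have h : (K.toCycles j i).hom w = y := iCycles_injective i
      ((ConcreteCategory.congr_hom (K.toCycles_i j i) w).trans hw)
    rw [← h]
    exact ConcreteCategory.congr_hom (K.toCycles_comp_homologyπ j i) w

lemma homologyMap_homologyπ (f : K ⟶ L) {i : ι} (y : K.cycles i) :
    (HomologicalComplex.homologyMap f i).hom ((K.homologyπ i).hom y) =
      (L.homologyπ i).hom ((HomologicalComplex.cyclesMap f i).hom y) :=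
  ConcreteCategory.congr_hom (HomologicalComplex.homologyπ_naturality f i) y

lemma iCycles_cyclesMap (f : K ⟶ L) {i : ι} (y : K.cycles i) :
    (L.iCycles i).hom ((HomologicalComplex.cyclesMap f i).hom y) =
      (f.f i).hom ((K.iCycles i).hom y) :=
  ConcreteCategory.congr_hom (HomologicalComplex.cyclesMap_i f i) y

lemma homologyMap_injective (f : K ⟶ L) (i : ι)
    (h : ∀ z : K.X i, (∀ j, (K.d i j).hom z = 0) → (∃ j w, (L.d j i).hom w = (f.f i).hom z) →
      ∃ j w, (K.d j i).hom w = z) :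
    Function.Injective (HomologicalComplex.homologyMap f i).hom := by
  rw [injective_iff_map_eq_zero]
  intro y hy
  obtain ⟨y, rfl⟩ := homologyπ_surjective i y
  rw [homologyMap_homologyπ, homologyπ_eq_zero_iff, iCycles_cyclesMap] at hy
  exact (homologyπ_eq_zero_iff y).2 (h _ (d_iCycles_apply y) hy)

lemma homologyMap_surjective (f : K ⟶ L) (i : ι)
    (h : ∀ z : L.X i, (∀ j, (L.d i j).hom z = 0) → ∃ y : K.X i, (∀ j, (K.d i j).hom y = 0) ∧
      ∃ j w, (L.d j i).hom w = z - (f.f i).hom y) :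
    Function.Surjective (HomologicalComplex.homologyMap f i).hom := by
  intro z
  obtain ⟨z, rfl⟩ := homologyπ_surjective i z
  obtain ⟨y, hy, hw⟩ := h _ (d_iCycles_apply z)
  obtain ⟨y, rfl⟩ := exists_cyclesMk y hy
  refine ⟨(K.homologyπ i).hom y, ?_⟩
  rw [homologyMap_homologyπ, eq_comm, ← sub_eq_zero, ← map_sub, homologyπ_eq_zero_iff, map_sub,
    iCycles_cyclesMap]
  exact hw

lemma homologyMap_eq (f g : K ⟶ L) (i : ι)
    (h : ∀ z : K.X i, (∀ j, (K.d i j).hom z = 0) →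
      ∃ j w, (L.d j i).hom w = (f.f i).hom z - (g.f i).hom z) :
    HomologicalComplex.homologyMap f i = HomologicalComplex.homologyMap g i := by
  refine AddCommGrpCat.hom_ext (AddMonoidHom.ext fun z => ?_)
  obtain ⟨z, rfl⟩ := homologyπ_surjective i z
  rw [homologyMap_homologyπ, homologyMap_homologyπ, ← sub_eq_zero, ← map_sub,
    homologyπ_eq_zero_iff, map_sub, iCycles_cyclesMap, iCycles_cyclesMap]
  exact h _ (d_iCycles_apply z)

end Elementwise

/-! ### Cycles and boundaries of the standard complexes -/

section Comparison

variable {C : Type u} [Category.{v} C] {B : Cᵒᵖ × C ⥤ AddCommGrpCat.{w}}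

lemma mem_cycles_iff {i : ℕ} (z : Chain B i) :
    z ∈ cycles B i ↔ ∀ j, ((chainComplex B).d i j).hom z = 0 := by
  cases i with
  | zero =>
    refine ⟨fun _ j => ?_, fun _ => AddSubgroup.mem_top z⟩
    rw [(chainComplex B).shape 0 j (by simp)]
    rfl
  | succ i =>
    refine ⟨fun h j => ?_, fun h => h i⟩
    by_cases hj : i = j
    · subst hj; exact h
    · rw [(chainComplex B).shape (i + 1) j (by simpa using fun h => hj h.symm)]
      rfl

lemma exists_boundary_iff {i : ℕ} (z : Chain B i) :
    (∃ j w, ((chainComplex B).d j i).hom w = z) ↔ ∃ w, chainD B i w = z := by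
  refine ⟨?_, fun ⟨w, hw⟩ => ⟨i + 1, w, hw⟩⟩
  rintro ⟨j, w, hw⟩
  by_cases hj : i + 1 = j
  · subst hj; exact ⟨w, hw⟩
  · refine ⟨0, ?_⟩
    rw [(chainComplex B).shape j i (by simpa using hj)] at hw
    rw [← hw, map_zero]
    rfl

lemma cochainD_eq_zero_iff {i : ℕ} (f : Cochain B i) :
    cochainD B i f = 0 ↔ ∀ j, ((cochainComplex B).d i j).hom f = 0 := by
  refine ⟨fun h j => ?_, fun h => h (i + 1)⟩
  by_cases hj : i + 1 = j
  · subst hj; exact h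
  · rw [(cochainComplex B).shape i j (by simpa using hj)]
    rfl

lemma isCoboundary_iff {i : ℕ} (f : Cochain B i) :
    IsCoboundary i f ↔ ∃ j g, ((cochainComplex B).d j i).hom g = f := by
  cases i with
  | zero =>
    refine ⟨fun h => ⟨0, 0, (map_zero _).trans h.symm⟩, ?_⟩
    rintro ⟨j, g, hg⟩
    rw [(cochainComplex B).shape j 0 (by simp)] at hg
    exact hg.symm
  | succ i =>
    refine ⟨fun ⟨g, hg⟩ => ⟨i, g, hg⟩, ?_⟩
    rintro ⟨j, g, hg⟩
    by_cases hj : i = j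
    · subst hj; exact ⟨g, hg⟩
    · refine ⟨0, ?_⟩
      rw [(cochainComplex B).shape j (i + 1) (by simpa using fun h => hj h.symm)] at hg
      rw [← hg, map_zero]
      rfl

end Comparison

/-! ### Comparison of the Hochschild homology of `P(A)` and of `ℤ[M_n(A)]` -/

section Transfer

universe w'

variable {ι : Type*} {c : ComplexShape ι} {K : HomologicalComplex AddCommGrpCat.{w} c}
  {L : HomologicalComplex AddCommGrpCat.{w'} c} (E : ∀ i, K.X i ≃+ L.X i)

/-- The isomorphisms of groups `E i` form an isomorphism of complexes. A morphism of complexes does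
not express this when `K` and `L` live in different universes. -/
def CommutesWithD : Prop :=
  ∀ i j, ∀ z : K.X i, E j ((K.d i j).hom z) = (L.d i j).hom (E i z)

variable {E}

lemma commutesWithD_of_rel
    (h : ∀ i j, c.Rel i j → ∀ z : K.X i, E j ((K.d i j).hom z) = (L.d i j).hom (E i z)) :
    CommutesWithD E := by
  intro i j z
  by_cases hij : c.Rel i j
  · exact h i j hij z
  · rw [K.shape i j hij, L.shape i j hij]
    exact map_zero _

lemma CommutesWithD.cycle_iff (hE : CommutesWithD E) {i : ι} (z : K.X i) :
    (∀ j, (K.d i j).hom z = 0) ↔ ∀ j, (L.d i j).hom (E i z) = 0 :=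
  forall_congr' fun j => by
    rw [← hE]
    exact (map_eq_zero_iff (E j) (E j).injective).symm

lemma CommutesWithD.boundary_iff (hE : CommutesWithD E) {i : ι} (z : K.X i) :
    (∃ j w, (K.d j i).hom w = z) ↔ ∃ j w, (L.d j i).hom w = E i z := by
  refine exists_congr fun j => ⟨fun ⟨w, hw⟩ => ⟨E j w, by rw [← hE, hw]⟩, fun ⟨w, hw⟩ =>
    ⟨(E j).symm w, (E i).injective ?_⟩⟩
  rw [hE, AddEquiv.apply_symm_apply, hw]

end Transfer

section Matrix

variable {A : Type u} [Ring A] (B : (Proj A)ᵒᵖ × Proj A ⥤ AddCommGrpCat.{w}) (n : ℕ)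

/-- The source of the chain map `comparisonChains`. -/
abbrev liftedChainComplex : ChainComplex AddCommGrpCat.{max (u + 1) w} ℕ :=
  (AddCommGrpCat.uliftFunctor.{u + 1}.mapHomologicalComplex _).obj (matrixChainComplex B n)

/-- The target of the cochain map `comparisonCochains`. -/
abbrev liftedCochainComplex : CochainComplex AddCommGrpCat.{max (u + 1) w} ℕ :=
  (AddCommGrpCat.uliftFunctor.{u + 1}.mapHomologicalComplex _).obj (matrixCochainComplex B n)

/-- The identification of the Hochschild chains of `ℤ[M_n(A)]` with those of a one-object
category. -/
def matrixChainsEquiv (i : ℕ) : (liftedChainComplex B n).X i ≃+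
    (chainComplex (restrict (matrixFunctor A n) B)).X i :=
  AddEquiv.ulift.trans (chainsEquiv (restrict (matrixFunctor A n) B) i)

/-- The identification of the Hochschild cochains of `ℤ[M_n(A)]` with those of a one-object
category. -/
def matrixCochainsEquiv (i : ℕ) : (liftedCochainComplex B n).X i ≃+
    (cochainComplex (restrict (matrixFunctor A n) B)).X i :=
  AddEquiv.ulift.trans (cochainsEquiv (restrict (matrixFunctor A n) B) i)

lemma commutesWithD_matrixChainsEquiv : CommutesWithD (matrixChainsEquiv B n) := by
  refine commutesWithD_of_rel fun i j h z => ?_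
  obtain rfl : j + 1 = i := h
  refine Eq.trans ?_ (chainsEquiv_d (restrict (matrixFunctor A n) B) j (ULift.down z))
  refine congrArg (chainsEquiv (restrict (matrixFunctor A n) B) j) ?_
  exact DFunLike.congr_fun (congrArg AddCommGrpCat.Hom.hom (ringChainComplex_d _ _ j))
    (ULift.down z)

lemma commutesWithD_matrixCochainsEquiv : CommutesWithD (matrixCochainsEquiv B n) := by
  refine commutesWithD_of_rel fun i j h z => ?_
  obtain rfl : i + 1 = j := h
  refine Eq.trans ?_ (cochainsEquiv_d (restrict (matrixFunctor A n) B) i (ULift.down z))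
  refine congrArg (cochainsEquiv (restrict (matrixFunctor A n) B) (i + 1)) ?_
  exact DFunLike.congr_fun (congrArg AddCommGrpCat.Hom.hom (ringCochainComplex_d _ _ i))
    (ULift.down z)

lemma comparisonChains_apply (i : ℕ) (z : (liftedChainComplex B n).X i) :
    ((comparisonChains B n).f i).hom z =
      chainMap B (matrixFunctor A n) i (matrixChainsEquiv B n i z) := rfl

lemma matrixCochainsEquiv_comparisonCochains (i : ℕ) (f : Cochain B i) :
    matrixCochainsEquiv B n i (((comparisonCochains B n).f i).hom f) =
      cochainRestrict (matrixFunctor A n) B i f :=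
  (cochainsEquiv (restrict (matrixFunctor A n) B) i).apply_symm_apply _

variable {B n}

lemma homologyMap_comparisonChains_surjective {d i : ℕ}
    (hB : DeviationVanishesInOneVariable B d) (hn : d * (i + 1) ≤ n) :
    Function.Surjective (HomologicalComplex.homologyMap (comparisonChains B n) i).hom := by
  refine homologyMap_surjective _ i fun z hz => ?_
  have hz' : z ∈ cycles B i := (mem_cycles_iff z).2 hz
  obtain ⟨y, hy, w, h⟩ := exists_cycle_chainMap_eq (Φ := matrixFunctor A n) (fun f hf hf' =>
    isCoboundary_of_cochainRestrict (Φ := matrixFunctor A n) (z₀ := OneObj.star _) (fun _ => rfl)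
      (relativelyAcyclic hB.dual hn) hf hf') hz'
  refine ⟨(matrixChainsEquiv B n i).symm y, ?_, i + 1, w, ?_⟩
  · rw [(commutesWithD_matrixChainsEquiv B n).cycle_iff, AddEquiv.apply_symm_apply]
    exact (mem_cycles_iff y).1 hy
  · rw [comparisonChains_apply, AddEquiv.apply_symm_apply, ← h]
    exact (add_sub_cancel_left _ _).symm

lemma homologyMap_comparisonChains_injective {d i : ℕ}
    (hB : DeviationVanishesInOneVariable B d) (hn : d * (i + 2) ≤ n) :
    Function.Injective (HomologicalComplex.homologyMap (comparisonChains B n) i).hom := by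
  refine homologyMap_injective _ i fun z _ hw => ?_
  obtain ⟨w, hw⟩ := (exists_boundary_iff (B := B) _).1 hw
  obtain ⟨y, hy⟩ := exists_chainD_eq (Φ := matrixFunctor A n) (fun g hg =>
    exists_cocycle_cochainRestrict_eq (Φ := matrixFunctor A n) (z₀ := OneObj.star _) (fun _ => rfl)
      (relativelyAcyclic hB.dual hn) hg) hw.symm
  exact ((commutesWithD_matrixChainsEquiv B n).boundary_iff z).2 ⟨i + 1, y, hy⟩

lemma homologyMap_comparisonCochains_injective {d i : ℕ}
    (hB : DeviationVanishesInOneVariable B d) (hn : d * (i + 1) ≤ n) :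
    Function.Injective (HomologicalComplex.homologyMap (comparisonCochains B n) i).hom := by
  refine homologyMap_injective _ i fun f hf hw => ?_
  obtain ⟨j, w, hw⟩ := ((commutesWithD_matrixCochainsEquiv B n).boundary_iff _).1 hw
  refine (isCoboundary_iff (B := B) f).1 ?_
  exact isCoboundary_of_cochainRestrict (Φ := matrixFunctor A n) (z₀ := OneObj.star _)
    (fun _ => rfl) (relativelyAcyclic hB hn) ((cochainD_eq_zero_iff f).2 hf)
    ((isCoboundary_iff (B := restrict (matrixFunctor A n) B) _).2
      ⟨j, w, hw.trans (matrixCochainsEquiv_comparisonCochains B n i f)⟩)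

lemma homologyMap_comparisonCochains_surjective {d i : ℕ}
    (hB : DeviationVanishesInOneVariable B d) (hn : d * (i + 2) ≤ n) :
    Function.Surjective (HomologicalComplex.homologyMap (comparisonCochains B n) i).hom := by
  refine homologyMap_surjective _ i fun g hg => ?_
  rw [(commutesWithD_matrixCochainsEquiv B n).cycle_iff] at hg
  obtain ⟨f, hf, hfg⟩ := exists_cocycle_cochainRestrict_eq (Φ := matrixFunctor A n)
    (z₀ := OneObj.star _) (fun _ => rfl) (relativelyAcyclic hB hn)
    ((cochainD_eq_zero_iff (B := restrict (matrixFunctor A n) B) _).2 hg)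
  refine ⟨f, (cochainD_eq_zero_iff f).1 hf, 0, 0, ?_⟩
  rw [map_zero, eq_comm, sub_eq_zero]
  apply (matrixCochainsEquiv B n i).injective
  rw [matrixCochainsEquiv_comparisonCochains, hfg]

/-- The identification in `homologyComparison` of the homology with that of the lifted complex. -/
lemma bijective_mapHomologyIso_inv (i : ℕ) :
    Function.Bijective ((((matrixChainComplex B n).sc i).mapHomologyIso
      AddCommGrpCat.uliftFunctor.{u + 1}).inv.hom.comp AddEquiv.ulift.symm.toAddMonoidHom) := by
  have h := (ConcreteCategory.bijective_of_isIso (((matrixChainComplex B n).sc i).mapHomologyIso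
    AddCommGrpCat.uliftFunctor.{u + 1}).inv).comp
      (AddEquiv.ulift (α := matrixHH B n i)).symm.bijective
  exact h

/-- The identification in `cohomologyComparison` of the homology with that of the lifted complex. -/
lemma bijective_mapHomologyIso_hom (i : ℕ) :
    Function.Bijective ((AddEquiv.ulift.toAddMonoidHom :
        ULift.{u + 1} (matrixCoHH B n i) →+ matrixCoHH B n i).comp
      (((matrixCochainComplex B n).sc i).mapHomologyIso
        AddCommGrpCat.uliftFunctor.{u + 1}).hom.hom) := by
  have h := (AddEquiv.ulift (α := matrixCoHH B n i)).bijective.comp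
    (ConcreteCategory.bijective_of_isIso (((matrixCochainComplex B n).sc i).mapHomologyIso
      AddCommGrpCat.uliftFunctor.{u + 1}).hom)
  exact h

lemma homologyComparison_surjective {d i : ℕ}
    (hB : DeviationVanishesInOneVariable B d) (hn : d * (i + 1) ≤ n) :
    Function.Surjective (homologyComparison B n i) :=
  (homologyMap_comparisonChains_surjective hB hn).comp (bijective_mapHomologyIso_inv i).2

lemma homologyComparison_bijective {d i : ℕ}
    (hB : DeviationVanishesInOneVariable B d) (hn : d * (i + 2) ≤ n) :
    Function.Bijective (homologyComparison B n i) :=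
  ⟨(homologyMap_comparisonChains_injective hB hn).comp (bijective_mapHomologyIso_inv i).1,
    homologyComparison_surjective hB ((Nat.mul_le_mul_left d (Nat.le_succ _)).trans hn)⟩

lemma cohomologyComparison_injective {d i : ℕ}
    (hB : DeviationVanishesInOneVariable B d) (hn : d * (i + 1) ≤ n) :
    Function.Injective (cohomologyComparison B n i) :=
  (bijective_mapHomologyIso_hom i).1.comp (homologyMap_comparisonCochains_injective hB hn)

lemma cohomologyComparison_bijective {d i : ℕ}
    (hB : DeviationVanishesInOneVariable B d) (hn : d * (i + 2) ≤ n) :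
    Function.Bijective (cohomologyComparison B n i) :=
  ⟨cohomologyComparison_injective hB ((Nat.mul_le_mul_left d (Nat.le_succ _)).trans hn),
    (bijective_mapHomologyIso_hom i).2.comp (homologyMap_comparisonCochains_surjective hB hn)⟩

end Matrix

/-! ### Stabilization -/

section Stabilization

lemma chainMap_comp {C : Type*} [Category* C] {D : Type*} [Category* D] {D' : Type*} [Category* D']
    (Θ : D' ⥤ D) (Φ : D ⥤ C) (B : Cᵒᵖ × C ⥤ AddCommGrpCat.{w}) (i : ℕ)
    (z : Chain (restrict Θ (restrict Φ B)) i) :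
    chainMap B Φ i (chainMap (restrict Φ B) Θ i z) = chainMap B (Θ ⋙ Φ) i z := by
  refine DFunLike.congr_fun (f := (chainMap B Φ i).comp (chainMap (restrict Φ B) Θ i))
    (g := chainMap B (Θ ⋙ Φ) i) (Chain.addHom_ext fun x b => ?_) z
  refine (congrArg (chainMap B Φ i) (chainMap_of (B := restrict Φ B) Θ x b)).trans ?_
  refine (chainMap_of (B := B) Φ ((Θ.mapComposableArrows i).obj x) b).trans ?_
  exact (chainMap_of (B := B) (Θ ⋙ Φ) x b).symm

variable (A : Type u) [Ring A] (n : ℕ)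

/-- The functor between one-object categories given by `g ↦ diag(g, 1)`. -/
def blockFunctor : OneObj (MatrixMonoid A n) ⥤ OneObj (MatrixMonoid A (n + 1)) where
  obj _ := OneObj.star _
  map g := OneObj.hom (blockHom A n g)
  map_id _ := map_one (blockHom A n)
  map_comp g h := (blockHom A n).map_mul' g h

/-- The inclusions `A^n ⟶ A^{n+1}` are compatible with `g ↦ diag(g, 1)`. -/
def blockIncl : matrixFunctor A n ⟶ blockFunctor A n ⋙ matrixFunctor A (n + 1) where
  app _ := inclFirst A n
  naturality _ _ g := (inclFirst_comp A n g).symm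

/-- The projections `A^{n+1} ⟶ A^n` are compatible with `g ↦ diag(g, 1)`. -/
def blockProj : blockFunctor A n ⋙ matrixFunctor A (n + 1) ⟶ matrixFunctor A n where
  app _ := projFirst A n
  naturality _ _ g := comp_projFirst A n g

lemma blockIncl_blockProj : blockIncl A n ≫ blockProj A n = 𝟙 (matrixFunctor A n) := by
  refine NatTrans.ext (funext fun _ => ObjectProperty.hom_ext _ (ModuleCat.hom_ext
    (LinearMap.ext fun v => funext fun k => ?_)))
  change Fin.lastCases (motive := fun _ => (Fin n → A) →ₗ[A] A) 0 (fun a => LinearMap.proj a)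
    k.castSucc v = v k
  rw [Fin.lastCases_castSucc]
  rfl

variable {A} (B : (Proj A)ᵒᵖ × Proj A ⥤ AddCommGrpCat.{w})

/-- The stabilization as a chain map. -/
abbrev stabilizationChains : matrixChainComplex B n ⟶ matrixChainComplex B (n + 1) :=
  ringChainComplexMap (stabCoeff_smul B n) (stabCoeff_op_smul B n)

lemma chainsEquiv_symm_of {M : Type v} [Monoid M] (F : (OneObj M)ᵒᵖ × OneObj M ⥤ AddCommGrpCat.{w})
    {i : ℕ} (x : ComposableArrows (OneObj M) i)
    (b : F.obj (op (x.obj (Fin.last i)), x.obj 0)) :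
    (chainsEquiv F i).symm (Chain.of x b) = (coeffEquiv F b : Coeff F) ⊗ₜ
      PiTensorProduct.tprod ℤ (MonoidAlgebra.of ℤ M ∘ OneObj.arrows x) :=
  chainsToRing_of (MonoidAlgebra.of ℤ M) F (coeffEquiv F) i x b

/-- A map of chains of one-object categories that is induced, on strings, by a homomorphism `ψ` of
monoids and, on coefficients, by `η`, corresponds to the map of Hochschild chains of the monoid
rings induced by `ψ` and `η`. -/
lemma ringChainsMap_chainsEquiv_symm {M M' : Type u} [Monoid M] [Monoid M'] (ψ : M →* M')
    (F : (OneObj M)ᵒᵖ × OneObj M ⥤ AddCommGrpCat.{w})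
    (F' : (OneObj M')ᵒᵖ × OneObj M' ⥤ AddCommGrpCat.{w}) (η : Coeff F →+ Coeff F') {i : ℕ}
    (T : Chain F i →+ Chain F' i)
    (r : ComposableArrows (OneObj M) i → ComposableArrows (OneObj M') i)
    (hr : ∀ x k, OneObj.arrows (r x) k = ψ (OneObj.arrows x k))
    (hT : ∀ x b, T (Chain.of x b) = Chain.of (r x) (η b)) (z : Chain F i) :
    ringChainsMap (MonoidAlgebra.mapDomainRingHom ℤ ψ) η i ((chainsEquiv F i).symm z) =
      (chainsEquiv F' i).symm (T z) := by
  let R := (ringChainsMap (MonoidAlgebra.mapDomainRingHom ℤ ψ) η i).toAddMonoidHom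
  let E := (chainsEquiv F i).symm.toAddMonoidHom
  let E' := (chainsEquiv F' i).symm.toAddMonoidHom
  refine DFunLike.congr_fun (f := R.comp E) (g := E'.comp T)
    (Chain.addHom_ext fun x b => ?_) z
  refine (congrArg R (chainsEquiv_symm_of F x b)).trans ?_
  refine (ringChainsMap_tmul _ _ _ _ _).trans ?_
  refine Eq.symm ((congrArg E' (hT x b)).trans ?_)
  refine (chainsEquiv_symm_of F' _ _).trans ?_
  have h : MonoidAlgebra.of ℤ M' ∘ OneObj.arrows (r x) =
      MonoidAlgebra.mapDomainRingHom ℤ ψ ∘ MonoidAlgebra.of ℤ M ∘ OneObj.arrows x := by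
    funext k
    refine (congrArg (MonoidAlgebra.of ℤ M') (hr x k)).trans ?_
    exact (MonoidAlgebra.mapDomain_single).symm
  rw [h]
  rfl

/-- The map induced on the chains of one-object categories by the functor `blockFunctor` and the
natural transformations `blockIncl` and `blockProj`. -/
def blockChains (i : ℕ) : Chain (restrict (matrixFunctor A n) B) i →+
    Chain (restrict (matrixFunctor A (n + 1)) B) i :=
  (chainMap (restrict (matrixFunctor A (n + 1)) B) (blockFunctor A n) i).comp
    (chainExtend B (blockIncl A n) (blockProj A n) i)

lemma chainExtend_block_of {i : ℕ} (x : ComposableArrows (OneObj (MatrixMonoid A n)) i)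
    (b : (restrict (matrixFunctor A n) B).obj (op (x.obj (Fin.last i)), x.obj 0)) :
    chainExtend B (blockIncl A n) (blockProj A n) i (Chain.of x b) =
      Chain.of (B := restrict (blockFunctor A n ⋙ matrixFunctor A (n + 1)) B) x
        (stabCoeff B n b) :=
  chainExtend_of (B := B) (blockIncl A n) (blockProj A n) x b

lemma blockChains_of {i : ℕ} (x : ComposableArrows (OneObj (MatrixMonoid A n)) i)
    (b : (restrict (matrixFunctor A n) B).obj (op (x.obj (Fin.last i)), x.obj 0)) :
    blockChains n B i (Chain.of x b) =
      Chain.of (((blockFunctor A n).mapComposableArrows i).obj x) (stabCoeff B n b) := by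
  change chainMap (restrict (matrixFunctor A (n + 1)) B) (blockFunctor A n) i
    (chainExtend B (blockIncl A n) (blockProj A n) i (Chain.of x b)) = _
  rw [chainExtend_block_of]
  exact chainMap_of (B := restrict (matrixFunctor A (n + 1)) B) (blockFunctor A n) x
    (stabCoeff B n b)

/-- In terms of strings, stabilization followed by the comparison map is induced by the functor
`blockFunctor A n ⋙ matrixFunctor A (n + 1)`, of which `matrixFunctor A n` is a retract. -/
lemma comparisonChains_stabilizationChains_apply (i : ℕ) (z : (liftedChainComplex B n).X i) :
    ((comparisonChains B (n + 1)).f i).hom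
      ((((AddCommGrpCat.uliftFunctor.{u + 1}.mapHomologicalComplex _).map
        (stabilizationChains n B)).f i).hom z) =
      chainMap B (blockFunctor A n ⋙ matrixFunctor A (n + 1)) i
        (chainExtend B (blockIncl A n) (blockProj A n) i (matrixChainsEquiv B n i z)) := by
  refine Eq.trans ?_ (chainMap_comp (blockFunctor A n) (matrixFunctor A (n + 1)) B i _)
  refine (comparisonChains_apply B (n + 1) i _).trans ?_
  refine congrArg (chainMap B (matrixFunctor A (n + 1)) i) ?_
  have h := ringChainsMap_chainsEquiv_symm (blockHom A n) (restrict (matrixFunctor A n) B)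
    (restrict (matrixFunctor A (n + 1)) B) (stabCoeff B n) (blockChains n B i)
    ((blockFunctor A n).mapComposableArrows i).obj (fun _ _ => rfl) (blockChains_of n B)
    (matrixChainsEquiv B n i z)
  have h' := congrArg (chainsEquiv (restrict (matrixFunctor A (n + 1)) B) i) h
  rw [AddEquiv.apply_symm_apply] at h'
  refine Eq.trans ?_ h'
  refine congrArg (fun y => chainsEquiv (restrict (matrixFunctor A (n + 1)) B) i (ringChainsMap
    (MonoidAlgebra.mapDomainRingHom ℤ (blockHom A n)) (stabCoeff B n) i y)) ?_
  exact ((chainsEquiv (restrict (matrixFunctor A n) B) i).symm_apply_apply (ULift.down z)).symm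

lemma homologyMap_comparisonChains_stabilization (i : ℕ) :
    HomologicalComplex.homologyMap ((AddCommGrpCat.uliftFunctor.{u + 1}.mapHomologicalComplex _).map
      (stabilizationChains n B)) i ≫ HomologicalComplex.homologyMap (comparisonChains B (n + 1)) i =
      HomologicalComplex.homologyMap (comparisonChains B n) i := by
  rw [← HomologicalComplex.homologyMap_comp]
  refine (homologyMap_eq _ _ i fun z hz => ?_).symm
  rw [(commutesWithD_matrixChainsEquiv B n).cycle_iff] at hz
  obtain ⟨w, hw⟩ := exists_chainD_eq_sub (B := B) (blockIncl_blockProj A n)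
    ((mem_cycles_iff (B := restrict (matrixFunctor A n) B) _).2 hz)
  refine ⟨i + 1, w, hw.trans ?_⟩
  exact congrArg₂ (fun y z : Chain B i => y - z) (comparisonChains_apply B n i z).symm
    (comparisonChains_stabilizationChains_apply n B i z).symm

/-- The stabilization morphisms are compatible with the comparison with `P(A)`. -/
lemma homologyComparison_stabilization (i : ℕ) (z : matrixHH B n i) :
    homologyComparison B (n + 1) i (stabilization B n i z) = homologyComparison B n i z := by
  have h := ShortComplex.mapHomologyIso_inv_naturality
    ((HomologicalComplex.shortComplexFunctor _ _ i).map (stabilizationChains n B))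
    AddCommGrpCat.uliftFunctor.{u + 1}
  have h₁ := ConcreteCategory.congr_hom h (ULift.up z)
  have h₂ := ConcreteCategory.congr_hom (homologyMap_comparisonChains_stabilization n B i)
    ((((matrixChainComplex B n).sc i).mapHomologyIso AddCommGrpCat.uliftFunctor.{u + 1}).inv.hom
      (ULift.up z))
  refine Eq.trans ?_ h₂
  exact congrArg (HomologicalComplex.homologyMap (comparisonChains B (n + 1)) i).hom h₁

variable {n B}

/-- The comparison maps for `n` and `n + 1` are surjective and bijective respectively, and
stabilization is compatible with them. -/
lemma stabilization_surjective {d i : ℕ} (hB : DeviationVanishesInOneVariable B d)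
    (hn : d * (i + 2) ≤ n + 1) : Function.Surjective (stabilization B n i) := by
  intro z
  have hn' : d * (i + 1) ≤ n := by
    -- For `d = 0` the bound is void; otherwise `d (i + 2)` exceeds `d (i + 1)` by at least `1`.
    rcases Nat.eq_zero_or_pos d with rfl | hd
    · simp
    · have : d * (i + 2) = d * (i + 1) + d := by ring
      omega
  obtain ⟨y, hy⟩ := homologyComparison_surjective hB hn' (homologyComparison B (n + 1) i z)
  refine ⟨y, (homologyComparison_bijective hB hn).1 ?_⟩
  rw [homologyComparison_stabilization, hy]

lemma stabilization_bijective {d i : ℕ} (hB : DeviationVanishesInOneVariable B d)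
    (hn : d * (i + 2) ≤ n) : Function.Bijective (stabilization B n i) := by
  refine ⟨fun y z h => (homologyComparison_bijective hB hn).1 ?_,
    stabilization_surjective hB (hn.trans (Nat.le_succ n))⟩
  rw [← homologyComparison_stabilization n B i y, ← homologyComparison_stabilization n B i z, h]

end Stabilization

end

end MatrixMonoidHH

theorem mainTheorem4 {A : Type u} [Ring A]
    (B : (Proj A)ᵒᵖ × Proj A ⥤ AddCommGrpCat.{w}) (d : ℕ)
    (hB : (∀ V : Proj A, IsPolynomialOfDegreeLEOp A (Prod.sectL (Proj A)ᵒᵖ V ⋙ B) d) ∨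
      (∀ U : (Proj A)ᵒᵖ, IsPolynomialOfDegreeLE A (Prod.sectR U (Proj A) ⋙ B) d))
    (i n : ℕ) :
    (d * (i + 1) ≤ n → Function.Surjective (homologyComparison B n i)) ∧
    (d * (i + 2) ≤ n → Function.Bijective (homologyComparison B n i)) ∧
    (d * (i + 1) ≤ n → Function.Injective (cohomologyComparison B n i)) ∧
    (d * (i + 2) ≤ n → Function.Bijective (cohomologyComparison B n i)) ∧
    (d * (i + 2) ≤ n + 1 → Function.Surjective (stabilization B n i)) ∧
    (d * (i + 2) ≤ n → Function.Bijective (stabilization B n i)) := by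
  have hB' : DeviationVanishesInOneVariable B d :=
    hB.imp (fun h V => (h V).deviationVanishes) (fun h U => (h U).deviationVanishes)
  exact ⟨homologyComparison_surjective hB', homologyComparison_bijective hB',
    cohomologyComparison_injective hB', cohomologyComparison_bijective hB',
    stabilization_surjective hB', stabilization_bijective hB'⟩
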